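/- Let $L^2_+$ be the space of $f\in L^2(\mathbb S^1)$ (normalized measure $d\theta/2\pi$) with $\hat f(n)=0$ for $n<0$, let $\Pi:L^2(\mathbb S^1)\to L^2_+$ be the orthogonal projector, let $(f|g)=\int f\bar g\,\frac{d\theta}{2\pi}$, and let $H^s_+=H^s(\mathbb S^1)\cap L^2_+$. For $u\in H^s_+$ with $s>\frac12$, define the antilinear operators $H_u(h)=\Pi(u\bar h)$ and $K_u=T_z^*H_u$ on $L^2_+$, where $T_zh=zh$, $z=e^{i\theta}$. For $\tau>0$, the multiplicity of $\tau$ as a singular value of $H_u$ (resp. $K_u$) is $\dim\ker(H_u^2-\tau^2 I)$ (resp. $\dim\ker(K_u^2-\tau^2I)$), and $\tau$ is a singular value if this is not $0$ (multiplicity $0$ means: not a singular value). Let $\alpha\in\mathbb R\setminus\{0\}$, $s>1$, $u_0\in H^s_+$, and let $u:\mathbb R\to H^s_+$ be the solution of the $\alpha$-Szegő equation $$i\partial_tu=\Pi(|u|^2u)+\alpha(u|1),\qquad u(0)=u_0 .$$ Let $\sigma>0$ be a singular value of $K_{u_0}$ of multiplicity $m\ge1$. Let $\sigma_+>\sigma$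 and $\sigma_-<\sigma$ be the closest singular values of $K_{u_0}$ above and below $\sigma$, with $\sigma_+=+\infty$, respectively $\sigma_-=0$, if there is none. Then one of the following holds. 1. $\sigma$ is a singular value of $H_{u(t)}$ of multiplicity $m+1$ for every $t\in\mathbb R$, and $u$ is a solution of the cubic Szegő equation $i\partial_tu=\Pi(|u|^2u)$. 2. There are a closed discrete set $T_c\subset\mathbb R$ and functions $\rho_1,\rho_2$, real analytic on $\mathbb R\setminus T_c$, such that for every $t\notin T_c$: $\rho_1(t)>\sigma>\rho_2(t)$; the singular values of $H_{u(t)}$ in $(\sigma_-,\sigma_+)$ other than $\sigma$ are exactly $\rho_1(t)$ and $\rho_2(t)$, both of multiplicity $1$; and $\sigma$ has multiplicity $m-1$ as a singular value of $H_{u(t)}$. 3. (Degenerate case.) $u$ is a solution of the cubic Szegő equation $i\partial_tu=\Pi(|u|^2u)$, and for every $t\in\mathbb R$, $\sigma$ has multiplicity $m-1$ as a singular value of $H_{u(t)}$, and $H_{u(t)}$ has no singular value in $(\sigma_-,\sigma_+)$ other than, possibly, $\sigma$. -/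

import Mathlib

open MeasureTheory Filter Topology
open scoped ENNReal ComplexConjugate

noncomputable section

namespace AlphaSzego

instance fact_two_pi_pos : Fact (0 < 2 * Real.pi) := ⟨Real.two_pi_pos⟩

/-- The circle `𝕊¹ = ℝ / 2πℤ`. -/
abbrev Circ : Type := AddCircle (2 * Real.pi)

/-- The normalized measure `dθ / 2π` on the circle. -/
abbrev μ : Measure Circ := AddCircle.haarAddCircle

/-- `L²(𝕊¹)` with the normalized measure. -/
abbrev L2 : Type := Lp ℂ 2 μ

/-- The inclusion of the continuous functions in `L²(𝕊¹)`. -/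
def toL2 (f : C(Circ, ℂ)) : L2 := ContinuousMap.toLp 2 μ ℂ f

/-- The Hardy space `L²_+`: square integrable functions without negative frequencies. -/
def hardy : Submodule ℂ L2 where
  carrier := {f | ∀ n : ℤ, n < 0 → fourierCoeff f n = 0}
  add_mem' := by
    intro f g hf hg n hn
    have h : fourierCoeff (f + g : L2) n = fourierCoeff f n + fourierCoeff g n := by
      simp only [← fourierBasis_repr, map_add, lp.coeFn_add, Pi.add_apply]
    rw [h, hf n hn, hg n hn, add_zero]
  zero_mem' := by
    intro n _
    rw [← fourierBasis_repr]
    simp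
  smul_mem' := by
    intro c f hf n hn
    have h : fourierCoeff (c • f : L2) n = c * fourierCoeff f n := by
      simp only [← fourierBasis_repr, map_smul, lp.coeFn_smul, Pi.smul_apply, smul_eq_mul]
    rw [h, hf n hn, mul_zero]

theorem isClosed_hardy : IsClosed (hardy : Set L2) := by
  have h : (hardy : Set L2) = ⋂ n : ℤ, ⋂ _ : n < 0,
      {f : L2 | inner ℂ (fourierLp (T := 2 * Real.pi) 2 n) f = 0} := by
    ext f
    simp only [Set.mem_iInter, Set.mem_ofPred_eq]
    refine forall₂_congr fun n _ => ?_
    rw [← fourierBasis_repr, HilbertBasis.repr_apply_apply, coe_fourierBasis]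
  rw [h]
  exact isClosed_iInter fun n => isClosed_iInter fun _ =>
    isClosed_eq (continuous_const.inner continuous_id) continuous_const

instance completeSpace_hardy : CompleteSpace hardy :=
  isClosed_hardy.completeSpace_coe

/-- The Szegő projector `Π : L² → L²_+`. -/
def szego : L2 →L[ℂ] hardy := hardy.orthogonalProjectionOnto

/-- Multiplication `h ↦ b h` on `L²(𝕊¹)` by a continuous function `b`. -/
def mulL2 (b : C(Circ, ℂ)) : L2 →L[ℂ] L2 :=
  (ContinuousLinearMap.mul ℂ ℂ).holderL μ ∞ 2 2 (ContinuousMap.toLp ∞ μ ℂ b)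

/-- Complex conjugation `h ↦ h̄` on `L²(𝕊¹)`. -/
def conjL2 : L2 →L⋆[ℂ] L2 :=
  ((starL ℂ : ℂ ≃L⋆[ℂ] ℂ) : ℂ →L⋆[ℂ] ℂ).compLpL 2 μ

/-- The Toeplitz operator `T_b h = Π (b h)` on `L²_+`. -/
def toeplitz (b : C(Circ, ℂ)) : hardy →L[ℂ] hardy :=
  szego.comp ((mulL2 b).comp hardy.subtypeL)

/-- The (antilinear) Hankel operator `H_u h = Π (u h̄)` on `L²_+`. -/
def hankel (u : C(Circ, ℂ)) : hardy →L⋆[ℂ] hardy :=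
  szego.comp ((mulL2 u).comp (conjL2.comp hardy.subtypeL))

/-- The shifted Hankel operator `K_u = T_z^* H_u`, where `z = e^{iθ}` on the circle. -/
def shiftedHankel (u : C(Circ, ℂ)) : hardy →L⋆[ℂ] hardy :=
  (ContinuousLinearMap.adjoint (toeplitz (fourier 1))).comp (hankel u)

/-- `ker (A² - τ² I)` for an antilinear operator `A` on `L²_+`; note that `A²` is linear. -/
def eigenspaceSq (A : hardy →L⋆[ℂ] hardy) (τ : ℝ) : Submodule ℂ hardy :=
  Module.End.eigenspace ((A.comp A : hardy →L[ℂ] hardy) : hardy →ₗ[ℂ] hardy) ((τ : ℂ) ^ 2)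

/-- The multiplicity `dim ker (A² - τ² I)` of `τ` as a singular value of `A`; it is `0` when `τ` is
not a singular value of `A`. -/
def multiplicity (A : hardy →L⋆[ℂ] hardy) (τ : ℝ) : Cardinal :=
  Module.rank ℂ (eigenspaceSq A τ)

/-- `τ > 0` is a singular value of `A`: `τ²` is an eigenvalue of `A²`. -/
def IsSingularValue (A : hardy →L⋆[ℂ] hardy) (τ : ℝ) : Prop :=
  0 < τ ∧ eigenspaceSq A τ ≠ ⊥

/-- `σ_-`: the closest singular value of `A` below `σ`, and `0` if there is none. -/
def lowerNeighbor (A : hardy →L⋆[ℂ] hardy) (σ : ℝ) : ℝ :=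
  sSup ({0} ∪ {τ | IsSingularValue A τ ∧ τ < σ})

/-- `σ_+`: the closest singular value of `A` above `σ`, and `+∞` if there is none. -/
def upperNeighbor (A : hardy →L⋆[ℂ] hardy) (σ : ℝ) : EReal :=
  sInf ((fun τ : ℝ => (τ : EReal)) '' {τ | IsSingularValue A τ ∧ σ < τ})

/-- The open interval `(σ_-, σ_+)` between the neighbors of `σ` among the singular values of `A`. -/
def gap (A : hardy →L⋆[ℂ] hardy) (σ : ℝ) : Set ℝ :=
  {τ | lowerNeighbor A σ < τ ∧ (τ : EReal) < upperNeighbor A σ}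

/-- The square of the `H^s` norm, `∑ (1 + n²)^s |f̂(n)|²`, with value `∞` outside `H^s`. -/
def sobolevNormSq (s : ℝ) (f : L2) : ℝ≥0∞ :=
  ∑' n : ℤ, ENNReal.ofReal ((1 + (n : ℝ) ^ 2) ^ s * ‖fourierCoeff f n‖ ^ 2)

/-- The space `H^s_+` for `s > 1/2`; there every class in `H^s` has exactly one continuous
representative, and the elements of `H^s_+` are identified with these. -/
def sobolevPlus (s : ℝ) : Set C(Circ, ℂ) :=
  {u | toL2 u ∈ hardy ∧ sobolevNormSq s (toL2 u) < ∞}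

/-- The right-hand side of `∂ₜ u = -i (Π(|u|² u) + α (u|1))`, where `(u|1) = ∫ u dθ/2π`. -/
def vectorField (α : ℝ) (u : C(Circ, ℂ)) : L2 :=
  -Complex.I • ((szego (toL2 (u * star u * u)) : L2) +
    ((α : ℂ) * ∫ x, u x ∂μ) • toL2 1)

/-- `u : ℝ → H^s_+` (with `s > 1/2`) is a global solution of the `α`-Szegő equation
`i ∂ₜ u = Π(|u|² u) + α (u|1)`, the time derivative being taken in the norm of `H^s`. For `α = 0`
this is the cubic Szegő equation. -/
structure IsSolution (s α : ℝ) (u : ℝ → C(Circ, ℂ)) : Prop where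
  mem : ∀ t : ℝ, u t ∈ sobolevPlus s
  deriv : ∀ t : ℝ, Tendsto
    (fun h : ℝ => sobolevNormSq s
      (((h⁻¹ : ℝ) : ℂ) • (toL2 (u (t + h)) - toL2 (u t)) - vectorField α (u t)))
    (𝓝[≠] 0) (𝓝 0)

end AlphaSzego

end

open AlphaSzego

noncomputable section

namespace AlphaSzego

local notation "⟪" x ", " y "⟫" => inner ℂ x y

/-! ### Multiplication and conjugation on the circle -/

/-! The operator `K_u` does not see the constant part of its symbol, so the term `α (u|1)` drops out
of its evolution: `K_u²` obeys the Lax equation `∂ₜ K_u² = [C_u, K_u²]` of the cubic flow, with `C_u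
= laxOp u` skew-adjoint. In the unitary frame `U(t)` of this equation (`LaxFlow.exists_frame`),
`K_u²` becomes the fixed compact positive operator `A = K_{u₀}²`, and `H_u² = K_u² + (· | u) u`
becomes `A + (· | v) v` with `v = U* u`. Only `v` and `w = U* 1` move, by the closed system
`ModeFlow`.

Off the spectrum of `A`, the eigenvalues of `A + (· | v) v` are the zeros of the secular function `1
+ ((A - l)⁻¹ v | v)`, and they are simple. For `v ≠ 0` this function increases strictly on each gap
of the spectrum; it takes negative values just to the right of an eigenvalue whose eigenspace is not
orthogonal to `v`, and positive values just to the left of it. So a gap between two such eigenvalues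
contains exactly one root. At an eigenvalue of `A` itself the multiplicity drops by one as soon as
`v` is not orthogonal to the eigenspace.

It remains to know when `v(t)` is orthogonal to an eigenspace. Since `(v, w, (v|w), 1)` solves a
quadratic differential equation, `v` is real analytic (`analyticAt_of_quadratic_ode`), so each
component of `v` vanishes identically or only on a closed discrete set. If an eigenspace is
orthogonal to `v` for all times, differentiation gives `α (v|w) (w|x) = 0` for `x` in it; the Hankel
structure, recorded in `HankelTriple`, forbids orthogonality to both `u` and `1`, hence `(u|1) ≡ 0`
and `u` solves the cubic equation. At `σ²` this is case 1, where the eigenvalue gains one dimension.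
If `v` does meet the eigenspace of `σ²` but `(u|1) ≡ 0`, all moments `(K_u²ⁿ u | 1)` vanish, and
then `H_u²` has no eigenvalue that `K_u²` lacks: case 3. Otherwise `v` generically meets the
eigenspaces of `σ²` and of its neighbours, and the two secular roots, analytic by the implicit
function theorem, are the squares of `ρ₁` and `ρ₂`: case 2. Without a lower neighbour, `ker K_u²`
takes its place; without an upper one, the secular function is positive for large `l`. -/

theorem coeFn_toL2 (f : C(Circ, ℂ)) : toL2 f =ᵐ[μ] f := ContinuousMap.coeFn_toLp μ f

theorem coeFn_mulL2 (b : C(Circ, ℂ)) (f : L2) : mulL2 b f =ᵐ[μ] fun x => b x * f x := by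
  have h1 := (ContinuousLinearMap.mul ℂ ℂ).coeFn_holder (r := 2) (ContinuousMap.toLp ∞ μ ℂ b) f
  have h2 := ContinuousMap.coeFn_toLp (p := ∞) (𝕜 := ℂ) μ b
  filter_upwards [h1, h2] with x hx hx2
  rw [← hx2]
  exact hx

theorem coeFn_conjL2 (f : L2) : conjL2 f =ᵐ[μ] fun x => conj (f x) := by
  exact ContinuousLinearMap.coeFn_compLpL _ f

theorem mulL2_mulL2 (a b : C(Circ, ℂ)) (f : L2) : mulL2 a (mulL2 b f) = mulL2 (a * b) f := by
  apply Lp.ext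
  filter_upwards [coeFn_mulL2 a (mulL2 b f), coeFn_mulL2 b f, coeFn_mulL2 (a * b) f]
    with x h1 h2 h3
  rw [h1, h2, h3, ContinuousMap.mul_apply, mul_assoc]

theorem mulL2_one (f : L2) : mulL2 1 f = f := by
  apply Lp.ext
  filter_upwards [coeFn_mulL2 1 f] with x h1
  simp [h1]

theorem mulL2_toL2 (a b : C(Circ, ℂ)) : mulL2 a (toL2 b) = toL2 (a * b) := by
  apply Lp.ext
  filter_upwards [coeFn_mulL2 a (toL2 b), coeFn_toL2 b, coeFn_toL2 (a * b)] with x h1 h2 h3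
  rw [h1, h2, h3, ContinuousMap.mul_apply]

theorem conjL2_toL2 (a : C(Circ, ℂ)) : conjL2 (toL2 a) = toL2 (star a) := by
  apply Lp.ext
  filter_upwards [coeFn_conjL2 (toL2 a), coeFn_toL2 a, coeFn_toL2 (star a)] with x h1 h2 h3
  rw [h1, h2, h3, ContinuousMap.star_apply]
  rfl

theorem conjL2_mulL2 (a : C(Circ, ℂ)) (f : L2) :
    conjL2 (mulL2 a f) = mulL2 (star a) (conjL2 f) := by
  apply Lp.ext
  filter_upwards [coeFn_conjL2 (mulL2 a f), coeFn_mulL2 a f, coeFn_mulL2 (star a) (conjL2 f),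
    coeFn_conjL2 f] with x h1 h2 h3 h4
  rw [h1, h2, h3, h4, map_mul, ContinuousMap.star_apply]
  rfl

theorem conjL2_conjL2 (f : L2) : conjL2 (conjL2 f) = f := by
  apply Lp.ext
  filter_upwards [coeFn_conjL2 (conjL2 f), coeFn_conjL2 f] with x h1 h2
  rw [h1, h2, Complex.conj_conj]

theorem inner_mulL2_left (b : C(Circ, ℂ)) (f g : L2) : ⟪mulL2 b f, g⟫ = ⟪f, mulL2 (star b) g⟫ := by
  rw [L2.inner_def, L2.inner_def]
  apply integral_congr_ae
  filter_upwards [coeFn_mulL2 b f, coeFn_mulL2 (star b) g] with x h1 h2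
  simp only [h1, h2, RCLike.inner_apply, map_mul, ContinuousMap.star_apply]
  rw [RCLike.star_def]; ring

theorem inner_conjL2_left (f g : L2) : ⟪conjL2 f, g⟫ = ⟪conjL2 g, f⟫ := by
  rw [L2.inner_def, L2.inner_def]
  apply integral_congr_ae
  filter_upwards [coeFn_conjL2 f, coeFn_conjL2 g] with x h1 h2
  simp only [h1, h2, RCLike.inner_apply, Complex.conj_conj]
  ring

theorem mulL2_add (a b : C(Circ, ℂ)) : mulL2 (a + b) = mulL2 a + mulL2 b := by
  simp [mulL2]

theorem mulL2_smul (c : ℂ) (b : C(Circ, ℂ)) : mulL2 (c • b) = c • mulL2 b := by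
  simp [mulL2]

theorem norm_mulL2_le (b : C(Circ, ℂ)) : ‖mulL2 b‖ ≤ ‖b‖ := by
  refine ContinuousLinearMap.opNorm_le_bound _ (norm_nonneg _) fun f => ?_
  refine Lp.norm_le_mul_norm_of_ae_le_mul ?_
  filter_upwards [coeFn_mulL2 b f] with x h1
  rw [h1, norm_mul]
  gcongr
  exact b.norm_coe_le_norm x

theorem norm_conjL2 (f : L2) : ‖conjL2 f‖ = ‖f‖ := by
  have h : ∀ f : L2, ‖conjL2 f‖ ≤ ‖f‖ := fun f => by
    refine Lp.norm_le_norm_of_ae_le ?_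
    filter_upwards [coeFn_conjL2 f] with x h1
    rw [h1, RCLike.norm_conj]
  refine le_antisymm (h f) ?_
  conv_lhs => rw [← conjL2_conjL2 f]
  exact h _

theorem toL2_fourier (n : ℤ) : toL2 (fourier n) = fourierLp 2 n := rfl

theorem toL2_one : toL2 1 = fourierLp 2 0 := by
  rw [← toL2_fourier]
  congr 1
  ext x
  simp

theorem fourierCoeff_eq_inner (f : L2) (n : ℤ) :
    fourierCoeff f n = ⟪toL2 (fourier n), f⟫ := by
  rw [toL2_fourier, ← fourierBasis_repr, HilbertBasis.repr_apply_apply, coe_fourierBasis]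

theorem L2_ext {f g : L2} (h : ∀ n : ℤ, ⟪toL2 (fourier n), f⟫ = ⟪toL2 (fourier n), g⟫) :
    f = g := by
  apply fourierBasis.repr.injective
  ext n
  rw [fourierBasis_repr, fourierBasis_repr, fourierCoeff_eq_inner, fourierCoeff_eq_inner, h]

theorem mem_hardy_iff {f : L2} : f ∈ hardy ↔ ∀ n : ℤ, n < 0 → ⟪toL2 (fourier n), f⟫ = 0 := by
  simp only [← fourierCoeff_eq_inner]
  rfl

theorem inner_fourier_fourier (m n : ℤ) :
    ⟪toL2 (fourier m), toL2 (fourier n)⟫ = if m = n then (1 : ℂ) else 0 := by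
  exact orthonormal_iff_ite.1 (orthonormal_fourier (T := 2 * Real.pi)) m n

theorem fourier_mem_hardy {n : ℤ} (hn : 0 ≤ n) : toL2 (fourier n) ∈ hardy := by
  rw [mem_hardy_iff]
  intro m hm
  rw [inner_fourier_fourier, if_neg (by omega)]

theorem one_mem_hardy : toL2 1 ∈ hardy := by
  rw [toL2_one, ← toL2_fourier]
  exact fourier_mem_hardy le_rfl

theorem fourier_mul_fourier (m n : ℤ) :
    (fourier m * fourier n : C(Circ, ℂ)) = fourier (m + n) := by
  ext x
  rw [ContinuousMap.mul_apply, ← fourier_add]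

theorem star_fourier (n : ℤ) : (star (fourier n) : C(Circ, ℂ)) = fourier (-n) := by
  ext x
  rw [fourier_neg, ContinuousMap.star_apply]
  rfl

/-- Vectors whose nonnegative frequencies vanish are orthogonal to the Hardy space. -/
theorem inner_eq_zero_of_mem_hardy {f h : L2}
    (hf : ∀ n : ℤ, 0 ≤ n → ⟪toL2 (fourier n), f⟫ = 0) (hh : h ∈ hardy) : ⟪f, h⟫ = 0 := by
  rw [← HilbertBasis.tsum_inner_mul_inner (fourierBasis (T := 2 * Real.pi)) f h]
  refine (tsum_congr fun n => ?_).trans tsum_zero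
  rw [coe_fourierBasis, ← toL2_fourier]
  rcases lt_or_ge n 0 with hn | hn
  · rw [mem_hardy_iff.1 hh n hn, mul_zero]
  · rw [← inner_conj_symm, hf n hn, map_zero, zero_mul]

/-! ### The Szegő projector -/

theorem inner_szego (f : L2) (h : hardy) : ⟪((szego f : hardy) : L2), (h : L2)⟫ = ⟪f, (h : L2)⟫ := by
  exact Submodule.inner_orthogonalProjectionOnto_eq_of_mem_right h f

theorem inner_szego_right (f : L2) (h : hardy) :
    ⟪(h : L2), ((szego f : hardy) : L2)⟫ = ⟪(h : L2), f⟫ := by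
  rw [← inner_conj_symm, inner_szego, inner_conj_symm]

theorem szego_coe (h : hardy) : szego (h : L2) = h :=
  Submodule.orthogonalProjectionOnto_mem_subspace_eq_self h

theorem szego_of_mem {f : L2} (hf : f ∈ hardy) : ((szego f : hardy) : L2) = f :=
  congrArg Subtype.val (szego_coe ⟨f, hf⟩)

theorem inner_fourier_szego (f : L2) (n : ℤ) :
    ⟪toL2 (fourier n), ((szego f : hardy) : L2)⟫ = if 0 ≤ n then ⟪toL2 (fourier n), f⟫ else 0 := by
  split_ifs with hn
  · exact inner_szego_right f ⟨_, fourier_mem_hardy hn⟩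
  · exact mem_hardy_iff.1 (szego f).2 n (by omega)

theorem norm_szego_le (f : L2) : ‖szego f‖ ≤ ‖f‖ :=
  Submodule.norm_orthogonalProjectionOnto_apply_le hardy f

theorem hardy_ext {f g : hardy} (h : ∀ y : hardy, ⟪y, f⟫ = ⟪y, g⟫) : f = g :=
  ext_inner_left ℂ h

/-- The antiunitary involution `f ↦ conj (z f)` exchanging the Hardy space and its complement. -/
def reflect : L2 →L⋆[ℂ] L2 := (mulL2 (fourier (-1))).comp conjL2

theorem reflect_apply (f : L2) : reflect f = mulL2 (fourier (-1)) (conjL2 f) := rfl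

theorem reflect_mulL2 (b : C(Circ, ℂ)) (f : L2) : reflect (mulL2 b f) = mulL2 (star b) (reflect f) := by
  rw [reflect_apply, reflect_apply, conjL2_mulL2, mulL2_mulL2, mulL2_mulL2,
    mul_comm (star b)]

theorem reflect_reflect (f : L2) : reflect (reflect f) = f := by
  rw [reflect_apply f, reflect_mulL2, reflect_apply, conjL2_conjL2, mulL2_mulL2, star_fourier,
    fourier_mul_fourier, show (fourier (- -1 + -1) : C(Circ, ℂ)) = 1 by ext x; simp, mulL2_one]

theorem reflect_fourier (n : ℤ) : reflect (toL2 (fourier n)) = toL2 (fourier (-1 - n)) := by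
  rw [reflect_apply, conjL2_toL2, mulL2_toL2, star_fourier, fourier_mul_fourier]
  rfl

theorem inner_reflect_left (f g : L2) : ⟪reflect f, g⟫ = ⟪reflect g, f⟫ := by
  rw [reflect_apply, reflect_apply, inner_mulL2_left, inner_conjL2_left, conjL2_mulL2, star_star]

theorem inner_fourier_reflect (f : L2) (n : ℤ) :
    ⟪toL2 (fourier n), reflect f⟫ = conj ⟪toL2 (fourier (-1 - n)), f⟫ := by
  rw [← inner_conj_symm, inner_reflect_left, reflect_fourier]

/-- `(1 - Π) f = conj (z Π (conj (z f)))`. -/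
theorem szego_add_reflect (f : L2) :
    ((szego f : hardy) : L2) + reflect ((szego (reflect f) : hardy) : L2) = f := by
  apply L2_ext
  intro n
  rw [inner_add_right, inner_fourier_szego, inner_fourier_reflect, inner_fourier_szego,
    inner_fourier_reflect]
  split_ifs with h1 h2 h2
  · omega
  · simp
  · rw [zero_add, Complex.conj_conj]; congr 3; ring
  · omega

theorem szego_reflect_coe (h : hardy) : szego (reflect (h : L2)) = 0 := by
  apply Subtype.ext
  apply L2_ext
  intro n
  rw [inner_fourier_szego, inner_fourier_reflect]
  split_ifs with h1
  · rw [mem_hardy_iff.1 h.2 _ (by omega)]; simp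
  · simp

/-- For `n < 0` the function `ū zⁿ` has only negative frequencies, so it is orthogonal to `h`. -/
theorem mulL2_mem_hardy {u : C(Circ, ℂ)} (hu : toL2 u ∈ hardy) (h : hardy) :
    mulL2 u (h : L2) ∈ hardy := by
  rw [mem_hardy_iff]
  intro n hn
  rw [← inner_conj_symm, inner_mulL2_left, inner_conj_symm, mulL2_toL2]
  refine inner_eq_zero_of_mem_hardy (fun k hk => ?_) h.2
  have h1 : toL2 (star u * fourier n) = mulL2 (fourier n) (conjL2 (toL2 u)) := by
    rw [conjL2_toL2, mulL2_toL2, mul_comm]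
  rw [h1, ← inner_conj_symm, inner_mulL2_left, inner_conjL2_left, conjL2_mulL2, conjL2_toL2,
    star_star, mulL2_toL2, star_fourier, fourier_mul_fourier, inner_conj_symm]
  rw [← inner_conj_symm, mem_hardy_iff.1 hu _ (by omega), map_zero]

/-! ### Hankel operators -/

theorem hankel_apply (u : C(Circ, ℂ)) (h : hardy) :
    hankel u h = szego (mulL2 u (conjL2 (h : L2))) := rfl

theorem toeplitz_apply (b : C(Circ, ℂ)) (h : hardy) :
    toeplitz b h = szego (mulL2 b (h : L2)) := rfl

theorem inner_toeplitz_left (b : C(Circ, ℂ)) (x y : hardy) :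
    ⟪toeplitz b x, y⟫ = ⟪x, toeplitz (star b) y⟫ := by
  rw [Submodule.coe_inner, Submodule.coe_inner, toeplitz_apply, toeplitz_apply, inner_szego,
    inner_szego_right, inner_mulL2_left]

theorem adjoint_toeplitz (b : C(Circ, ℂ)) :
    ContinuousLinearMap.adjoint (toeplitz b) = toeplitz (star b) := by
  symm
  rw [ContinuousLinearMap.eq_adjoint_iff]
  intro x y
  rw [inner_toeplitz_left, star_star]

/-- An antianalytic multiplier keeps negative frequencies negative, so the projection of `f`
beforehand changes nothing. The proof is the dual statement, `mulL2_mem_hardy` for `star b`. -/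
theorem toeplitz_mul_szego {b : C(Circ, ℂ)} (hb : toL2 (star b) ∈ hardy) (f : L2) :
    toeplitz b (szego f) = szego (mulL2 b f) := by
  refine hardy_ext fun y => ?_
  rw [Submodule.coe_inner, Submodule.coe_inner, toeplitz_apply, inner_szego_right,
    inner_szego_right]
  have h1 : ∀ g : L2, ⟪(y : L2), mulL2 b g⟫ = ⟪mulL2 (star b) (y : L2), g⟫ := fun g => by
    rw [inner_mulL2_left, star_star]
  rw [h1, h1]
  exact inner_szego_right f ⟨_, mulL2_mem_hardy hb y⟩

theorem fourier_one_mem_hardy : toL2 (fourier 1) ∈ hardy := fourier_mem_hardy zero_le_one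

theorem shiftedHankel_eq_toeplitz (u : C(Circ, ℂ)) (h : hardy) :
    shiftedHankel u h = toeplitz (fourier (-1)) (hankel u h) := by
  have h1 : shiftedHankel u h =
    ContinuousLinearMap.adjoint (toeplitz (fourier 1)) (hankel u h) := rfl
  rw [h1, adjoint_toeplitz, star_fourier]

theorem shiftedHankel_apply (u : C(Circ, ℂ)) (h : hardy) :
    shiftedHankel u h = szego (mulL2 u (reflect (h : L2))) := by
  rw [shiftedHankel_eq_toeplitz, hankel_apply, toeplitz_mul_szego, reflect_apply, mulL2_mulL2,
    mulL2_mulL2, mul_comm u]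
  rw [star_fourier, neg_neg]
  exact fourier_one_mem_hardy

/-- Multiplication by `z` on the Hardy space. -/
theorem coe_toeplitz_fourier_one (h : hardy) :
    ((toeplitz (fourier 1) h : hardy) : L2) = mulL2 (fourier 1) (h : L2) := by
  rw [toeplitz_apply, szego_of_mem (mulL2_mem_hardy fourier_one_mem_hardy h)]

theorem shiftedHankel_eq_hankel (u : C(Circ, ℂ)) (h : hardy) :
    shiftedHankel u h = hankel u (toeplitz (fourier 1) h) := by
  rw [shiftedHankel_apply, hankel_apply, coe_toeplitz_fourier_one, conjL2_mulL2, star_fourier]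
  rfl

theorem inner_hankel (u : C(Circ, ℂ)) (x y : hardy) : ⟪hankel u x, y⟫ = ⟪hankel u y, x⟫ := by
  rw [Submodule.coe_inner, Submodule.coe_inner, hankel_apply, hankel_apply, inner_szego,
    inner_szego, inner_mulL2_left, inner_conjL2_left, conjL2_mulL2, star_star]

theorem inner_shiftedHankel (u : C(Circ, ℂ)) (x y : hardy) :
    ⟪shiftedHankel u x, y⟫ = ⟪shiftedHankel u y, x⟫ := by
  rw [Submodule.coe_inner, Submodule.coe_inner, shiftedHankel_apply, shiftedHankel_apply,
    inner_szego, inner_szego, inner_mulL2_left, inner_reflect_left, reflect_mulL2, star_star]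

/-- The constant function `1` in the Hardy space. -/
def hardyOne : hardy := ⟨toL2 1, one_mem_hardy⟩

theorem hankel_one {u : C(Circ, ℂ)} (hu : toL2 u ∈ hardy) : hankel u hardyOne = ⟨toL2 u, hu⟩ := by
  apply Subtype.ext
  have h : (star (1 : C(Circ, ℂ))) = 1 := star_one _
  rw [hankel_apply, hardyOne, conjL2_toL2, mulL2_toL2, h, mul_one, szego_of_mem hu]

theorem norm_hardyOne : ‖hardyOne‖ = 1 := by
  have h : ‖toL2 1‖ = 1 := by
    rw [toL2_one]
    exact (orthonormal_fourier (T := 2 * Real.pi)).1 0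
  exact h

theorem hardyOne_ne_zero : hardyOne ≠ 0 := by
  intro h
  have := norm_hardyOne
  rw [h, norm_zero] at this
  exact zero_ne_one this

theorem toeplitz_neg_one_hardyOne : toeplitz (fourier (-1)) hardyOne = 0 := by
  apply Subtype.ext
  apply L2_ext
  intro n
  have h1 : (fourier (-1) * 1 : C(Circ, ℂ)) = fourier (-1) := mul_one _
  rw [toeplitz_apply, inner_fourier_szego, hardyOne, mulL2_toL2, h1, inner_fourier_fourier]
  split_ifs with h2 h3
  · omega
  · simp
  · simp

/-- `z T_z^* h = h - (h | 1)`. -/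
theorem toeplitz_one_toeplitz_neg_one (h : hardy) :
    toeplitz (fourier 1) (toeplitz (fourier (-1)) h) = h - ⟪hardyOne, h⟫ • hardyOne := by
  apply Subtype.ext
  apply L2_ext
  intro n
  have h2 : ∀ f : L2, ⟪toL2 (fourier n), mulL2 (fourier 1) f⟫ = ⟪toL2 (fourier (n - 1)), f⟫ := by
    intro f
    rw [← star_star (fourier 1 : C(Circ, ℂ)), ← inner_mulL2_left, star_fourier, mulL2_toL2,
      fourier_mul_fourier]
    congr 3; ring
  have h3 : ⟪toL2 (fourier (n - 1)), mulL2 (fourier (-1)) (h : L2)⟫ = ⟪toL2 (fourier n), (h : L2)⟫ := by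
    rw [← star_star (fourier (-1) : C(Circ, ℂ)), ← inner_mulL2_left, star_fourier, mulL2_toL2,
      fourier_mul_fourier]
    congr 3; ring
  rw [coe_toeplitz_fourier_one, h2, toeplitz_apply, inner_fourier_szego, h3]
  have h4 : ((h - ⟪hardyOne, h⟫ • hardyOne : hardy) : L2) =
    (h : L2) - ⟪toL2 (fourier 0), (h : L2)⟫ • toL2 (fourier 0) := by
    rw [← show toL2 1 = toL2 (fourier 0) from toL2_one]; rfl
  rw [h4, inner_sub_right, inner_smul_right, inner_fourier_fourier]
  by_cases hn : n = 0
  · subst hn; simp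
  · rcases lt_or_gt_of_ne hn with hn' | hn'
    · rw [if_neg (by omega), if_neg hn, mem_hardy_iff.1 h.2 n hn']; simp
    · rw [if_pos (by omega), if_neg hn]; simp

theorem conj_inner_hardy (x y : hardy) : conj ⟪x, y⟫ = ⟪y, x⟫ := inner_conj_symm y x

/-- The square `H_u²` as a linear operator. -/
def hankelSq (u : C(Circ, ℂ)) : hardy →L[ℂ] hardy := (hankel u).comp (hankel u)

/-- The square `K_u²` as a linear operator. -/
def shiftedHankelSq (u : C(Circ, ℂ)) : hardy →L[ℂ] hardy :=
  (shiftedHankel u).comp (shiftedHankel u)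

theorem hankelSq_apply (u : C(Circ, ℂ)) (h : hardy) : hankelSq u h = hankel u (hankel u h) := rfl

theorem shiftedHankelSq_apply (u : C(Circ, ℂ)) (h : hardy) :
    shiftedHankelSq u h = shiftedHankel u (shiftedHankel u h) := rfl

theorem inner_hankelSq (u : C(Circ, ℂ)) (x y : hardy) :
    ⟪hankelSq u x, y⟫ = ⟪hankel u y, hankel u x⟫ := by
  rw [hankelSq_apply, inner_hankel]

theorem inner_shiftedHankelSq (u : C(Circ, ℂ)) (x y : hardy) :
    ⟪shiftedHankelSq u x, y⟫ = ⟪shiftedHankel u y, shiftedHankel u x⟫ := by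
  rw [shiftedHankelSq_apply, inner_shiftedHankel]

theorem isSelfAdjoint_shiftedHankelSq (u : C(Circ, ℂ)) : IsSelfAdjoint (shiftedHankelSq u) := by
  rw [ContinuousLinearMap.isSelfAdjoint_iff_isSymmetric]
  intro x y
  change ⟪shiftedHankelSq u x, y⟫ = ⟪x, shiftedHankelSq u y⟫
  rw [inner_shiftedHankelSq, ← inner_conj_symm x, inner_shiftedHankelSq,
    conj_inner_hardy]

/-- `H_u² = K_u² + (· | u) u`. -/
theorem hankelSq_eq {u : C(Circ, ℂ)} (hu : toL2 u ∈ hardy) (x : hardy) :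
    hankelSq u x = shiftedHankelSq u x + ⟪(⟨toL2 u, hu⟩ : hardy), x⟫ • (⟨toL2 u, hu⟩ : hardy) := by
  -- `K_u² = (H_u T_z)(T_z^* H_u)`, and `T_z T_z^*` is the identity minus the projection on
  -- constants; that projection produces the rank one term because `H_u 1 = u`.
  rw [shiftedHankelSq_apply, shiftedHankel_eq_hankel u (shiftedHankel u x),
    shiftedHankel_eq_toeplitz, toeplitz_one_toeplitz_neg_one, map_sub, map_smulₛₗ, ← hankel_one hu,
    hankelSq_apply, inner_hankel u hardyOne, conj_inner_hardy, sub_add_cancel]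

theorem isSelfAdjoint_toeplitz {b : C(Circ, ℂ)} (hb : star b = b) : IsSelfAdjoint (toeplitz b) := by
  rw [ContinuousLinearMap.isSelfAdjoint_iff', adjoint_toeplitz, hb]

/-! ### Algebraic identities behind the Lax pair -/

/-- Split `ū h` by `szego_add_reflect`: the antianalytic part is the reflection of `K_u h`. After
multiplication by `u`, the analytic part stays in the Hardy space and the other one projects to
`K_u² h`. -/
theorem toeplitz_abs_sq {u : C(Circ, ℂ)} (hu : toL2 u ∈ hardy) (h : hardy) :
    ((toeplitz (u * star u) h : hardy) : L2) =
      mulL2 u ((toeplitz (star u) h : hardy) : L2) + (shiftedHankelSq u h : L2) := by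
  have h1 := szego_add_reflect (mulL2 (star u) (h : L2))
  rw [reflect_mulL2, star_star, ← shiftedHankel_apply, ← toeplitz_apply] at h1
  rw [toeplitz_apply, ← mulL2_mulL2, ← h1, map_add, map_add]
  push_cast
  rw [szego_of_mem (mulL2_mem_hardy hu _), ← shiftedHankel_apply]
  rfl

/-- The source of the Lax pair. Split `u · reflect h` into `K_u h` and the reflection of `T_ū h`,
then multiply by `|u|²`. The second part becomes `u · reflect (u T_ū h)`, and `u T_ū h = T_{|u|²} h
- K_u² h` by `toeplitz_abs_sq`. -/
theorem shiftedHankel_cubic {u : C(Circ, ℂ)} (hu : toL2 u ∈ hardy) (h : hardy) :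
    szego (mulL2 (u * star u * u) (reflect (h : L2))) =
      toeplitz (u * star u) (shiftedHankel u h) + shiftedHankel u (toeplitz (u * star u) h) -
        shiftedHankel u (shiftedHankelSq u h) := by
  have h1 := szego_add_reflect (mulL2 u (reflect (h : L2)))
  rw [← shiftedHankel_apply, reflect_mulL2, reflect_reflect, ← toeplitz_apply] at h1
  have h2 : toeplitz (u * star u) h - shiftedHankelSq u h =
      ⟨mulL2 u ((toeplitz (star u) h : hardy) : L2), mulL2_mem_hardy hu _⟩ := by
    apply Subtype.ext
    push_cast
    rw [toeplitz_abs_sq hu, add_sub_cancel_right]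
  rw [← mulL2_mulL2, ← h1, map_add, map_add, ← toeplitz_apply, add_sub_assoc, ← map_sub, h2,
    shiftedHankel_apply u h, shiftedHankel_apply u ⟨mulL2 u _, _⟩]
  change _ = _ + szego (mulL2 u (reflect (mulL2 u ((toeplitz (star u) h : hardy) : L2))))
  rw [reflect_mulL2, mulL2_mulL2]

/-- `reflect h` has only negative frequencies, so the antianalytic part of a symbol contributes
nothing. This lets the continuous symbol `|u|² u` stand for its projection. -/
theorem szego_mulL2_reflect_of_szego_eq {f g : C(Circ, ℂ)} (hfg : szego (toL2 f) = szego (toL2 g))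
    (h : hardy) : szego (mulL2 f (reflect (h : L2))) = szego (mulL2 g (reflect (h : L2))) := by
  have h2 : ∀ n : ℤ, 0 ≤ n → ⟪toL2 (fourier n), toL2 (f - g)⟫ = 0 := by
    intro n hn
    have := inner_fourier_szego (toL2 f) n
    rw [hfg, inner_fourier_szego, if_pos hn, if_pos hn] at this
    have h4 : toL2 (f - g) = toL2 f - toL2 g := map_sub (ContinuousMap.toLp 2 μ ℂ) f g
    rw [h4, inner_sub_right, this, sub_self]
  have h3 : mulL2 f (reflect (h : L2)) - mulL2 g (reflect (h : L2)) =
      mulL2 (f - g) (reflect (h : L2)) := by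
    rw [sub_eq_add_neg f g, mulL2_add, ← neg_one_smul ℂ g, mulL2_smul]
    simp [sub_eq_add_neg]
  apply Subtype.ext
  apply L2_ext
  intro n
  rw [inner_fourier_szego, inner_fourier_szego]
  split_ifs with hn
  swap; · rfl
  rw [← sub_eq_zero, ← inner_sub_right, h3, ← star_star (f - g), ← inner_mulL2_left,
    ← inner_conj_symm, inner_reflect_left, reflect_mulL2, star_star, reflect_fourier, mulL2_toL2,
    inner_eq_zero_of_mem_hardy _ h.2, map_zero]
  intro k hk
  have h5 := h2 (k + 1 + n) (by omega)
  rw [mul_comm (f - g), ← mulL2_toL2, ← star_star (fourier (-1 - n) : C(Circ, ℂ)), ← inner_mulL2_left,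
    star_fourier, mulL2_toL2, fourier_mul_fourier, ← h5]
  congr 3; ring

section

/-! ### Linear differential equations in Banach spaces -/

section LinearODE

variable {F : Type*} [NormedAddCommGroup F] [NormedSpace ℝ F]

theorem linear_ode_unique {L : ℝ → F →L[ℝ] F} (hL : Continuous L) {y₁ y₂ : ℝ → F}
    (h₁ : ∀ t, HasDerivAt y₁ (L t (y₁ t)) t) (h₂ : ∀ t, HasDerivAt y₂ (L t (y₂ t)) t)
    (h0 : y₁ 0 = y₂ 0) (t : ℝ) : y₁ t = y₂ t := by
  obtain ⟨R, hR⟩ : ∃ R : ℝ, |t| < R := exists_gt _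
  have hRpos : 0 < R := (abs_nonneg t).trans_lt hR
  obtain ⟨M, hM⟩ := (isCompact_Icc (a := -R) (b := R)).exists_bound_of_continuousOn hL.continuousOn
  have hM' : ∀ s ∈ Set.Ioo (-R) R, LipschitzOnWith M.toNNReal (L s) Set.univ := by
    intro s hs
    refine ((L s).lipschitz.weaken ?_).lipschitzOnWith
    rw [← NNReal.coe_le_coe]
    exact (hM s (Set.Ioo_subset_Icc_self hs)).trans (Real.le_coe_toNNReal M)
  have := ODE_solution_unique_of_mem_Ioo (v := fun s x => L s x) (s := fun _ => Set.univ)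
    (K := M.toNNReal) (a := -R) (b := R) (t₀ := 0) hM' ⟨by linarith, hRpos⟩
    (fun s _ => ⟨h₁ s, Set.mem_univ _⟩) (fun s _ => ⟨h₂ s, Set.mem_univ _⟩) h0
  exact this (abs_lt.1 hR)

/-- The Picard iterates of a linear differential equation. -/
def dysonTerm (L : ℝ → F →L[ℝ] F) (y₀ : F) : ℕ → ℝ → F
  | 0 => fun _ => y₀
  | n + 1 => fun t => ∫ s in (0 : ℝ)..t, L s (dysonTerm L y₀ n s)

theorem continuous_dysonTerm {L : ℝ → F →L[ℝ] F} (hL : Continuous L) (y₀ : F) (n : ℕ) :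
    Continuous (dysonTerm L y₀ n) := by
  induction n with
  | zero => exact continuous_const
  | succ n ih =>
    exact intervalIntegral.continuous_primitive
      (fun a b => (hL.clm_apply ih).intervalIntegrable a b) 0

theorem hasDerivAt_dysonTerm [CompleteSpace F] {L : ℝ → F →L[ℝ] F} (hL : Continuous L) (y₀ : F) (n : ℕ) (t : ℝ) :
    HasDerivAt (dysonTerm L y₀ (n + 1)) (L t (dysonTerm L y₀ n t)) t :=
  (hL.clm_apply (continuous_dysonTerm hL y₀ n)).integral_hasStrictDerivAt 0 t |>.hasDerivAt

theorem norm_dysonTerm_le {L : ℝ → F →L[ℝ] F} {M R : ℝ}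
    (hM : ∀ t, |t| < R → ‖L t‖ ≤ M) (y₀ : F) (n : ℕ) :
    ∀ t, |t| < R → ‖dysonTerm L y₀ n t‖ ≤ ‖y₀‖ * (M ^ n * |t| ^ n / n.factorial) := by
  induction n with
  | zero => intro t _; simp [dysonTerm]
  | succ n ih =>
    intro t ht
    have hM0 : 0 ≤ M := (norm_nonneg _).trans (hM t ht)
    have hb : ∀ s, |s| ≤ |t| → ‖L s (dysonTerm L y₀ n s)‖ ≤
        M * ‖y₀‖ * M ^ n / n.factorial * |s| ^ n := by
      intro s hs
      have hs' : |s| < R := hs.trans_lt ht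
      calc ‖L s (dysonTerm L y₀ n s)‖ ≤ M * (‖y₀‖ * (M ^ n * |s| ^ n / n.factorial)) :=
            (L s).le_of_opNorm_le_of_le (hM s hs') (ih s hs')
        _ = _ := by ring
    have hfac : ((n + 1).factorial : ℝ) = (n + 1) * n.factorial := by
      rw [Nat.factorial_succ]; push_cast; ring
    have hpos : (0 : ℝ) < n.factorial := by exact_mod_cast n.factorial_pos
    rcases le_total 0 t with h0 | h0
    · have h1 := intervalIntegral.norm_integral_le_of_norm_le (μ := volume) h0
        (f := fun s => L s (dysonTerm L y₀ n s))
        (g := fun s => M * ‖y₀‖ * M ^ n / n.factorial * s ^ n)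
        (Filter.Eventually.of_forall fun s hs => by
          have := hb s (by rw [abs_of_pos hs.1, abs_of_nonneg h0]; exact hs.2)
          rwa [abs_of_pos hs.1] at this)
        ((continuous_const.mul (continuous_pow n)).intervalIntegrable _ _)
      refine h1.trans (le_of_eq ?_)
      rw [intervalIntegral.integral_const_mul, integral_pow, hfac, abs_of_nonneg h0]
      field_simp
      ring
    · have h1 := intervalIntegral.norm_integral_le_of_norm_le (μ := volume) h0
        (f := fun s => L s (dysonTerm L y₀ n s))
        (g := fun s => M * ‖y₀‖ * M ^ n / n.factorial * (-s) ^ n)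
        (Filter.Eventually.of_forall fun s hs => by
          have := hb s (by rw [abs_of_nonpos hs.2, abs_of_nonpos h0]; linarith [hs.1])
          rwa [abs_of_nonpos hs.2] at this)
        ((continuous_const.mul (continuous_neg.pow n)).intervalIntegrable _ _)
      have h2 : ‖dysonTerm L y₀ (n + 1) t‖ =
          ‖∫ s in t..(0 : ℝ), L s (dysonTerm L y₀ n s)‖ := by
        rw [intervalIntegral.integral_symm, norm_neg]; rfl
      rw [h2]
      refine h1.trans (le_of_eq ?_)
      rw [intervalIntegral.integral_const_mul, intervalIntegral.integral_comp_neg (fun s => s ^ n),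
        integral_pow, hfac, abs_of_nonpos h0]
      field_simp
      simp
      ring

/-- Linear differential equations with continuous coefficients have global solutions. -/
theorem exists_linear_ode_solution [CompleteSpace F] {L : ℝ → F →L[ℝ] F} (hL : Continuous L) (y₀ : F) :
    ∃ y : ℝ → F, y 0 = y₀ ∧ ∀ t, HasDerivAt y (L t (y t)) t := by
  refine ⟨fun t => ∑' n, dysonTerm L y₀ n t, ?_, fun t => ?_⟩
  · have h : ∀ n, n ≠ 0 → dysonTerm L y₀ n 0 = 0 := by
      intro n hn
      obtain ⟨k, rfl⟩ := Nat.exists_eq_succ_of_ne_zero hn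
      exact intervalIntegral.integral_same
    exact tsum_eq_single 0 h
  obtain ⟨R, hR⟩ : ∃ R : ℝ, |t| < R := exists_gt _
  have hR0 : 0 < R := (abs_nonneg t).trans_lt hR
  obtain ⟨M, hM⟩ := (isCompact_Icc (a := -R) (b := R)).exists_bound_of_continuousOn hL.continuousOn
  have hM' : ∀ s, |s| < R → ‖L s‖ ≤ M := fun s hs => hM s (abs_le.1 hs.le)
  have hM0 : 0 ≤ M := (norm_nonneg _).trans (hM' t hR)
  have hb := norm_dysonTerm_le hM' y₀
  have hsum0 : Summable fun n : ℕ => ‖y₀‖ * (M ^ n * R ^ n / n.factorial) := by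
    have := (Real.summable_pow_div_factorial (M * R)).mul_left ‖y₀‖
    simpa only [mul_pow] using this
  have hbR : ∀ n s, |s| < R → ‖dysonTerm L y₀ n s‖ ≤ ‖y₀‖ * (M ^ n * R ^ n / n.factorial) := by
    intro n s hs
    refine (hb n s hs).trans ?_
    gcongr
  have hmem : ∀ s, s ∈ Metric.ball (0 : ℝ) R ↔ |s| < R := fun s => by simp
  have hsum : ∀ s, |s| < R → Summable fun n => dysonTerm L y₀ n s := fun s hs =>
    Summable.of_norm_bounded hsum0 fun n => hbR n s hs
  have key := hasDerivAt_tsum_of_isPreconnected (𝕜 := ℝ)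
    (g := fun n s => dysonTerm L y₀ (n + 1) s)
    (g' := fun n s => L s (dysonTerm L y₀ n s)) (u := fun n => M * (‖y₀‖ * (M ^ n * R ^ n / n.factorial)))
    (t := Metric.ball (0 : ℝ) R) (y₀ := t) (y := t) (hsum0.mul_left M) Metric.isOpen_ball
    (convex_ball (0 : ℝ) R).isPreconnected (fun n s _ => hasDerivAt_dysonTerm hL y₀ n s)
    (fun n s hs => (L s).le_of_opNorm_le_of_le (hM' s ((hmem s).1 hs)) (hbR n s ((hmem s).1 hs)))
    ((hmem t).2 hR) ((summable_nat_add_iff 1).2 (hsum t hR)) ((hmem t).2 hR)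
  rw [← (L t).map_tsum (hsum t hR)] at key
  refine (key.const_add y₀).congr_of_eventuallyEq ?_
  filter_upwards [Metric.isOpen_ball.mem_nhds ((hmem t).2 hR)] with s hs
  exact (hsum s ((hmem s).1 hs)).tsum_eq_zero_add

end LinearODE

/-! ### Analyticity of the solutions of quadratic differential equations -/

section QuadraticODE

variable {F : Type*} [NormedAddCommGroup F] [NormedSpace ℝ F]

/-- The Taylor coefficients at `x` of the solution of `y' = B (y, y)`. -/
def quadCoeff (B : F →L[ℝ] F →L[ℝ] F) (x : F) : ℕ → F
  | 0 => x
  | n + 1 => ((n : ℝ) + 1)⁻¹ • ∑ i : Fin (n + 1), B (quadCoeff B x i) (quadCoeff B x (n - i))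

theorem quadCoeff_succ (B : F →L[ℝ] F →L[ℝ] F) (x : F) (n : ℕ) :
    ((n : ℝ) + 1) • quadCoeff B x (n + 1) =
      ∑ i ∈ Finset.range (n + 1), B (quadCoeff B x i) (quadCoeff B x (n - i)) := by
  rw [quadCoeff, smul_smul, mul_inv_cancel₀ (by positivity), one_smul,
    Finset.sum_range (fun i => B (quadCoeff B x i) (quadCoeff B x (n - i)))]

/-- Geometric growth, because the division by `n + 1` in the recursion compensates the `n + 1` terms
of the convolution. -/
theorem norm_quadCoeff_le (B : F →L[ℝ] F →L[ℝ] F) (x : F) (n : ℕ) :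
    ‖quadCoeff B x n‖ ≤ ‖x‖ * (‖B‖ * ‖x‖) ^ n := by
  induction n using Nat.strong_induction_on with
  | _ n ih =>
    cases n with
    | zero => simp [quadCoeff]
    | succ n =>
      have h1 : ((n : ℝ) + 1) * ‖quadCoeff B x (n + 1)‖ ≤
          ((n : ℝ) + 1) * (‖x‖ * (‖B‖ * ‖x‖) ^ (n + 1)) := by
        have hn : ((n : ℝ) + 1) * ‖quadCoeff B x (n + 1)‖ =
            ‖((n : ℝ) + 1) • quadCoeff B x (n + 1)‖ := by
          rw [norm_smul, Real.norm_of_nonneg (by positivity)]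
        rw [hn, quadCoeff_succ]
        refine (norm_sum_le _ _).trans ?_
        refine (Finset.sum_le_sum (g := fun _ => ‖x‖ * (‖B‖ * ‖x‖) ^ (n + 1)) fun i hi => ?_).trans
          (by simp)
        have hi' : i < n + 1 := Finset.mem_range.1 hi
        calc ‖B (quadCoeff B x i) (quadCoeff B x (n - i))‖
            ≤ ‖B‖ * (‖x‖ * (‖B‖ * ‖x‖) ^ i) * (‖x‖ * (‖B‖ * ‖x‖) ^ (n - i)) := by
              refine (B.le_opNorm₂ _ _).trans ?_
              gcongr
              · exact ih i hi'
              · exact ih (n - i) (by omega)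
          _ = ‖x‖ * (‖B‖ * ‖x‖) ^ (n + 1) := by
              have : (‖B‖ * ‖x‖) ^ (n + 1) =
                  (‖B‖ * ‖x‖) ^ i * (‖B‖ * ‖x‖) ^ (n - i) * (‖B‖ * ‖x‖) := by
                rw [← pow_add, ← pow_succ]; congr 1; omega
              rw [this]; ring
      exact le_of_mul_le_mul_left h1 (by positivity)

/-- This identifies the coefficients with `y⁽ⁿ⁾ / n!`. In the Leibniz rule for the convolution, the
two shifted sums carry the weights `n + 1 - i` and `i`, which add up to `n + 1`. -/
theorem hasDerivAt_quadCoeff {B : F →L[ℝ] F →L[ℝ] F} {y : ℝ → F}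
    (hy : ∀ t, HasDerivAt y (B (y t) (y t)) t) (n : ℕ) (t : ℝ) :
    HasDerivAt (fun s => quadCoeff B (y s) n) (((n : ℝ) + 1) • quadCoeff B (y t) (n + 1)) t := by
  induction n using Nat.strong_induction_on with
  | _ n ih =>
    cases n with
    | zero => simpa [quadCoeff] using hy t
    | succ n =>
      have hc : (((n : ℝ) + 1)) ≠ 0 := by positivity
      have h1 : HasDerivAt (fun s => ∑ i ∈ Finset.range (n + 1),
          B (quadCoeff B (y s) i) (quadCoeff B (y s) (n - i)))
          (∑ i ∈ Finset.range (n + 1),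
            (B (quadCoeff B (y t) i) ((((n - i : ℕ) : ℝ) + 1) • quadCoeff B (y t) (n - i + 1)) +
            B (((i : ℝ) + 1) • quadCoeff B (y t) (i + 1)) (quadCoeff B (y t) (n - i)))) t := by
        refine HasDerivAt.fun_sum fun i hi => ?_
        have hi' : i < n + 1 := Finset.mem_range.1 hi
        exact B.hasDerivAt_of_bilinear (fun _ => ih i hi') (fun _ => ih (n - i) (by omega))
      have h2 : (∑ i ∈ Finset.range (n + 1),
            (B (quadCoeff B (y t) i) ((((n - i : ℕ) : ℝ) + 1) • quadCoeff B (y t) (n - i + 1)) +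
            B (((i : ℝ) + 1) • quadCoeff B (y t) (i + 1)) (quadCoeff B (y t) (n - i)))) =
          ((n : ℝ) + 1) • ∑ i ∈ Finset.range (n + 1 + 1),
            B (quadCoeff B (y t) i) (quadCoeff B (y t) (n + 1 - i)) := by
        rw [Finset.sum_add_distrib]
        have e1 : ∑ i ∈ Finset.range (n + 1),
            B (quadCoeff B (y t) i) ((((n - i : ℕ) : ℝ) + 1) • quadCoeff B (y t) (n - i + 1)) =
            ∑ i ∈ Finset.range (n + 1 + 1), ((n : ℝ) + 1 - i) •
              B (quadCoeff B (y t) i) (quadCoeff B (y t) (n + 1 - i)) := by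
          rw [Finset.sum_range_succ _ (n + 1)]
          push_cast
          rw [sub_self, zero_smul, add_zero]
          refine Finset.sum_congr rfl fun i hi => ?_
          have hi' : i ≤ n := Nat.lt_succ_iff.1 (Finset.mem_range.1 hi)
          rw [map_smul, Nat.cast_sub hi', show n + 1 - i = n - i + 1 by omega]
          congr 1; ring
        have e2 : ∑ i ∈ Finset.range (n + 1),
            B (((i : ℝ) + 1) • quadCoeff B (y t) (i + 1)) (quadCoeff B (y t) (n - i)) =
            ∑ i ∈ Finset.range (n + 1 + 1), (i : ℝ) •
              B (quadCoeff B (y t) i) (quadCoeff B (y t) (n + 1 - i)) := by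
          rw [Finset.sum_range_succ' _ (n + 1)]
          simp only [Nat.cast_zero, zero_smul, add_zero]
          refine Finset.sum_congr rfl fun i _ => ?_
          rw [map_smul, smul_apply, Nat.add_sub_add_right]
          push_cast; rfl
        rw [e1, e2, ← Finset.sum_add_distrib, Finset.smul_sum]
        refine Finset.sum_congr rfl fun i _ => ?_
        rw [← add_smul]; congr 1; ring
      rw [h2, ← quadCoeff_succ] at h1
      have h3 := h1.const_smul ((n : ℝ) + 1)⁻¹
      rw [smul_smul, inv_mul_cancel₀ hc, one_smul] at h3
      refine h3.congr_of_eventuallyEq (Filter.Eventually.of_forall fun s => ?_)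
      simp only [Pi.smul_apply]
      rw [← quadCoeff_succ, smul_smul, inv_mul_cancel₀ hc, one_smul]

/-- Taylor's formula with the base point `s` moving and the target `t` fixed: the derivative
telescopes to its last term. -/
theorem hasDerivAt_sum_quadCoeff {B : F →L[ℝ] F →L[ℝ] F} {y : ℝ → F}
    (hy : ∀ t, HasDerivAt y (B (y t) (y t)) t) (t : ℝ) (N : ℕ) (s : ℝ) :
    HasDerivAt (fun s => ∑ k ∈ Finset.range (N + 1), (t - s) ^ k • quadCoeff B (y s) k)
      (((N : ℝ) + 1) • (t - s) ^ N • quadCoeff B (y s) (N + 1)) s := by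
  induction N with
  | zero => simpa using hasDerivAt_quadCoeff hy 0 s
  | succ N ih =>
    simp only [Finset.sum_range_succ _ (N + 1)]
    have h1 : HasDerivAt (fun s => (t - s) ^ (N + 1)) (-(((N : ℝ) + 1) * (t - s) ^ N)) s := by
      have := ((hasDerivAt_id s).const_sub t).fun_pow (N + 1)
      refine this.congr_deriv ?_
      push_cast
      simp
    refine (ih.fun_add (h1.fun_smul (hasDerivAt_quadCoeff hy (N + 1) s))).congr_deriv ?_
    push_cast
    rw [pow_succ]
    module

/-- Solutions of quadratic differential equations are real analytic. -/
theorem analyticAt_of_quadratic_ode {B : F →L[ℝ] F →L[ℝ] F} {y : ℝ → F}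
    (hy : ∀ t, HasDerivAt y (B (y t) (y t)) t) (t₀ : ℝ) : AnalyticAt ℝ y t₀ := by
  have hcont : Continuous y := continuous_iff_continuousAt.2 fun t => (hy t).continuousAt
  obtain ⟨M, hM⟩ := (isCompact_Icc (a := t₀ - 1) (b := t₀ + 1)).exists_bound_of_continuousOn
    hcont.continuousOn
  have hM0 : 0 ≤ M := (norm_nonneg _).trans (hM t₀ ⟨by linarith, by linarith⟩)
  -- The growth rate of the coefficients is at most `‖B‖ M` near `t₀`; the added `1` keeps `R`
  -- positive, so that it can be divided by.
  set R : ℝ := ‖B‖ * M + 1 with hRdef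
  have hR1 : 1 ≤ R := by rw [hRdef]; nlinarith [norm_nonneg B, mul_nonneg (norm_nonneg B) hM0]
  have hRpos : 0 < R := by linarith
  have hbound : ∀ n, ∀ s, |s - t₀| ≤ 1 → ‖quadCoeff B (y s) n‖ ≤ M * R ^ n := by
    intro n s hs
    have hMs := hM s ⟨by linarith [(abs_le.1 hs).1], by linarith [(abs_le.1 hs).2]⟩
    refine (norm_quadCoeff_le B (y s) n).trans ?_
    gcongr
    rw [hRdef]
    nlinarith [norm_nonneg B, mul_le_mul_of_nonneg_left hMs (norm_nonneg B)]
  have hlim : ∀ t, |t - t₀| < 1 / (2 * R) →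
      HasSum (fun n => (t - t₀) ^ n • quadCoeff B (y t₀) n) (y t) := by
    intro t ht
    have ht1 : |t - t₀| ≤ 1 := ht.le.trans (by
      rw [div_le_one (by positivity)]; linarith)
    have hx : R * |t - t₀| < 1 := by
      have := mul_lt_mul_of_pos_left ht hRpos
      refine this.trans (lt_of_eq_of_lt (b := 1 / 2) ?_ (by norm_num))
      field_simp
    have hx0 : 0 ≤ R * |t - t₀| := by positivity
    have hsummable : Summable fun n => ‖(t - t₀) ^ n • quadCoeff B (y t₀) n‖ := by
      refine Summable.of_nonneg_of_le (fun _ => norm_nonneg _) (fun n => ?_)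
        ((summable_geometric_of_lt_one hx0 hx).mul_left M)
      rw [norm_smul, norm_pow, Real.norm_eq_abs]
      calc |t - t₀| ^ n * ‖quadCoeff B (y t₀) n‖ ≤ |t - t₀| ^ n * (M * R ^ n) := by
            gcongr; exact hbound n t₀ (by simp)
        _ = M * (R * |t - t₀|) ^ n := by rw [mul_pow]; ring
    have herr : ∀ N : ℕ, ‖(∑ k ∈ Finset.range (N + 1), (t - t₀) ^ k • quadCoeff B (y t₀) k) - y t‖ ≤
        M * ((N + 1 : ℕ) * (R * |t - t₀|) ^ (N + 1)) := by
      intro N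
      -- Mean value inequality in the base point, which runs from `t₀`, where the value is the
      -- partial sum, to `t`, where it is `y t`.
      have h1 := Convex.norm_image_sub_le_of_norm_hasDerivWithin_le (𝕜 := ℝ) (s := Set.uIcc t₀ t)
        (f := fun s => ∑ k ∈ Finset.range (N + 1), (t - s) ^ k • quadCoeff B (y s) k)
        (f' := fun s => ((N : ℝ) + 1) • (t - s) ^ N • quadCoeff B (y s) (N + 1))
        (C := ((N : ℝ) + 1) * (|t - t₀| ^ N * (M * R ^ (N + 1)))) (x := t) (y := t₀)
        (fun s _ => (hasDerivAt_sum_quadCoeff hy t N s).hasDerivWithinAt)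
        (fun s hs => by
          have h2 : |s - t₀| ≤ |t - t₀| := Set.abs_sub_left_of_mem_uIcc hs
          have h3 : |t - s| ≤ |t - t₀| := Set.abs_sub_right_of_mem_uIcc hs
          rw [norm_smul, norm_smul, norm_pow, Real.norm_eq_abs, Real.norm_eq_abs,
            abs_of_nonneg (by positivity : (0 : ℝ) ≤ (N : ℝ) + 1)]
          gcongr
          exact hbound (N + 1) s (h2.trans ht1))
        (convex_uIcc t₀ t) Set.right_mem_uIcc Set.left_mem_uIcc
      have h4 : (∑ k ∈ Finset.range (N + 1), (t - t) ^ k • quadCoeff B (y t) k) = y t := by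
        rw [Finset.sum_eq_single_of_mem 0 (by simp) (fun k _ hk => by simp [hk])]
        simp [quadCoeff]
      simp only [h4] at h1
      refine h1.trans (le_of_eq ?_)
      rw [Real.norm_eq_abs, abs_sub_comm t₀ t, mul_pow]
      push_cast
      ring
    have htend : Tendsto (fun N : ℕ => ∑ k ∈ Finset.range (N + 1), (t - t₀) ^ k • quadCoeff B (y t₀) k)
        atTop (𝓝 (y t)) := by
      rw [tendsto_iff_norm_sub_tendsto_zero]
      refine squeeze_zero (fun _ => norm_nonneg _) herr ?_
      have h5 := (tendsto_self_mul_const_pow_of_lt_one hx0 hx).const_mul M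
      rw [mul_zero] at h5
      exact h5.comp (tendsto_add_atTop_nat 1)
    rw [hasSum_iff_tendsto_nat_of_summable_norm hsummable]
    exact (tendsto_add_atTop_iff_nat 1).1 htend
  let p : FormalMultilinearSeries ℝ ℝ F := fun n =>
    ContinuousMultilinearMap.mkPiRing ℝ (Fin n) (quadCoeff B (y t₀) n)
  refine ⟨p, ENNReal.ofReal (1 / (2 * R)), ?_, ?_, ?_⟩
  · refine (ENNReal.ofReal_le_ofReal (q := 1 / R) ?_).trans
      (p.le_radius_of_bound M (r := (1 / R).toNNReal) fun n => ?_)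
    · gcongr; linarith
    · rw [ContinuousMultilinearMap.norm_mkPiRing, Real.coe_toNNReal _ (by positivity)]
      calc ‖quadCoeff B (y t₀) n‖ * (1 / R) ^ n ≤ M * R ^ n * (1 / R) ^ n := by
            gcongr; exact hbound n t₀ (by simp)
        _ = M := by rw [mul_assoc, ← mul_pow, mul_one_div_cancel hRpos.ne', one_pow, mul_one]
  · exact ENNReal.ofReal_pos.2 (by positivity)
  · intro z hz
    rw [Metric.eball_ofReal, Metric.mem_ball, dist_zero_right, Real.norm_eq_abs] at hz
    have := hlim (t₀ + z) (by rwa [add_sub_cancel_left])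
    rw [add_sub_cancel_left] at this
    simpa [p] using this

end QuadraticODE

end

section

variable {E : Type*} [NormedAddCommGroup E] [InnerProductSpace ℂ E]

/-! ### The flow in the frame of the Lax pair -/

/-- The evolution of `v = U* u` and `w = U* 1` in the frame `U` of the Lax pair. -/
structure ModeFlow (α : ℝ) (A : E →L[ℂ] E) (v w : ℝ → E) : Prop where
  symm : ∀ x y, ⟪A x, y⟫ = ⟪x, A y⟫
  hasDerivAt_v : ∀ t, HasDerivAt v
    (-(Complex.I / 2) • A (v t) - (Complex.I * α * ⟪w t, v t⟫) • w t) t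
  hasDerivAt_w : ∀ t, HasDerivAt w
    ((Complex.I / 2) • A (w t) + (Complex.I * ⟪v t, w t⟫) • v t) t
  norm_w : ∀ t, ‖w t‖ = 1

namespace ModeFlow

variable {α : ℝ} {A : E →L[ℂ] E} {v w : ℝ → E}

theorem inner_self_v_const (h : ModeFlow α A v w) (t : ℝ) : ⟪v t, v t⟫ = ⟪v 0, v 0⟫ := by
  have hd : ∀ t, HasDerivAt (fun t => ⟪v t, v t⟫) 0 t := by
    intro t
    refine ((h.hasDerivAt_v t).inner ℂ (h.hasDerivAt_v t)).congr_deriv ?_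
    simp only [inner_sub_left, inner_sub_right, inner_smul_left, inner_smul_right, h.symm,
      map_neg, map_mul, map_div₀, Complex.conj_I, Complex.conj_ofReal, map_ofNat, inner_conj_symm]
    ring
  exact is_const_of_deriv_eq_zero (fun t => (hd t).differentiableAt) (fun t => (hd t).deriv) t 0

theorem inner_self_w (h : ModeFlow α A v w) (t : ℝ) : ⟪w t, w t⟫ = 1 := by
  rw [inner_self_eq_norm_sq_to_K, h.norm_w]; simp

/-- Since `‖w‖ = 1` and `‖v‖` is conserved, the derivative of `q = ⟪w, v⟫` is `⟪w, A v⟫` and `q`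
with constant coefficients. Taking `q` as an extra unknown thus makes the cubic system for `(v, w)`
quadratic, and a coordinate constantly `1` makes it homogeneous. -/
theorem hasDerivAt_inner (h : ModeFlow α A v w) (t : ℝ) :
    HasDerivAt (fun t => ⟪w t, v t⟫)
      (-Complex.I * ⟪w t, A (v t)⟫ - Complex.I * (α + ⟪v 0, v 0⟫) * ⟪w t, v t⟫) t := by
  refine ((h.hasDerivAt_w t).inner ℂ (h.hasDerivAt_v t)).congr_deriv ?_
  rw [← h.inner_self_v_const t]
  simp only [inner_sub_right, inner_add_left, inner_smul_left, inner_smul_right, h.symm,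
    map_mul, map_div₀, Complex.conj_I, map_ofNat, inner_conj_symm, h.inner_self_w]
  ring

/-- The phase space of the quadratic system equivalent to the evolution of `(v, w)`. -/
abbrev Phase (E : Type*) : Type _ := E × E × ℂ × ℝ

/-- The quadratic system equivalent to the evolution of `(v, w)`. -/
def quadratic (α : ℝ) (A : E →L[ℂ] E) (c : ℂ) : Phase E →L[ℝ] Phase E →L[ℝ] Phase E :=
  let p1 : Phase E →L[ℝ] E := .fst ℝ _ _
  let r1 : Phase E →L[ℝ] E × ℂ × ℝ := .snd ℝ _ _
  let p2 : Phase E →L[ℝ] E := (ContinuousLinearMap.fst ℝ _ _).comp r1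
  let r2 : Phase E →L[ℝ] ℂ × ℝ := (ContinuousLinearMap.snd ℝ _ _).comp r1
  let p3 : Phase E →L[ℝ] ℂ := (ContinuousLinearMap.fst ℝ _ _).comp r2
  let p4 : Phase E →L[ℝ] ℝ := (ContinuousLinearMap.snd ℝ _ _).comp r2
  let i1 : E →L[ℝ] Phase E := .inl ℝ _ _
  let i2 : E →L[ℝ] Phase E := (ContinuousLinearMap.inr ℝ _ _).comp (.inl ℝ _ _)
  let i3 : ℂ →L[ℝ] Phase E :=
    (ContinuousLinearMap.inr ℝ _ _).comp ((ContinuousLinearMap.inr ℝ _ _).comp (.inl ℝ _ _))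
  let A' : E →L[ℝ] E := A.restrictScalars ℝ
  let sE : ℂ →L[ℝ] E →L[ℝ] E := .lsmul ℝ ℂ
  let sR : ℝ →L[ℝ] E →L[ℝ] E := .lsmul ℝ ℝ
  let sC : ℝ →L[ℝ] ℂ →L[ℝ] ℂ := .lsmul ℝ ℝ
  let m : ℂ → ℂ →L[ℝ] ℂ := fun z => .mul ℝ ℂ z
  let B1 : Phase E →L[ℝ] Phase E →L[ℝ] E :=
    sR.bilinearComp p4 ((sE (-(Complex.I / 2))).comp (A'.comp p1)) +
      sE.bilinearComp ((m (-(Complex.I * α))).comp p3) p2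
  let B2 : Phase E →L[ℝ] Phase E →L[ℝ] E :=
    sR.bilinearComp p4 ((sE (Complex.I / 2)).comp (A'.comp p2)) +
      sE.bilinearComp ((m Complex.I).comp ((Complex.conjCLE : ℂ →L[ℝ] ℂ).comp p3)) p1
  let inn : E →L[ℝ] E →L[ℝ] ℂ := (isBoundedBilinearMap_inner (𝕜 := ℂ) (E := E)).toContinuousLinearMap
  let B3 : Phase E →L[ℝ] Phase E →L[ℝ] ℂ :=
    (ContinuousLinearMap.compL ℝ _ _ _ (m (-Complex.I))).comp (inn.bilinearComp p2 (A'.comp p1)) +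
      sC.bilinearComp p4 ((m (-Complex.I * (α + c))).comp p3)
  (ContinuousLinearMap.compL ℝ _ _ _ i1).comp B1 +
    (ContinuousLinearMap.compL ℝ _ _ _ i2).comp B2 +
    (ContinuousLinearMap.compL ℝ _ _ _ i3).comp B3

theorem quadratic_apply (α : ℝ) (A : E →L[ℂ] E) (c : ℂ) (x y : E) (q : ℂ) :
    quadratic α A c (x, y, q, 1) (x, y, q, 1) =
      (-(Complex.I / 2) • A x + (-(Complex.I * α) * q) • y,
        (Complex.I / 2) • A y + (Complex.I * conj q) • x,
        -Complex.I * ⟪y, A x⟫ + -Complex.I * (α + c) * q, 0) := by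
  simp [quadratic]

theorem analyticAt_v [CompleteSpace E] (h : ModeFlow α A v w) (t : ℝ) : AnalyticAt ℝ v t := by
  have hy : ∀ t, HasDerivAt (fun t => ((v t, w t, ⟪w t, v t⟫, 1) : Phase E))
      (quadratic α A ⟪v 0, v 0⟫ (v t, w t, ⟪w t, v t⟫, 1) (v t, w t, ⟪w t, v t⟫, 1)) t := by
    intro t
    refine ((h.hasDerivAt_v t).prodMk ((h.hasDerivAt_w t).prodMk
      ((h.hasDerivAt_inner t).prodMk (hasDerivAt_const t (1 : ℝ))))).congr_deriv ?_
    rw [quadratic_apply, inner_conj_symm]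
    simp only [Prod.mk.injEq, and_true, true_and]
    refine ⟨by module, by ring⟩
  exact (ContinuousLinearMap.fst ℝ E (E × ℂ × ℝ)).analyticAt _ |>.comp
    (analyticAt_of_quadratic_ode hy t)

/-- If `(v | w)` vanishes identically, so do all the moments `(Aⁿ v | w)`. -/
theorem inner_pow_eq_zero (h : ModeFlow α A v w) (hq : ∀ t, ⟪w t, v t⟫ = 0) (n : ℕ) (t : ℝ) :
    ⟪w t, (A ^ n) (v t)⟫ = 0 := by
  induction n generalizing t with
  | zero => simpa using hq t
  | succ n ih =>
    have hA : ∀ x y, ⟪A x, y⟫ = ⟪x, A y⟫ := h.symm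
    have hq' : ∀ t, ⟪v t, w t⟫ = 0 := fun t => by rw [← inner_conj_symm, hq, map_zero]
    have h1 := h.hasDerivAt_w t
    have h2 := (((A ^ n).restrictScalars ℝ).hasFDerivAt).comp_hasDerivAt t (h.hasDerivAt_v t)
    -- As `⟪w, v⟫` vanishes, the rank one terms drop out of both equations, and the two halves left
    -- add up to `-i ⟪w, Aⁿ⁺¹ v⟫`.
    have h3 := h1.inner ℂ h2
    have h4 : HasDerivAt (fun t => ⟪w t, (A ^ n) (v t)⟫) 0 t := by
      simp only [ih]; exact hasDerivAt_const t 0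
    have h5 := h3.unique h4
    rw [hq, hq'] at h5
    simp only [Function.comp_apply, ContinuousLinearMap.coe_restrictScalars', mul_zero, zero_smul,
      sub_zero, add_zero, map_smul, inner_smul_left, inner_smul_right, hA, map_div₀,
      Complex.conj_I, map_ofNat] at h5
    have h6 : (A ^ n) (A (v t)) = (A ^ (n + 1)) (v t) := by rw [pow_succ]; rfl
    have h7 : A ((A ^ n) (v t)) = (A ^ (n + 1)) (v t) := by rw [pow_succ']; rfl
    rw [h6, h7] at h5
    have h8 : Complex.I * ⟪w t, (A ^ (n + 1)) (v t)⟫ = 0 := by linear_combination -h5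
    simpa using h8

end ModeFlow

variable [CompleteSpace E]

/-- The structure of the evolution of `K_u²` and `u` under the `α`-Szegő flow. -/
structure LaxFlow (α : ℝ) (A C : ℝ → E →L[ℂ] E) (x : ℝ → E) (e : E) : Prop where
  continuous : Continuous C
  skew : ∀ t, star (C t) = -C t
  selfAdjoint : ∀ t, IsSelfAdjoint (A t)
  hasDerivAt_A : ∀ t, HasDerivAt A (C t * A t - A t * C t) t
  hasDerivAt_x : ∀ t, HasDerivAt x
    (C t (x t) - (Complex.I / 2) • A t (x t) - (Complex.I * α * ⟪e, x t⟫) • e) t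
  apply_e : ∀ t, C t e = -(Complex.I / 2) • A t e - (Complex.I * ⟪x t, e⟫) • x t
  norm_e : ‖e‖ = 1

/-- `U` solves `U' = C U`, `U 0 = 1`. Skewness of `C` makes it unitary, and the commutator equation
makes `U* A U` constant. In this frame `C` cancels from `U* (x' - C x)`, while `U* e` moves by `-U*
C e`. -/
theorem LaxFlow.exists_frame {α : ℝ} {A C : ℝ → E →L[ℂ] E} {x : ℝ → E} {e : E}
    (h : LaxFlow α A C x e) :
    ∃ U : ℝ → E →L[ℂ] E, (∀ t, star (U t) * U t = 1) ∧ (∀ t, U t * star (U t) = 1) ∧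
      (∀ t, star (U t) * A t = A 0 * star (U t)) ∧ U 0 = 1 ∧
      ModeFlow α (A 0) (fun t => star (U t) (x t)) (fun t => star (U t) e) := by
  let L : ℝ → (E →L[ℂ] E) →L[ℝ] (E →L[ℂ] E) := fun t => ContinuousLinearMap.mul ℝ (E →L[ℂ] E) (C t)
  have hL : Continuous L := (ContinuousLinearMap.mul ℝ (E →L[ℂ] E)).continuous.comp h.continuous
  obtain ⟨U, hU0, hU⟩ := exists_linear_ode_solution hL (1 : E →L[ℂ] E)
  have hU' : ∀ t, HasDerivAt U (C t * U t) t := hU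
  have hV : ∀ t, HasDerivAt (fun t => star (U t)) (-(star (U t) * C t)) t := by
    intro t
    refine (hU' t).star.congr_deriv ?_
    rw [star_mul, h.skew, mul_neg]
  have hVU : ∀ t, star (U t) * U t = 1 := by
    intro t
    have hd : ∀ t, HasDerivAt (fun t => star (U t) * U t) 0 t := by
      intro t
      refine ((hV t).mul (hU' t)).congr_deriv ?_
      noncomm_ring
    rw [is_const_of_deriv_eq_zero (fun t => (hd t).differentiableAt) (fun t => (hd t).deriv) t 0,
      hU0, star_one, one_mul]
  -- In infinite dimension an isometry need not be onto. But `U U*` and the constant `1` both solve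
  -- `X' = C X - X C`, so they agree by uniqueness.
  have hUV : ∀ t, U t * star (U t) = 1 := by
    let L2 : ℝ → (E →L[ℂ] E) →L[ℝ] (E →L[ℂ] E) := fun t =>
      ContinuousLinearMap.mul ℝ (E →L[ℂ] E) (C t) -
        (ContinuousLinearMap.mul ℝ (E →L[ℂ] E)).flip (C t)
    have hL2 : Continuous L2 :=
      hL.sub ((ContinuousLinearMap.mul ℝ (E →L[ℂ] E)).flip.continuous.comp h.continuous)
    refine linear_ode_unique (y₁ := fun t => U t * star (U t)) (y₂ := fun _ => 1) hL2
      (fun t => ?_) (fun t => ?_) ?_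
    · refine ((hU' t).mul (hV t)).congr_deriv ?_
      simp only [L2, sub_apply, ContinuousLinearMap.mul_apply', ContinuousLinearMap.flip_apply]
      noncomm_ring
    · refine (hasDerivAt_const t _).congr_deriv ?_
      simp [L2]
    · simp [hU0]
  have hVA : ∀ t, star (U t) * A t = A 0 * star (U t) := by
    intro t
    have hd : ∀ t, HasDerivAt (fun t => star (U t) * A t * U t) 0 t := by
      intro t
      refine (((hV t).fun_mul (h.hasDerivAt_A t)).fun_mul (hU' t)).congr_deriv ?_
      noncomm_ring
    have h1 := is_const_of_deriv_eq_zero (fun t => (hd t).differentiableAt)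
      (fun t => (hd t).deriv) t 0
    simp only [hU0, star_one, one_mul, mul_one] at h1
    rw [← h1, mul_assoc, hUV, mul_one]
  refine ⟨U, hVU, hUV, hVA, hU0, ?_, fun t => ?_, fun t => ?_, fun t => ?_⟩
  · exact fun a b => (ContinuousLinearMap.isSelfAdjoint_iff_isSymmetric.1 (h.selfAdjoint 0)) a b
  all_goals
    have hVA' : ∀ y, A 0 (star (U t) y) = star (U t) (A t y) := fun y =>
      (congrArg (fun T : E →L[ℂ] E => T y) (hVA t)).symm
    have hin : ∀ y z, ⟪star (U t) y, star (U t) z⟫ = ⟪y, z⟫ := by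
      intro y z
      rw [ContinuousLinearMap.star_eq_adjoint, ContinuousLinearMap.adjoint_inner_left,
        ← ContinuousLinearMap.star_eq_adjoint]
      exact congrArg (fun T : E →L[ℂ] E => ⟪y, T z⟫) (hUV t)
    have hVr : HasDerivAt (fun t => (star (U t)).restrictScalars ℝ)
        ((-(star (U t) * C t)).restrictScalars ℝ) t :=
      ((ContinuousLinearMap.restrictScalarsL ℂ E E ℝ ℝ).hasFDerivAt).comp_hasDerivAt t (hV t)
  · have h1 := hVr.clm_apply (h.hasDerivAt_x t)
    refine h1.congr_deriv ?_
    rw [hin, hVA']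
    simp
    module
  · have h1 := hVr.clm_apply (hasDerivAt_const t e)
    refine h1.congr_deriv ?_
    rw [hin, hVA']
    simp [h.apply_e]
    module
  · have h1 := hin e e
    rw [inner_self_eq_norm_sq_to_K, inner_self_eq_norm_sq_to_K, h.norm_e] at h1
    have h2 : ‖star (U t) e‖ ^ 2 = 1 ^ 2 := by exact_mod_cast h1
    exact (pow_left_inj₀ (norm_nonneg _) zero_le_one two_ne_zero).1 h2

end

section

variable {E : Type*} [NormedAddCommGroup E] [InnerProductSpace ℂ E]

/-! ### Rank one perturbations of self-adjoint operators -/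

/-- The eigenspace of a bounded operator at a real number. -/
abbrev eigen (A : E →L[ℂ] E) (l : ℝ) : Submodule ℂ E :=
  Module.End.eigenspace (A : E →ₗ[ℂ] E) (l : ℂ)

theorem mem_eigen {A : E →L[ℂ] E} {l : ℝ} {x : E} : x ∈ eigen A l ↔ A x = (l : ℂ) • x :=
  Module.End.mem_eigenspace_iff

theorem isClosed_eigen (A : E →L[ℂ] E) (l : ℝ) : IsClosed (eigen A l : Set E) := by
  have h : (eigen A l : Set E) = {x | A x = (l : ℂ) • x} := by ext x; exact mem_eigen
  rw [h]
  exact isClosed_eq A.continuous (continuous_const_smul _)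

/-- The perturbation `A + (· | v) v`. -/
def perturb (A : E →L[ℂ] E) (v : E) : E →L[ℂ] E := A + (innerSL ℂ v).smulRight v

theorem perturb_apply (A : E →L[ℂ] E) (v x : E) : perturb A v x = A x + ⟪v, x⟫ • v := by
  simp [perturb]

theorem rank_eq_rank_inf_ker_add_one (G : Submodule ℂ E) (φ : E →ₗ[ℂ] ℂ) {x : E} (hx : x ∈ G)
    (hφ : φ x ≠ 0) :
    Module.rank ℂ G = Module.rank ℂ (G ⊓ LinearMap.ker φ : Submodule ℂ E) + 1 := by
  have h1 := (φ.domRestrict G).lift_rank_range_add_rank_ker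
  have h2 : LinearMap.range (φ.domRestrict G) = ⊤ := by
    rw [LinearMap.range_eq_top]
    refine LinearMap.surjective fun h => hφ ?_
    exact congrArg (fun f : G →ₗ[ℂ] ℂ => f ⟨x, hx⟩) h
  rw [h2, rank_top, Module.rank_self, Cardinal.lift_one, Cardinal.lift_uzero, Cardinal.lift_uzero] at h1
  have h3 : Module.rank ℂ (LinearMap.ker (φ.domRestrict G)) =
      Module.rank ℂ (G ⊓ LinearMap.ker φ : Submodule ℂ E) := by
    rw [LinearMap.domRestrict, LinearMap.ker_comp]
    have h4 : Submodule.map G.subtype (Submodule.comap G.subtype (LinearMap.ker φ)) =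
        G ⊓ LinearMap.ker φ := Submodule.map_comap_subtype _ _
    rw [← h4]
    exact (Submodule.equivMapOfInjective G.subtype G.injective_subtype _).rank_eq
  rw [← h1, h3, add_comm]

/-- Pair `(A - l) x = -⟪v, x⟫ v` with `p`: the left side vanishes by symmetry. -/
theorem symm_eigen_orthogonal {A : E →L[ℂ] E} (hA : ∀ x y, ⟪A x, y⟫ = ⟪x, A y⟫) {l : ℝ} {v p x : E}
    (hp : p ∈ eigen A l) (hpv : ⟪p, v⟫ ≠ 0) (hx : x ∈ eigen (perturb A v) l) : ⟪v, x⟫ = 0 := by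
  rw [mem_eigen] at hp hx
  rw [perturb_apply] at hx
  have h1 : ⟪p, A x + ⟪v, x⟫ • v⟫ = ⟪p, (l : ℂ) • x⟫ := by rw [hx]
  rw [inner_add_right, ← hA, hp, inner_smul_left, inner_smul_right, inner_smul_right,
    Complex.conj_ofReal] at h1
  have h2 : ⟪v, x⟫ * ⟪p, v⟫ = 0 := by linear_combination h1
  exact (mul_eq_zero.1 h2).resolve_right hpv

theorem eigen_perturb_inf (A : E →L[ℂ] E) (v : E) (l : ℝ) :
    eigen (perturb A v) l ⊓ LinearMap.ker (innerₛₗ ℂ v) =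
      eigen A l ⊓ LinearMap.ker (innerₛₗ ℂ v) := by
  ext x
  simp only [Submodule.mem_inf, mem_eigen, LinearMap.mem_ker, innerₛₗ_apply_apply, perturb_apply]
  constructor <;> rintro ⟨h1, h2⟩ <;> refine ⟨?_, h2⟩
  · simpa [h2] using h1
  · simpa [h2] using h1

theorem natCast_add_one_eq {c : Cardinal} {m : ℕ} (h : (m : Cardinal) = c + 1) :
    c = ((m - 1 : ℕ) : Cardinal) := by
  have hc : c < Cardinal.aleph0 :=
    (self_le_add_right c 1).trans_lt (h ▸ Cardinal.natCast_lt_aleph0)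
  obtain ⟨k, rfl⟩ := Cardinal.lt_aleph0.1 hc
  have : m = k + 1 := by exact_mod_cast h
  rw [this, Nat.add_sub_cancel]

/-- If `v` is not orthogonal to the eigenspace, the perturbation lowers its dimension by one. -/
theorem rank_eigen_perturb_of_inner_ne {A : E →L[ℂ] E} (hA : ∀ x y, ⟪A x, y⟫ = ⟪x, A y⟫) {l : ℝ}
    {v p : E} {m : ℕ} (hp : p ∈ eigen A l) (hpv : ⟪p, v⟫ ≠ 0)
    (hm : Module.rank ℂ (eigen A l) = m) :
    Module.rank ℂ (eigen (perturb A v) l) = ((m - 1 : ℕ) : Cardinal) := by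
  have h1 : eigen (perturb A v) l ≤ LinearMap.ker (innerₛₗ ℂ v) := fun x hx =>
    symm_eigen_orthogonal hA hp hpv hx
  have h2 : innerₛₗ ℂ v p ≠ 0 := by
    intro h
    apply hpv
    rw [← inner_conj_symm, ← innerₛₗ_apply_apply, h, map_zero]
  have h3 := rank_eq_rank_inf_ker_add_one (eigen A l) (innerₛₗ ℂ v) hp h2
  rw [← eigen_perturb_inf, inf_eq_left.2 h1, hm] at h3
  exact natCast_add_one_eq h3

/-- If `v` is orthogonal to the eigenspace and the perturbation has another eigenvector, the
dimension is raised by one. -/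
theorem rank_eigen_perturb_of_orthogonal {A : E →L[ℂ] E} {l : ℝ} {v x : E} {m : ℕ}
    (hv : ∀ p ∈ eigen A l, ⟪v, p⟫ = 0) (hx : x ∈ eigen (perturb A v) l) (hxv : ⟪v, x⟫ ≠ 0)
    (hm : Module.rank ℂ (eigen A l) = m) :
    Module.rank ℂ (eigen (perturb A v) l) = ((m + 1 : ℕ) : Cardinal) := by
  have h1 : eigen A l ≤ LinearMap.ker (innerₛₗ ℂ v) := fun p hp => hv p hp
  have h3 := rank_eq_rank_inf_ker_add_one (eigen (perturb A v) l) (innerₛₗ ℂ v) hx hxv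
  rw [eigen_perturb_inf, inf_eq_left.2 h1, hm] at h3
  rw [h3]
  push_cast
  rfl

/-! ### The secular function -/

/-- The resolvent `(A - l)⁻¹`. -/
def resolv (A : E →L[ℂ] E) (l : ℝ) : E →L[ℂ] E := Ring.inverse (A - (l : ℂ) • 1)

/-- The secular function `1 + ((A - l)⁻¹ v | v)`. -/
def secular (A : E →L[ℂ] E) (v : E) (l : ℝ) : ℝ := 1 + (⟪v, resolv A l v⟫).re

/-- `l` is a regular value: `A - l` is invertible. -/
def Regular (A : E →L[ℂ] E) (l : ℝ) : Prop := IsUnit (A - (l : ℂ) • (1 : E →L[ℂ] E))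

section

variable {A : E →L[ℂ] E} {l : ℝ}

theorem Regular.apply_resolv (h : Regular A l) (x : E) :
    A (resolv A l x) - (l : ℂ) • resolv A l x = x := by
  have := congrArg (fun T : E →L[ℂ] E => T x) (Ring.mul_inverse_cancel _ h)
  simpa [resolv] using this

theorem Regular.resolv_apply (h : Regular A l) (x : E) :
    resolv A l (A x - (l : ℂ) • x) = x := by
  have := congrArg (fun T : E →L[ℂ] E => T x) (Ring.inverse_mul_cancel _ h)
  simpa [resolv] using this

theorem Regular.inner_resolv (h : Regular A l) (hA : ∀ x y, ⟪A x, y⟫ = ⟪x, A y⟫) (x y : E) :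
    ⟪resolv A l x, y⟫ = ⟪x, resolv A l y⟫ := by
  conv_lhs => rw [← h.apply_resolv y]
  conv_rhs => rw [← h.apply_resolv x]
  rw [inner_sub_right, inner_sub_left, hA, inner_smul_left, inner_smul_right, Complex.conj_ofReal]

theorem Regular.inner_resolv_self (h : Regular A l) (hA : ∀ x y, ⟪A x, y⟫ = ⟪x, A y⟫) (v : E) :
    ⟪v, resolv A l v⟫ = ((secular A v l - 1 : ℝ) : ℂ) := by
  have h1 : conj ⟪v, resolv A l v⟫ = ⟪v, resolv A l v⟫ := by
    rw [inner_conj_symm, h.inner_resolv hA]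
  rw [secular, add_sub_cancel_left]
  exact (Complex.conj_eq_iff_re.1 h1).symm

theorem Regular.eigen_eq_bot (h : Regular A l) : eigen A l = ⊥ := by
  rw [Submodule.eq_bot_iff]
  intro x hx
  rw [← h.resolv_apply x, mem_eigen.1 hx, sub_self, map_zero]

/-- An eigenvector satisfies `x = -⟪v, x⟫ (A - l)⁻¹ v`. Pairing with `v` gives `⟪v, x⟫ · secular =
0`, and `⟪v, x⟫ = 0` forces `x = 0`. -/
theorem Regular.eigen_perturb_eq_bot (h : Regular A l) (hA : ∀ x y, ⟪A x, y⟫ = ⟪x, A y⟫) {v : E}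
    (hf : secular A v l ≠ 0) : eigen (perturb A v) l = ⊥ := by
  rw [Submodule.eq_bot_iff]
  intro x hx
  rw [mem_eigen, perturb_apply] at hx
  have h1 : A x - (l : ℂ) • x = -⟪v, x⟫ • v := by rw [← hx]; module
  have h2 := h.resolv_apply x
  rw [h1, map_smul] at h2
  have h3 : ⟪v, -⟪v, x⟫ • resolv A l v⟫ = ⟪v, x⟫ := by rw [h2]
  rw [inner_smul_right, h.inner_resolv_self hA] at h3
  have h4 : ⟪v, x⟫ * (secular A v l : ℂ) = 0 := by
    push_cast at h3
    linear_combination -h3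
  have h5 : ⟪v, x⟫ = 0 := (mul_eq_zero.1 h4).resolve_right (by exact_mod_cast hf)
  rw [← h2, h5]; simp

/-- The vector `(A - l)⁻¹ v` is an eigenvector. It is the only one up to scalars, since an
eigenvector orthogonal to `v` would be one of `A`. -/
theorem Regular.rank_eigen_perturb (h : Regular A l) (hA : ∀ x y, ⟪A x, y⟫ = ⟪x, A y⟫) {v : E}
    (hf : secular A v l = 0) : Module.rank ℂ (eigen (perturb A v) l) = 1 := by
  have h0 : ⟪v, resolv A l v⟫ = -1 := by rw [h.inner_resolv_self hA, hf]; simp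
  have h1 : resolv A l v ∈ eigen (perturb A v) l := by
    rw [mem_eigen, perturb_apply, h0]
    have := h.apply_resolv v
    rw [sub_eq_iff_eq_add] at this
    rw [this]; module
  have h2 := rank_eq_rank_inf_ker_add_one (eigen (perturb A v) l) (innerₛₗ ℂ v) h1
    (by rw [innerₛₗ_apply_apply, h0]; norm_num)
  rw [eigen_perturb_inf, h.eigen_eq_bot, bot_inf_eq, rank_bot, zero_add] at h2
  exact h2

/-- The resolvent has derivative equal to its square, and symmetry turns `⟪v, R² v⟫` into `‖R v‖²`.
The sign of this derivative is what counts the roots. -/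
theorem hasDerivAt_secular [CompleteSpace E] (h : Regular A l) (hA : ∀ x y, ⟪A x, y⟫ = ⟪x, A y⟫) (v : E) :
    HasDerivAt (secular A v) (‖resolv A l v‖ ^ 2) l := by
  obtain ⟨u, hu⟩ := h
  have hu' : resolv A l = ((u⁻¹ : (E →L[ℂ] E)ˣ) : E →L[ℂ] E) := by
    rw [resolv, ← hu, Ring.inverse_unit]
  have h1 : HasDerivAt (fun s : ℝ => A - (s : ℂ) • (1 : E →L[ℂ] E)) (-1) l := by
    have h2 : HasDerivAt (fun s : ℝ => (s : ℂ)) 1 l := Complex.ofRealCLM.hasDerivAt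
    exact ((h2.smul_const (1 : E →L[ℂ] E)).const_sub A).congr_deriv (by simp)
  have h3 : HasDerivAt (fun s : ℝ => resolv A s) (resolv A l * resolv A l) l := by
    have h4 := hasFDerivAt_ringInverse (𝕜 := ℝ) u
    rw [hu] at h4
    refine (h4.comp_hasDerivAt l h1).congr_deriv ?_
    rw [hu']
    simp
  let φ : (E →L[ℂ] E) →L[ℝ] ℝ :=
    Complex.reCLM.comp (((innerSL ℂ v).comp (ContinuousLinearMap.apply ℂ E v)).restrictScalars ℝ)
  have h5 := ((φ.hasFDerivAt.comp_hasDerivAt l h3)).const_add 1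
  refine h5.congr_deriv ?_
  have h6 : φ (resolv A l * resolv A l) = (⟪v, resolv A l (resolv A l v)⟫).re := by
    simp [φ]
  rw [h6, ← Regular.inner_resolv ⟨u, hu⟩ hA]
  exact (norm_sq_eq_re_inner (𝕜 := ℂ) _).symm

theorem Regular.resolv_ne_zero (h : Regular A l) {v : E} (hv : v ≠ 0) : resolv A l v ≠ 0 := by
  intro h0
  apply hv
  rw [← h.apply_resolv v, h0]; simp

theorem monotoneOn_secular [CompleteSpace E] {I : Set ℝ} (hI : Convex ℝ I) (hreg : ∀ l ∈ I, Regular A l)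
    (hA : ∀ x y, ⟪A x, y⟫ = ⟪x, A y⟫) (v : E) : MonotoneOn (secular A v) I :=
  monotoneOn_of_hasDerivWithinAt_nonneg hI
    (fun l hl => (hasDerivAt_secular (hreg l hl) hA v).continuousAt.continuousWithinAt)
    (fun l hl => (hasDerivAt_secular (hreg l (interior_subset hl)) hA v).hasDerivWithinAt)
    (fun _ _ => sq_nonneg _)

theorem strictMonoOn_secular [CompleteSpace E] {I : Set ℝ} (hI : Convex ℝ I) (hreg : ∀ l ∈ I, Regular A l)
    (hA : ∀ x y, ⟪A x, y⟫ = ⟪x, A y⟫) {v : E} (hv : v ≠ 0) : StrictMonoOn (secular A v) I :=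
  strictMonoOn_of_hasDerivWithinAt_pos hI
    (fun l hl => (hasDerivAt_secular (hreg l hl) hA v).continuousAt.continuousWithinAt)
    (fun l hl => (hasDerivAt_secular (hreg l (interior_subset hl)) hA v).hasDerivWithinAt)
    (fun l hl => by
      have := norm_pos_iff.2 ((hreg l (interior_subset hl)).resolv_ne_zero hv)
      positivity)

/-- Contribution of an eigenvector to the secular function. -/
theorem secular_add_eigenvector (h : Regular A l) (hA : ∀ x y, ⟪A x, y⟫ = ⟪x, A y⟫) {a : ℝ}
    (hal : a ≠ l) {p r : E} (hp : p ∈ eigen A a) (hpr : ⟪p, r⟫ = 0) :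
    secular A (p + r) l = secular A r l + ‖p‖ ^ 2 / (a - l) := by
  have hne : ((a - l : ℝ) : ℂ) ≠ 0 := by exact_mod_cast sub_ne_zero.2 hal
  have h1 : resolv A l p = ((a - l : ℝ) : ℂ)⁻¹ • p := by
    have h2 := h.resolv_apply p
    rw [mem_eigen.1 hp, ← sub_smul, map_smul, ← Complex.ofReal_sub] at h2
    rw [eq_inv_smul_iff₀ hne, h2]
  have h3 : ⟪p, resolv A l r⟫ = 0 := by
    rw [← h.inner_resolv hA, h1, inner_smul_left, hpr, mul_zero]
  have h4 : ⟪r, p⟫ = 0 := by rw [← inner_conj_symm, hpr, map_zero]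
  have h5 : ⟪p + r, resolv A l (p + r)⟫ = ⟪r, resolv A l r⟫ + ((‖p‖ ^ 2 / (a - l) : ℝ) : ℂ) := by
    rw [map_add, inner_add_left, inner_add_right, inner_add_right, h3, h1, inner_smul_right,
      inner_smul_right, h4, inner_self_eq_norm_sq_to_K]
    push_cast
    rw [div_eq_inv_mul]
    simp; ring
  rw [secular, secular, h5, Complex.add_re, Complex.ofReal_re]
  ring

/-- The eigenvector `p` contributes the pole `‖p‖² / (a - l)`, and the part from `r` is bounded
above near `a` by monotonicity alone. So `r` may still have a component in the eigenspace at `a`. -/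
theorem exists_secular_neg [CompleteSpace E] {a b : ℝ} (hab : a < b) (hreg : ∀ l ∈ Set.Ioo a b, Regular A l)
    (hA : ∀ x y, ⟪A x, y⟫ = ⟪x, A y⟫) {p r : E} (hp : p ∈ eigen A a) (hp0 : p ≠ 0)
    (hpr : ⟪p, r⟫ = 0) : ∃ l ∈ Set.Ioo a b, secular A (p + r) l < 0 := by
  set c : ℝ := (a + b) / 2
  have hc : c ∈ Set.Ioo a b := ⟨by simp only [c]; linarith, by simp only [c]; linarith⟩
  have hP : 0 < ‖p‖ ^ 2 := by have := norm_pos_iff.2 hp0; positivity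
  -- The first bound keeps `a + d` to the left of `c`, where monotonicity applies; the second makes
  -- the pole at least `|secular A r c| + 1` in size.
  set d : ℝ := min (c - a) (‖p‖ ^ 2 / (|secular A r c| + 1)) with hd
  have hd0 : 0 < d := lt_min (by linarith [hc.1]) (by positivity)
  have hl : a + d ∈ Set.Ioo a b := ⟨by linarith, by
    have := min_le_left (c - a) (‖p‖ ^ 2 / (|secular A r c| + 1)); linarith [hc.2]⟩
  refine ⟨a + d, hl, ?_⟩
  rw [secular_add_eigenvector (hreg _ hl) hA (by linarith) hp hpr]
  have h1 : secular A r (a + d) ≤ secular A r c :=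
    monotoneOn_secular (convex_Ioo a b) hreg hA r hl hc (by
      have := min_le_left (c - a) (‖p‖ ^ 2 / (|secular A r c| + 1)); linarith)
  have h2 : |secular A r c| + 1 ≤ ‖p‖ ^ 2 / d := by
    rw [le_div_iff₀ hd0, mul_comm, ← le_div_iff₀ (by positivity)]
    exact min_le_right _ _
  have h3 : ‖p‖ ^ 2 / (a - (a + d)) = -(‖p‖ ^ 2 / d) := by
    rw [show a - (a + d) = -d by ring, div_neg]
  rw [h3]
  linarith [le_abs_self (secular A r c)]

theorem exists_secular_pos [CompleteSpace E] {a b : ℝ} (hab : a < b) (hreg : ∀ l ∈ Set.Ioo a b, Regular A l)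
    (hA : ∀ x y, ⟪A x, y⟫ = ⟪x, A y⟫) {p r : E} (hp : p ∈ eigen A b) (hp0 : p ≠ 0)
    (hpr : ⟪p, r⟫ = 0) : ∃ l ∈ Set.Ioo a b, 0 < secular A (p + r) l := by
  set c : ℝ := (a + b) / 2
  have hc : c ∈ Set.Ioo a b := ⟨by simp only [c]; linarith, by simp only [c]; linarith⟩
  have hP : 0 < ‖p‖ ^ 2 := by have := norm_pos_iff.2 hp0; positivity
  set d : ℝ := min (b - c) (‖p‖ ^ 2 / (|secular A r c| + 1)) with hd
  have hd0 : 0 < d := lt_min (by linarith [hc.2]) (by positivity)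
  have hl : b - d ∈ Set.Ioo a b := ⟨by
    have := min_le_left (b - c) (‖p‖ ^ 2 / (|secular A r c| + 1)); linarith [hc.1], by linarith⟩
  refine ⟨b - d, hl, ?_⟩
  rw [secular_add_eigenvector (hreg _ hl) hA (by linarith) hp hpr]
  have h1 : secular A r c ≤ secular A r (b - d) :=
    monotoneOn_secular (convex_Ioo a b) hreg hA r hc hl (by
      have := min_le_left (b - c) (‖p‖ ^ 2 / (|secular A r c| + 1)); linarith)
  have h2 : |secular A r c| + 1 ≤ ‖p‖ ^ 2 / d := by
    rw [le_div_iff₀ hd0, mul_comm, ← le_div_iff₀ (by positivity)]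
    exact min_le_right _ _
  rw [show b - (b - d) = d by ring]
  linarith [neg_abs_le (secular A r c)]

/-- Here `‖(A - l)⁻¹ v‖ ≤ ‖v‖ / (l - ‖A‖)`, so `|⟪v, (A - l)⁻¹ v⟫| < 1`. -/
theorem secular_pos_of_large {v : E} (hreg : Regular A l) (hl : ‖A‖ + ‖v‖ ^ 2 < l) :
    0 < secular A v l := by
  set y := resolv A l v with hy
  have h1 : l * ‖y‖ ≤ ‖A‖ * ‖y‖ + ‖v‖ := by
    have h2 : (l : ℂ) • y = A y - v := by
      have := hreg.apply_resolv v
      rw [← hy] at this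
      rw [← this]; module
    have h3 : ‖(l : ℂ) • y‖ ≤ ‖A‖ * ‖y‖ + ‖v‖ := by
      rw [h2]
      exact (norm_sub_le _ _).trans (by gcongr; exact A.le_opNorm y)
    rwa [norm_smul, Complex.norm_real, Real.norm_of_nonneg
      (by linarith [norm_nonneg A, sq_nonneg ‖v‖])] at h3
  have h4 : -(‖v‖ * ‖y‖) ≤ (⟪v, y⟫).re :=
    (abs_le.1 ((Complex.abs_re_le_norm _).trans (norm_inner_le_norm v y))).1
  have h5 : ‖v‖ * ‖y‖ < 1 := by
    by_contra hcon
    push Not at hcon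
    have hv0 : 0 < ‖v‖ := by
      rcases (norm_nonneg v).eq_or_lt with h | h
      · rw [← h] at hcon; linarith [zero_mul ‖y‖]
      · exact h
    have hy0 : 0 < ‖y‖ := by
      rcases (norm_nonneg y).eq_or_lt with h | h
      · rw [← h] at hcon; linarith [mul_zero ‖v‖]
      · exact h
    have h6 : (l - ‖A‖) * ‖y‖ ≤ ‖v‖ := by linarith
    have h7 : ‖v‖ ^ 2 * ‖y‖ < (l - ‖A‖) * ‖y‖ := by
      apply mul_lt_mul_of_pos_right _ hy0; linarith
    nlinarith
  rw [secular, ← hy]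
  linarith

/-- The Fredholm alternative for compact operators. -/
theorem regular_of_eigen_eq_bot [CompleteSpace E] (hc : IsCompactOperator A) (hl : l ≠ 0) (h : eigen A l = ⊥) :
    Regular A l := by
  have h1 := IsCompactOperator.hasEigenvalue_or_mem_resolventSet hc
    (μ := (l : ℂ)) (by exact_mod_cast hl)
  rcases h1 with h1 | h1
  · exact absurd h h1
  · rw [spectrum.mem_resolventSet_iff, ← IsUnit.neg_iff, neg_sub, Algebra.algebraMap_eq_smul_one] at h1
    exact h1

theorem isOpen_regular [CompleteSpace E] (A : E →L[ℂ] E) : IsOpen {l : ℝ | Regular A l} := by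
  have h : Continuous fun l : ℝ => A - (l : ℂ) • (1 : E →L[ℂ] E) := by fun_prop
  exact Units.isOpen.preimage h

end

/-! ### Analytic dependence of the secular roots on time -/

open scoped ContDiff in
theorem contDiffAt_secular [CompleteSpace E] {A : E →L[ℂ] E} {v : ℝ → E} {t ρ : ℝ} (hv : AnalyticAt ℝ v t)
    (h : Regular A (ρ ^ 2)) :
    ContDiffAt ℝ ω (fun p : ℝ × ℝ => secular A (v p.1) (p.2 ^ 2)) (t, ρ) := by
  have h1 : ContDiffAt ℝ ω (fun p : ℝ × ℝ => v p.1) (t, ρ) :=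
    ContDiffAt.comp (t, ρ) hv.contDiffAt contDiffAt_fst
  have h2 : ContDiffAt ℝ ω (fun p : ℝ × ℝ => A - ((p.2 ^ 2 : ℝ) : ℂ) • (1 : E →L[ℂ] E)) (t, ρ) := by
    have h3 : ContDiff ℝ ω (fun p : ℝ × ℝ => ((p.2 ^ 2 : ℝ) : ℂ)) :=
      Complex.ofRealCLM.contDiff.comp (contDiff_snd.pow 2)
    exact contDiffAt_const.sub (h3.contDiffAt.smul contDiffAt_const)
  have h4 : ContDiffAt ℝ ω (fun p : ℝ × ℝ => resolv A (p.2 ^ 2)) (t, ρ) := by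
    obtain ⟨u, hu⟩ := h
    have h5 : ContDiffAt ℝ ω Ring.inverse (A - ((ρ ^ 2 : ℝ) : ℂ) • (1 : E →L[ℂ] E)) := by
      rw [← hu]; exact contDiffAt_ringInverse ℝ u
    exact ContDiffAt.comp (t, ρ) h5 h2
  have h6 : ContDiffAt ℝ ω (fun p : ℝ × ℝ => resolv A (p.2 ^ 2) (v p.1)) (t, ρ) := by
    have h7 := ((ContinuousLinearMap.restrictScalarsL ℂ E E ℝ ℝ).contDiff (n := ω)).contDiffAt.comp
      (t, ρ) h4
    exact h7.clm_apply h1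
  have h8 := h1.inner ℂ h6
  exact contDiffAt_const.add (Complex.reCLM.contDiff.contDiffAt.comp (t, ρ) h8)

open scoped ContDiff in
/-- Analyticity of the unique zero of an analytic family of functions with simple zeros. -/
theorem exists_analytic_root {g : ℝ × ℝ → ℝ} {g' : ℝ → ℝ → ℝ} {T I : Set ℝ} (hT : IsOpen T)
    (hI : IsOpen I) (hg : ∀ t ∈ T, ∀ ρ ∈ I, ContDiffAt ℝ ω g (t, ρ))
    (hg' : ∀ t ∈ T, ∀ ρ ∈ I, HasDerivAt (fun r => g (t, r)) (g' t ρ) ρ)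
    (hne : ∀ t ∈ T, ∀ ρ ∈ I, g' t ρ ≠ 0) (hex : ∀ t ∈ T, ∃ ρ ∈ I, g (t, ρ) = 0)
    (huniq : ∀ t ∈ T, ∀ ρ ∈ I, ∀ ρ' ∈ I, g (t, ρ) = 0 → g (t, ρ') = 0 → ρ = ρ') :
    ∃ r : ℝ → ℝ, AnalyticOnNhd ℝ r T ∧ ∀ t ∈ T, r t ∈ I ∧ g (t, r t) = 0 := by
  classical
  choose! r hrI hr0 using hex
  refine ⟨r, fun t ht => ?_, fun t ht => ⟨hrI t ht, hr0 t ht⟩⟩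
  have cdf := hg t ht (r t) (hrI t ht)
  have hω : (ω : WithTop ℕ∞) ≠ 0 := by simp
  have hinv : (fderiv ℝ g (t, r t) ∘L .inr ℝ ℝ ℝ).IsInvertible := by
    have hd := (cdf.differentiableAt hω).hasFDerivAt
    have h1 : HasDerivAt (fun s => g (t, s)) (fderiv ℝ g (t, r t) (0, 1)) (r t) := by
      have h2 : HasDerivAt (fun s : ℝ => (t, s)) ((0 : ℝ), (1 : ℝ)) (r t) :=
        (hasDerivAt_const _ _).prodMk (hasDerivAt_id _)
      exact hd.comp_hasDerivAt (r t) h2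
    have h3 := h1.unique (hg' t ht (r t) (hrI t ht))
    have hc := hne t ht (r t) (hrI t ht)
    refine ⟨ContinuousLinearEquiv.unitsEquivAut ℝ (Units.mk0 _ hc), ?_⟩
    ext
    simp [← h3]
  have key := cdf.contDiffAt_implicitFunction hω hinv
  have hself := cdf.implicitFunction_apply_self hω hinv
  have hev := cdf.eventually_apply_implicitFunction hω hinv
  refine (analyticWithinAt_univ.1 (contDiffWithinAt_omega_iff_analyticWithinAt.1 key)).congr ?_
  have hcont := key.continuousAt
  simp only at hself hcont hev
  have hevI : ∀ᶠ s in 𝓝 t, cdf.implicitFunction hω hinv s ∈ I :=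
    hcont.eventually (by rw [hself]; exact hI.mem_nhds (hrI t ht))
  -- The root `r` was chosen pointwise, without any continuity. The implicit function stays in the
  -- open set `I` near `t`, so uniqueness of the zero there identifies it with `r`.
  filter_upwards [hev, hevI, hT.mem_nhds ht] with s hs hsI hsT
  rw [hr0 t ht] at hs
  exact huniq s hsT _ hsI _ (hrI s hsT) hs (hr0 s hsT)

end

section

/-! ### Squares of families of antilinear operators -/

section AntilinearSquare

variable {E X : Type*} [NormedAddCommGroup E] [InnerProductSpace ℂ E] [NormedAddCommGroup X]
  [NormedSpace ℂ X]

/-- The square of an antilinear operator. -/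
def antiSq (K : E →L⋆[ℂ] E) : E →L[ℂ] E := K.comp K

/-- Only real bilinear: a complex scalar on the inner factor comes out conjugated. Real bilinearity
is enough for time derivatives. -/
theorem isBoundedBilinearMap_antilinear_comp (K : X →L[ℂ] (E →L⋆[ℂ] E)) :
    IsBoundedBilinearMap ℝ fun p : X × X => ((K p.1).comp (K p.2) : E →L[ℂ] E) where
  add_left a b c := by
    ext1 x
    simp
  smul_left r a b := by
    have h : r • a = (r : ℂ) • a := rfl
    ext1 x
    simp only [h, map_smul]
    simp
  add_right a b c := by
    ext1 x
    simp
  smul_right r a b := by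
    have h : r • b = (r : ℂ) • b := rfl
    ext1 x
    have h3 : (K a) ((r : ℂ) • (K b) x) = (r : ℂ) • (K a) ((K b) x) := by
      rw [map_smulₛₗ, Complex.conj_ofReal]
    simp only [h, map_smul]
    exact h3
  bound := by
    refine ⟨‖K‖ * ‖K‖ + 1, by positivity, fun a b => ?_⟩
    refine (ContinuousLinearMap.opNorm_comp_le _ _).trans ?_
    have h1 := K.le_opNorm a
    have h2 := K.le_opNorm b
    calc ‖K a‖ * ‖K b‖ ≤ (‖K‖ * ‖a‖) * (‖K‖ * ‖b‖) := by gcongr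
      _ ≤ (‖K‖ * ‖K‖ + 1) * ‖a‖ * ‖b‖ := by
        nlinarith [mul_nonneg (norm_nonneg a) (norm_nonneg b)]

theorem hasDerivAt_antiSq (K : X →L[ℂ] (E →L⋆[ℂ] E)) {u : ℝ → X} {g : X} {t : ℝ}
    (hu : HasDerivAt u g t) :
    HasDerivAt (fun t => antiSq (K (u t))) ((K (u t)).comp (K g) + (K g).comp (K (u t))) t := by
  have h := ((isBoundedBilinearMap_antilinear_comp K).hasFDerivAt (u t, u t)).comp_hasDerivAt t
    (hu.prodMk hu)
  exact h

theorem continuous_antiSq (K : X →L[ℂ] (E →L⋆[ℂ] E)) : Continuous fun u => antiSq (K u) :=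
  (isBoundedBilinearMap_antilinear_comp K).continuous.comp
    ((continuous_id (X := X)).prodMk continuous_id)

theorem continuous_lax (K : X →L[ℂ] (E →L⋆[ℂ] E)) (T : X →L[ℂ] E →L[ℂ] E) (a b : ℂ)
    {u f : ℝ → X} (hu : Continuous u) (hf : Continuous f) :
    Continuous fun t => a • T (f t) + b • antiSq (K (u t)) := by
  have h1 := (continuous_antiSq K).comp hu
  have h2 : Continuous fun t => T (f t) := T.continuous.comp hf
  exact (h2.const_smul a).add (h1.const_smul b)

end AntilinearSquare

end

/-! ### Dependence of the operators on the symbol -/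

theorem shiftedHankel_add (a b : C(Circ, ℂ)) :
    shiftedHankel (a + b) = shiftedHankel a + shiftedHankel b := by
  ext1 h
  rw [add_apply]
  simp only [shiftedHankel_apply]
  rw [mulL2_add, add_apply, map_add]

theorem shiftedHankel_smul (c : ℂ) (b : C(Circ, ℂ)) :
    shiftedHankel (c • b) = c • shiftedHankel b := by
  ext1 h
  rw [smul_apply]
  simp only [shiftedHankel_apply]
  rw [mulL2_smul, smul_apply, map_smul]

theorem norm_reflect (f : L2) : ‖reflect f‖ = ‖f‖ := by
  have h : ∀ f : L2, ‖reflect f‖ ≤ ‖f‖ := fun f => by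
    rw [reflect_apply]
    refine ((mulL2 _).le_of_opNorm_le (norm_mulL2_le _) _).trans ?_
    rw [fourier_norm, one_mul, norm_conjL2]
  refine le_antisymm (h f) ?_
  conv_lhs => rw [← reflect_reflect f]
  exact h _

theorem norm_shiftedHankel_le (u : C(Circ, ℂ)) : ‖shiftedHankel u‖ ≤ ‖u‖ := by
  refine ContinuousLinearMap.opNorm_le_bound _ (norm_nonneg _) fun h => ?_
  rw [shiftedHankel_apply]
  refine (norm_szego_le _).trans (((mulL2 u).le_of_opNorm_le (norm_mulL2_le u) _).trans ?_)
  rw [norm_reflect]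
  rfl

theorem toeplitz_add (a b : C(Circ, ℂ)) : toeplitz (a + b) = toeplitz a + toeplitz b := by
  ext1 h
  rw [add_apply]
  simp only [toeplitz_apply]
  rw [mulL2_add, add_apply, map_add]

theorem toeplitz_smul (c : ℂ) (b : C(Circ, ℂ)) : toeplitz (c • b) = c • toeplitz b := by
  ext1 h
  rw [smul_apply]
  simp only [toeplitz_apply]
  rw [mulL2_smul, smul_apply, map_smul]

theorem norm_toeplitz_le (u : C(Circ, ℂ)) : ‖toeplitz u‖ ≤ ‖u‖ := by
  refine ContinuousLinearMap.opNorm_le_bound _ (norm_nonneg _) fun h => ?_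
  rw [toeplitz_apply]
  exact (norm_szego_le _).trans ((mulL2 u).le_of_opNorm_le (norm_mulL2_le u) _)

/-- The symbol-to-operator map `b ↦ T_b`. -/
def toeplitzL : C(Circ, ℂ) →L[ℂ] (hardy →L[ℂ] hardy) :=
  LinearMap.mkContinuous (σ := RingHom.id ℂ) ⟨⟨toeplitz, toeplitz_add⟩, toeplitz_smul⟩ 1
    fun u => (one_mul ‖u‖).symm ▸ norm_toeplitz_le u

/-- The symbol-to-operator map `u ↦ K_u`. -/
def shiftedHankelL : C(Circ, ℂ) →L[ℂ] (hardy →L⋆[ℂ] hardy) :=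
  LinearMap.mkContinuous ⟨⟨shiftedHankel, shiftedHankel_add⟩, shiftedHankel_smul⟩ 1
    fun u => (one_mul ‖u‖).symm ▸ norm_shiftedHankel_le u

/-! ### Compactness -/

/-- Finite rank: `K` maps `zʲ` to the projection of `zⁿ⁻¹⁻ʲ`, so the range lies in the span of `zᵏ`
with `0 ≤ k < n`. -/
theorem isCompactOperator_shiftedHankel_fourier (n : ℤ) :
    IsCompactOperator (shiftedHankel (fourier n)) := by
  set V : Submodule ℂ hardy := Submodule.span ℂ
    ((fun k : ℕ => (⟨toL2 (fourier k), fourier_mem_hardy (by positivity)⟩ : hardy)) ''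
      Set.Iio n.toNat) with hV
  have : FiniteDimensional ℂ V :=
    FiniteDimensional.span_of_finite ℂ ((Set.finite_Iio _).image _)
  have : ProperSpace V := FiniteDimensional.proper ℂ V
  have hmem : ∀ h : hardy, shiftedHankel (fourier n) h ∈ V := by
    intro h
    have hVV : Vᗮᗮ = V := Submodule.orthogonal_orthogonal V
    rw [← hVV, Submodule.mem_orthogonal]
    intro y hy
    rw [Submodule.coe_inner, shiftedHankel_apply, inner_szego_right,
      ← star_star (fourier n : C(Circ, ℂ)), ← inner_mulL2_left, ← inner_conj_symm,
      inner_reflect_left, reflect_mulL2, star_star, ← inner_conj_symm (𝕜 := ℂ) _ (h : L2)]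
    have h0 : ⟪(h : L2), mulL2 (fourier n) (reflect (y : L2))⟫ = 0 := by
      rw [← inner_conj_symm, inner_eq_zero_of_mem_hardy _ h.2, map_zero]
      intro k hk
      rw [← star_star (fourier n : C(Circ, ℂ)), ← inner_mulL2_left, star_fourier, mulL2_toL2,
        fourier_mul_fourier, inner_fourier_reflect]
      have hk2 : -1 - (-n + k) = n - 1 - k := by ring
      rw [hk2]
      rcases lt_or_ge (n - 1 - k) 0 with h1 | h1
      · rw [mem_hardy_iff.1 y.2 _ h1, map_zero]
      · obtain ⟨j, hj⟩ := Int.eq_ofNat_of_zero_le h1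
        rw [hj]
        have := Submodule.mem_orthogonal _ _ |>.1 hy _
          (Submodule.subset_span ⟨j, by simp only [Set.mem_Iio]; omega, rfl⟩)
        rw [Submodule.coe_inner] at this
        rw [this, map_zero]
    rw [h0, map_zero, map_zero]
  have h1 : IsCompactOperator (V.subtypeL ∘ ((shiftedHankel (fourier n)).codRestrict V hmem)) :=
    (isCompactOperator_of_locallyCompactSpace_rng V.subtypeL).comp_clm _
  exact h1

/-- Trigonometric polynomials are uniformly dense, `‖K_u‖ ≤ ‖u‖`, and compact operators form a
closed set. -/
theorem isCompactOperator_shiftedHankel (u : C(Circ, ℂ)) :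
    IsCompactOperator (shiftedHankel u) := by
  let S : Submodule ℂ C(Circ, ℂ) :=
    (compactOperator (starRingEnd ℂ) hardy hardy).comap shiftedHankelL.toLinearMap
  have hS : IsClosed (S : Set C(Circ, ℂ)) :=
    isClosed_setOfPred_isCompactOperator.preimage shiftedHankelL.continuous
  have h1 : (Submodule.span ℂ (Set.range (fourier (T := 2 * Real.pi)))).topologicalClosure ≤ S := by
    refine Submodule.topologicalClosure_minimal _ (Submodule.span_le.2 ?_) hS
    rintro _ ⟨n, rfl⟩
    exact isCompactOperator_shiftedHankel_fourier n
  rw [span_fourier_closure_eq_top] at h1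
  exact h1 (Submodule.mem_top (x := u))

theorem isCompactOperator_shiftedHankelSq (u : C(Circ, ℂ)) :
    IsCompactOperator (shiftedHankelSq u) :=
  (isCompactOperator_shiftedHankel u).comp_clm (shiftedHankel u)

/-! ### The Lax pair -/

/-- The skew-adjoint operator `C_u = -i T_{|u|²} + (i/2) K_u²` of the Lax pair for `K_u`. -/
def laxOp (u : C(Circ, ℂ)) : hardy →L[ℂ] hardy :=
  (-Complex.I) • toeplitz (u * star u) + (Complex.I / 2) • shiftedHankelSq u

theorem star_laxOp (u : C(Circ, ℂ)) : star (laxOp u) = -laxOp u := by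
  have h1 : star (toeplitz (u * star u)) = toeplitz (u * star u) :=
    isSelfAdjoint_toeplitz (by rw [star_mul, star_star])
  have h2 : star (shiftedHankelSq u) = shiftedHankelSq u := isSelfAdjoint_shiftedHankelSq u
  have h3 : ∀ (a b : ℂ) (X Y : hardy →L[ℂ] hardy),
      star (a • X + b • Y) = conj a • star X + conj b • star Y := by
    intro a b X Y
    simp only [ContinuousLinearMap.star_eq_adjoint, map_add, map_smulₛₗ]
  rw [laxOp, h3, h1, h2]
  simp only [map_neg, map_div₀, Complex.conj_I, map_ofNat]
  module

theorem continuous_laxOp {u : ℝ → C(Circ, ℂ)} (hu : Continuous u) :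
    Continuous fun t => laxOp (u t) :=
  continuous_lax shiftedHankelL toeplitzL (-Complex.I) (Complex.I / 2) hu
    (hu.mul (continuous_star.comp hu))

theorem szego_toL2_of_vectorField {α : ℝ} {u g : C(Circ, ℂ)} (hg : toL2 g = vectorField α u) :
    szego (toL2 g) = szego (toL2 (-Complex.I • (u * star u * u + ((α : ℂ) * ∫ x, u x ∂μ) • 1))) := by
  have h : ∀ (c d : ℂ) (a : C(Circ, ℂ)), toL2 (c • (a + d • 1)) = c • (toL2 a + d • toL2 1) := by
    intro c d a
    simp only [toL2, map_smul, map_add]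
  rw [hg, h, vectorField, map_smul, map_smul, map_add, map_add, szego_coe, mul_right_comm u]

/-- Constants are invisible to `K`; for this reason `α` does not enter the Lax equation. -/
theorem szego_reflect_eq_zero (h : hardy) (c : ℂ) :
    szego (mulL2 (c • (1 : C(Circ, ℂ))) (reflect (h : L2))) = 0 := by
  rw [mulL2_smul, smul_apply, mulL2_one, map_smul, szego_reflect_coe, smul_zero]

/-- As `K_u` is antilinear, it conjugates the coefficients of `C_u`. The right side is therefore `-i
(T K + K T - K³)` with `T = T_{|u|²}`, which is `-i` times the identity `shiftedHankel_cubic`. -/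
theorem shiftedHankel_vectorField {α : ℝ} {u g : C(Circ, ℂ)} (hu : toL2 u ∈ hardy)
    (hg : toL2 g = vectorField α u) (h : hardy) :
    shiftedHankel g h = laxOp u (shiftedHankel u h) - shiftedHankel u (laxOp u h) := by
  rw [shiftedHankel_apply g, szego_mulL2_reflect_of_szego_eq (szego_toL2_of_vectorField hg),
    mulL2_smul, mulL2_add, smul_apply, add_apply, map_smul,
    map_add, szego_reflect_eq_zero, add_zero, shiftedHankel_cubic hu]
  simp only [laxOp, add_apply, smul_apply, map_add,
    map_smulₛₗ, map_neg, map_div₀, Complex.conj_I, map_ofNat]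
  have h3 : shiftedHankelSq u (shiftedHankel u h) = shiftedHankel u (shiftedHankelSq u h) := rfl
  rw [h3]
  module

/-- The time derivative of `K_u²` along the flow is the commutator with `C_u`. -/
theorem shiftedHankel_comp_vectorField {α : ℝ} {u g : C(Circ, ℂ)} (hu : toL2 u ∈ hardy)
    (hg : toL2 g = vectorField α u) :
    ((shiftedHankel u).comp (shiftedHankel g) + (shiftedHankel g).comp (shiftedHankel u) :
      hardy →L[ℂ] hardy) = laxOp u * shiftedHankelSq u - shiftedHankelSq u * laxOp u := by
  ext1 x
  simp only [add_apply, ContinuousLinearMap.comp_apply,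
    sub_apply, mul_apply_eq_comp,
    shiftedHankel_vectorField hu hg, map_sub, shiftedHankelSq_apply]
  abel

/-! ### Moments and spectral gaps for rank one perturbations -/

variable {E : Type*} [NormedAddCommGroup E] [InnerProductSpace ℂ E] [CompleteSpace E]

/-- An eigenvector of `A + (· | u) u` at a regular value is orthogonal to `e` if all the moments
`(Aⁿ u | e)` vanish. -/
theorem inner_eigen_perturb_eq_zero {A : E →L[ℂ] E} (hA : ∀ x y, ⟪A x, y⟫ = ⟪x, A y⟫) {u e : E}
    (hmom : ∀ n : ℕ, ⟪e, (A ^ n) u⟫ = 0) {l : ℝ} (hl : eigen A l = ⊥) {x : E}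
    (hx : x ∈ eigen (perturb A u) l) : ⟪e, x⟫ = 0 := by
  have hpow : ∀ (n : ℕ) (x y : E), ⟪(A ^ n) x, y⟫ = ⟪x, (A ^ n) y⟫ := by
    intro n
    induction n with
    | zero => simp
    | succ n ih =>
      intro x y
      rw [pow_succ', mul_apply_eq_comp, hA, ih, ← mul_apply_eq_comp, ← pow_succ, pow_succ']
  -- `M` is the cyclic space of `e`. Its complement is `A`-invariant and contains `u`, so the
  -- perturbation acts there only; the component of `x` in `Mᗮᗮ` is an eigenvector of `A`, hence
  -- zero.
  set M : Submodule ℂ E := Submodule.span ℂ (Set.range fun n : ℕ => (A ^ n) e) with hM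
  have hmem : ∀ y, y ∈ Mᗮ ↔ ∀ n : ℕ, ⟪(A ^ n) e, y⟫ = 0 := by
    intro y
    rw [Submodule.mem_orthogonal]
    constructor
    · exact fun h n => h _ (Submodule.subset_span ⟨n, rfl⟩)
    · intro h z hz
      induction hz using Submodule.span_induction with
      | mem z hz => obtain ⟨n, rfl⟩ := hz; exact h n
      | zero => simp
      | add a b _ _ ha hb => rw [inner_add_left, ha, hb, add_zero]
      | smul c a _ ha => rw [inner_smul_left, ha, mul_zero]
  have hu : u ∈ Mᗮ := (hmem u).2 fun n => by rw [hpow]; exact hmom n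
  have hAN : ∀ y ∈ Mᗮ, A y ∈ Mᗮ := by
    intro y hy
    rw [hmem] at hy ⊢
    intro n
    rw [← hA, ← mul_apply_eq_comp, ← pow_succ']
    exact hy (n + 1)
  have hANp : ∀ y ∈ Mᗮᗮ, A y ∈ Mᗮᗮ := by
    intro y hy
    rw [Submodule.mem_orthogonal] at hy ⊢
    intro z hz
    rw [← hA]
    exact hy _ (hAN z hz)
  obtain ⟨p, hp, q, hq, rfl⟩ := Mᗮ.exists_add_mem_mem_orthogonal x
  have huq : ⟪u, q⟫ = 0 := (Submodule.mem_orthogonal _ _).1 hq u hu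
  rw [mem_eigen, perturb_apply, inner_add_right, huq, add_zero, map_add, smul_add] at hx
  have h1 : A q - (l : ℂ) • q ∈ Mᗮᗮ :=
    Submodule.sub_mem _ (hANp q hq) (Submodule.smul_mem _ _ hq)
  have h2 : A q - (l : ℂ) • q ∈ Mᗮ := by
    have h3 : A q - (l : ℂ) • q = (l : ℂ) • p - A p - ⟪u, p⟫ • u := by
      rw [sub_sub, sub_eq_sub_iff_add_eq_add]
      calc A q + (A p + ⟪u, p⟫ • u) = A p + A q + ⟪u, p⟫ • u := by abel
        _ = _ := hx
    rw [h3]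
    exact Submodule.sub_mem _ (Submodule.sub_mem _ (Submodule.smul_mem _ _ hp) (hAN p hp))
      (Submodule.smul_mem _ _ hu)
  have h4 : A q - (l : ℂ) • q = 0 :=
    inner_self_eq_zero.1 ((Submodule.mem_orthogonal _ _).1 h1 _ h2)
  have h5 : q ∈ eigen A l := mem_eigen.2 (sub_eq_zero.1 h4)
  rw [hl, Submodule.mem_bot] at h5
  rw [h5, add_zero]
  simpa using (hmem p).1 hp 0

/-- Spectral gap above zero: a positive operator without spectrum in `(0, s)` is bounded below by
`s` on the orthogonal complement of its kernel. -/
theorem le_inner_of_gap {A : E →L[ℂ] E} (hA : A.IsPositive) {s : ℝ}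
    (hreg : ∀ l ∈ Set.Ioo 0 s, Regular A l) {y : E} (hy : y ∈ (eigen A 0)ᗮ) :
    s * ‖y‖ ^ 2 ≤ (⟪A y, y⟫).re := by
  have hsa : IsSelfAdjoint A := hA.isSelfAdjoint
  have hsymm : ∀ x y, ⟪A x, y⟫ = ⟪x, A y⟫ := fun x y =>
    (ContinuousLinearMap.isSelfAdjoint_iff_isSymmetric.1 hsa) x y
  -- The spectrum lies in `{0} ∪ [s, ∞)`, where `x² (x - s) ≥ 0`. This gives the bound on the range
  -- of `A`, which is dense in the complement of the kernel.
  have hpos : 0 ≤ cfc (fun x : ℝ => x ^ 3 - s * x ^ 2) A := by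
    refine cfc_nonneg fun x hx => ?_
    have h0 : 0 ≤ x := spectrum_nonneg_of_nonneg
      ((ContinuousLinearMap.nonneg_iff_isPositive A).2 hA) hx
    have h1 : x = 0 ∨ s ≤ x := by
      by_contra hcon
      push Not at hcon
      have h2 := hreg x ⟨lt_of_le_of_ne h0 (Ne.symm hcon.1), hcon.2⟩
      apply hx
      rw [spectrum.mem_resolventSet_iff, ← IsUnit.neg_iff, neg_sub, Algebra.algebraMap_eq_smul_one]
      exact h2
    rcases h1 with rfl | h1
    · simp
    · nlinarith [mul_nonneg (sq_nonneg x) (sub_nonneg.2 h1)]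
  have hcfc : cfc (fun x : ℝ => x ^ 3 - s * x ^ 2) A = A ^ 3 - s • A ^ 2 := by
    rw [cfc_sub (fun x : ℝ => x ^ 3) (fun x : ℝ => s * x ^ 2) A, cfc_pow_id A 3,
      cfc_const_mul s (fun x : ℝ => x ^ 2) A, cfc_pow_id A 2]
  rw [hcfc, ContinuousLinearMap.nonneg_iff_isPositive] at hpos
  have hrange : ∀ z, s * ‖A z‖ ^ 2 ≤ (⟪A (A z), A z⟫).re := by
    intro z
    have h1 := hpos.re_inner_nonneg_left z
    have h2 : (A ^ 3 - s • A ^ 2) z = A (A (A z)) - (s : ℂ) • A (A z) := by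
      simp [pow_succ, pow_zero]
    have h3 : ⟪A (A z), z⟫ = ((‖A z‖ ^ 2 : ℝ) : ℂ) := by
      rw [hsymm, inner_self_eq_norm_sq_to_K]; simp
    rw [h2, inner_sub_left, inner_smul_left, hsymm (A (A z)), h3, Complex.conj_ofReal,
      ← Complex.ofReal_mul] at h1
    simp only [RCLike.re_to_complex, Complex.sub_re, Complex.ofReal_re] at h1
    linarith
  have hclos : y ∈ closure (Set.range A) := by
    have h1 : (eigen A 0)ᗮ = (LinearMap.range (A : E →ₗ[ℂ] E)).topologicalClosure := by
      rw [← Submodule.orthogonal_orthogonal_eq_closure]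
      congr 1
      ext x
      rw [mem_eigen, Submodule.mem_orthogonal]
      simp only [Complex.ofReal_zero, zero_smul]
      constructor
      · rintro hx _ ⟨z, rfl⟩
        change ⟪A z, x⟫ = 0
        rw [hsymm, hx, inner_zero_right]
      · intro hx
        have := hx (A (A x)) ⟨A x, rfl⟩
        rw [hsymm] at this
        exact inner_self_eq_zero.1 this
    rw [h1] at hy
    exact hy
  have hclosed : IsClosed {y : E | s * ‖y‖ ^ 2 ≤ (⟪A y, y⟫).re} :=
    isClosed_le (by fun_prop) (Complex.continuous_re.comp (A.continuous.inner continuous_id))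
  refine closure_minimal ?_ hclosed hclos
  rintro _ ⟨z, rfl⟩
  exact hrange z

/-- Solvability of `(A + (· | u) u) y = e` in the presence of a spectral gap above zero. -/
theorem exists_perturb_eq {A : E →L[ℂ] E} (hA : A.IsPositive) {s : ℝ} (hs : 0 < s)
    (hreg : ∀ l ∈ Set.Ioo 0 s, Regular A l) {u e : E} (hu : ∀ x ∈ eigen A 0, ⟪u, x⟫ = 0)
    (he : ∀ x ∈ eigen A 0, ⟪e, x⟫ = 0) : ∃ y, perturb A u y = e := by
  have hsymm : ∀ x y, ⟪A x, y⟫ = ⟪x, A y⟫ := fun x y =>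
    (ContinuousLinearMap.isSelfAdjoint_iff_isSymmetric.1 hA.isSelfAdjoint) x y
  have : CompleteSpace (eigen A 0) := (isClosed_eigen A 0).completeSpace_coe
  set P : E →L[ℂ] E := (eigen A 0).starProjection with hP
  have hPmem : ∀ x, P x ∈ eigen A 0 := fun x => (eigen A 0).starProjection_apply_mem x
  have hAP : ∀ x, A (P x) = 0 := fun x => by
    have := mem_eigen.1 (hPmem x)
    simpa using this
  have hPin : ∀ x, x - P x ∈ (eigen A 0)ᗮ := fun x =>
    (eigen A 0).sub_starProjection_mem_orthogonal x
  -- Adding the projection on the kernel makes the operator coercive: the gap gives `s` off the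
  -- kernel and `P` gives `1` on it.
  have hunit : IsUnit (perturb A u + P) := by
    have hc : 0 < min s 1 := lt_min hs one_pos
    refine ContinuousLinearMap.isUnit_of_forall_le_norm_inner_map _
      (c := ⟨min s 1, hc.le⟩) hc fun x => ?_
    set y := x - P x with hy
    have hxy : x = y + P x := by rw [hy, sub_add_cancel]
    have horth : ⟪y, P x⟫ = 0 := by
      rw [← inner_conj_symm, (Submodule.mem_orthogonal _ _).1 (hPin x) _ (hPmem x), map_zero]
    have horth' : ⟪P x, y⟫ = 0 := (Submodule.mem_orthogonal _ _).1 (hPin x) _ (hPmem x)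
    have h1 : ⟪A x, x⟫ = ⟪A y, y⟫ := by
      have h2 : A x = A y := by rw [hy, map_sub, hAP, sub_zero]
      rw [h2]
      conv_lhs => rw [hxy]
      rw [inner_add_right, hsymm y (P x), hAP, inner_zero_right, add_zero]
    have h3 : ⟪P x, x⟫ = ((‖P x‖ ^ 2 : ℝ) : ℂ) := by
      have h2 : ⟪P x, x⟫ = ⟪P x, y + P x⟫ := by rw [← hxy]
      rw [h2, inner_add_right, horth', zero_add, inner_self_eq_norm_sq_to_K]; simp
    have h4 : ⟪⟪u, x⟫ • u, x⟫ = ((‖⟪u, x⟫‖ ^ 2 : ℝ) : ℂ) := by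
      rw [inner_smul_left, ← Complex.normSq_eq_norm_sq, ← Complex.normSq_eq_conj_mul_self]
    have h5 : ‖x‖ ^ 2 = ‖y‖ ^ 2 + ‖P x‖ ^ 2 := by
      have h6 : ⟪x, x⟫ = ⟪y, y⟫ + ⟪P x, P x⟫ := by
        have h2 : ⟪x, x⟫ = ⟪y + P x, y + P x⟫ := by rw [← hxy]
        rw [h2, inner_add_left, inner_add_right, inner_add_right, horth, horth']; ring
      rw [inner_self_eq_norm_sq_to_K, inner_self_eq_norm_sq_to_K, inner_self_eq_norm_sq_to_K] at h6
      exact_mod_cast h6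
    have h7 := le_inner_of_gap hA hreg (hPin x)
    rw [← hy] at h7
    refine le_trans ?_ (Complex.re_le_norm _)
    rw [add_apply, perturb_apply, inner_add_left, inner_add_left, h1, h3, h4]
    simp only [Complex.add_re, Complex.ofReal_re]
    rw [h5]
    have h8 : min s 1 * ‖y‖ ^ 2 ≤ s * ‖y‖ ^ 2 := by gcongr; exact min_le_left _ _
    have h9 : min s 1 * ‖P x‖ ^ 2 ≤ 1 * ‖P x‖ ^ 2 := by gcongr; exact min_le_right _ _
    change (‖y‖ ^ 2 + ‖P x‖ ^ 2) * min s 1 ≤ _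
    nlinarith [sq_nonneg ‖⟪u, x⟫‖]
  refine ⟨Ring.inverse (perturb A u + P) e, ?_⟩
  set y := Ring.inverse (perturb A u + P) e with hy
  have h1 : perturb A u y + P y = e := by
    have := congrArg (fun T : E →L[ℂ] E => T e) (Ring.mul_inverse_cancel _ hunit)
    simpa [hy] using this
  -- The correction vanishes because `e`, `u` and the range of `A` are all orthogonal to the kernel.
  have h2 : P y = 0 := by
    rw [← inner_self_eq_zero (𝕜 := ℂ)]
    have h3 : P y = e - perturb A u y := by rw [← h1]; abel
    have h4 : ⟪P y, P y⟫ = ⟪e - perturb A u y, P y⟫ := by rw [← h3]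
    rw [h4, inner_sub_left, perturb_apply, inner_add_left, hsymm, inner_smul_left]
    rw [hAP, he _ (hPmem y), hu _ (hPmem y)]
    simp
  rw [h2, add_zero] at h1
  exact h1

/-! ### Spectral rigidity of Hankel operators -/

theorem hankelSq_eq_perturb {u : C(Circ, ℂ)} (hu : toL2 u ∈ hardy) :
    hankelSq u = perturb (shiftedHankelSq u) ⟨toL2 u, hu⟩ := by
  ext1 x
  rw [perturb_apply, hankelSq_eq hu]

theorem symm_shiftedHankelSq (u : C(Circ, ℂ)) (x y : hardy) :
    ⟪shiftedHankelSq u x, y⟫ = ⟪x, shiftedHankelSq u y⟫ :=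
  (ContinuousLinearMap.isSelfAdjoint_iff_isSymmetric.1 (isSelfAdjoint_shiftedHankelSq u)) x y

theorem symm_hankelSq (u : C(Circ, ℂ)) (x y : hardy) :
    ⟪hankelSq u x, y⟫ = ⟪x, hankelSq u y⟫ := by
  rw [inner_hankelSq, ← conj_inner_hardy _ x, inner_hankelSq, conj_inner_hardy]

theorem isPositive_shiftedHankelSq (u : C(Circ, ℂ)) : (shiftedHankelSq u).IsPositive := by
  rw [ContinuousLinearMap.isPositive_def']
  refine ⟨isSelfAdjoint_shiftedHankelSq u, fun x => ?_⟩
  have h : (shiftedHankelSq u).reApplyInnerSelf x = ‖shiftedHankel u x‖ ^ 2 := by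
    rw [ContinuousLinearMap.reApplyInnerSelf_apply, inner_shiftedHankelSq]
    exact (norm_sq_eq_re_inner (𝕜 := ℂ) (E := hardy) (shiftedHankel u x)).symm
  rw [h]
  positivity

theorem hankel_mem_eigen {u : C(Circ, ℂ)} {l : ℝ} {x : hardy} (hx : x ∈ eigen (hankelSq u) l) :
    hankel u x ∈ eigen (hankelSq u) l := by
  rw [mem_eigen] at hx ⊢
  have h1 : hankelSq u (hankel u x) = hankel u (hankelSq u x) := rfl
  rw [h1, hx, map_smulₛₗ, Complex.conj_ofReal]

theorem shiftedHankel_mem_eigen {u : C(Circ, ℂ)} {l : ℝ} {x : hardy}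
    (hx : x ∈ eigen (shiftedHankelSq u) l) : shiftedHankel u x ∈ eigen (shiftedHankelSq u) l := by
  rw [mem_eigen] at hx ⊢
  have h1 : shiftedHankelSq u (shiftedHankel u x) = shiftedHankel u (shiftedHankelSq u x) := rfl
  rw [h1, hx, map_smulₛₗ, Complex.conj_ofReal]

theorem inner_hankel_hardyOne {u : C(Circ, ℂ)} (hu : toL2 u ∈ hardy) (x : hardy) :
    ⟪hankel u x, hardyOne⟫ = ⟪(⟨toL2 u, hu⟩ : hardy), x⟫ := by
  rw [inner_hankel, hankel_one hu]

theorem mem_eigen_hankelSq_iff {u : C(Circ, ℂ)} (hu : toL2 u ∈ hardy) {l : ℝ} {x : hardy}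
    (hx : ⟪(⟨toL2 u, hu⟩ : hardy), x⟫ = 0) :
    x ∈ eigen (hankelSq u) l ↔ x ∈ eigen (shiftedHankelSq u) l := by
  rw [mem_eigen, mem_eigen, hankelSq_eq hu, hx, zero_smul, add_zero]

theorem inner_fourier_toeplitz_neg_one (x : hardy) {n : ℤ} (hn : 0 ≤ n) :
    ⟪toL2 (fourier n), ((toeplitz (fourier (-1)) x : hardy) : L2)⟫ =
      ⟪toL2 (fourier (n + 1)), (x : L2)⟫ := by
  rw [toeplitz_apply, inner_fourier_szego, if_pos hn, ← star_star (fourier (-1) : C(Circ, ℂ)),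
    ← inner_mulL2_left, star_fourier, mulL2_toL2, fourier_mul_fourier]
  congr 3; ring

/-- An eigenspace of `K_u²` orthogonal to both `u` and `1` is trivial. -/
theorem eigen_shiftedHankelSq_eq_bot {u : C(Circ, ℂ)} (hu : toL2 u ∈ hardy) {l : ℝ} (hl : l ≠ 0)
    (h1 : ∀ x ∈ eigen (shiftedHankelSq u) l, ⟪(⟨toL2 u, hu⟩ : hardy), x⟫ = 0)
    (h2 : ∀ x ∈ eigen (shiftedHankelSq u) l, ⟪hardyOne, x⟫ = 0) :
    eigen (shiftedHankelSq u) l = ⊥ := by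
  have hlC : (l : ℂ) ≠ 0 := by exact_mod_cast hl
  -- `H_u²` and `K_u²` agree on vectors orthogonal to `u`, and `⟪u, H_u x⟫` is conjugate to `⟪1,
  -- H_u² x⟫ = l ⟪1, x⟫ = 0`.
  have hH : ∀ x ∈ eigen (shiftedHankelSq u) l, hankel u x ∈ eigen (shiftedHankelSq u) l := by
    intro x hx
    have h3 : ⟪(⟨toL2 u, hu⟩ : hardy), hankel u x⟫ = 0 := by
      rw [← conj_inner_hardy, inner_hankel, ← hankel_one hu, ← hankelSq_apply, symm_hankelSq,
        mem_eigen.1 ((mem_eigen_hankelSq_iff hu (h1 x hx)).2 hx), inner_smul_right, h2 x hx,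
        mul_zero, map_zero]
    exact (mem_eigen_hankelSq_iff hu h3).1
      (hankel_mem_eigen ((mem_eigen_hankelSq_iff hu (h1 x hx)).2 hx))
  -- Since `x = l⁻¹ H_u² x`, one has `T_z^* x = l⁻¹ K_u H_u x`. A space invariant under the backward
  -- shift and orthogonal to `1` has only zero Fourier coefficients.
  have hT : ∀ x ∈ eigen (shiftedHankelSq u) l,
      toeplitz (fourier (-1)) x ∈ eigen (shiftedHankelSq u) l := by
    intro x hx
    have h3 : hankel u (hankel u x) = (l : ℂ) • x :=
      mem_eigen.1 ((mem_eigen_hankelSq_iff hu (h1 x hx)).2 hx)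
    have h4 : x = (l : ℂ)⁻¹ • hankel u (hankel u x) := by
      rw [h3, smul_smul, inv_mul_cancel₀ hlC, one_smul]
    rw [h4, map_smul, ← shiftedHankel_eq_toeplitz]
    exact Submodule.smul_mem _ _ (shiftedHankel_mem_eigen (hH x hx))
  rw [Submodule.eq_bot_iff]
  have hcoef : ∀ (n : ℕ) (x : hardy), x ∈ eigen (shiftedHankelSq u) l →
      ⟪toL2 (fourier n), (x : L2)⟫ = 0 := by
    intro n
    induction n with
    | zero =>
      intro x hx
      have h3 := h2 x hx
      have h4 : ⟪hardyOne, x⟫ = ⟪toL2 1, (x : L2)⟫ := rfl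
      rwa [h4, toL2_one, ← toL2_fourier] at h3
    | succ n ih =>
      intro x hx
      have h3 := ih _ (hT x hx)
      rw [inner_fourier_toeplitz_neg_one x (by positivity)] at h3
      exact_mod_cast h3
  intro x hx
  apply Subtype.ext
  apply L2_ext
  intro n
  rw [Submodule.coe_zero, inner_zero_right]
  rcases lt_or_ge n 0 with hn | hn
  · exact mem_hardy_iff.1 x.2 n hn
  · lift n to ℕ using hn
    exact hcoef n x hx

/-- If a nontrivial eigenspace of `K_u²` is orthogonal to `u`, then the corresponding eigenspace
of `H_u²` is not. -/
theorem exists_eigen_hankelSq_inner_ne {u : C(Circ, ℂ)} (hu : toL2 u ∈ hardy) {l : ℝ} (hl : l ≠ 0)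
    (h1 : ∀ x ∈ eigen (shiftedHankelSq u) l, ⟪(⟨toL2 u, hu⟩ : hardy), x⟫ = 0)
    (hne : eigen (shiftedHankelSq u) l ≠ ⊥) :
    ∃ x ∈ eigen (hankelSq u) l, ⟪(⟨toL2 u, hu⟩ : hardy), x⟫ ≠ 0 := by
  by_contra! hcon
  refine hne (eigen_shiftedHankelSq_eq_bot hu hl h1 fun x hx => ?_)
  have hx' := (mem_eigen_hankelSq_iff hu (h1 x hx)).2 hx
  -- If the eigenspace of `H_u²` were orthogonal to `u`, then `⟪H_u (H_u x), 1⟫ = ⟪u, H_u x⟫ = 0`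
  -- would give `l ⟪1, x⟫ = 0`, orthogonality to `1` as well.
  have h3 : ⟪hardyOne, hankel u (hankel u x)⟫ = 0 := by
    rw [← conj_inner_hardy, inner_hankel_hardyOne hu, hcon _ (hankel_mem_eigen hx'), map_zero]
  have h4 : hankel u (hankel u x) = (l : ℂ) • x := mem_eigen.1 hx'
  rw [h4] at h3
  have h5 := (inner_smul_right (𝕜 := ℂ) (E := hardy) hardyOne x (l : ℂ)).symm.trans h3
  exact (mul_eq_zero.1 h5).resolve_left (by exact_mod_cast hl)

/-- If `K_u²` has a spectral gap above zero, its kernel is not orthogonal to both `u` and `1`. -/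
theorem not_orthogonal_ker_shiftedHankelSq {u : C(Circ, ℂ)} (hu : toL2 u ∈ hardy) {s : ℝ}
    (hs : 0 < s) (hreg : ∀ l ∈ Set.Ioo 0 s, Regular (shiftedHankelSq u) l)
    (h1 : ∀ x ∈ eigen (shiftedHankelSq u) 0, ⟪(⟨toL2 u, hu⟩ : hardy), x⟫ = 0)
    (h2 : ∀ x ∈ eigen (shiftedHankelSq u) 0, ⟪hardyOne, x⟫ = 0) : False := by
  -- Solve `H_u² y = 1`. Then `y' = H_u y` has `K_u y' = T_z^* 1 = 0`, so it lies in the kernel, is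
  -- orthogonal to `u`, and satisfies `H_u² y' = 0`; hence `1 = H_u y' = 0`.
  obtain ⟨y, hy⟩ := exists_perturb_eq (isPositive_shiftedHankelSq u) hs hreg h1 h2
  rw [← hankelSq_eq_perturb hu, hankelSq_apply] at hy
  set y' := hankel u y
  have h3 : shiftedHankel u y' = 0 := by
    rw [shiftedHankel_eq_toeplitz, hy, toeplitz_neg_one_hardyOne]
  have h4 : y' ∈ eigen (shiftedHankelSq u) 0 := by
    rw [mem_eigen, shiftedHankelSq_apply, h3, map_zero]; simp
  have h5 : hankelSq u y' = 0 := by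
    have := mem_eigen.1 ((mem_eigen_hankelSq_iff hu (h1 y' h4)).2 h4)
    simpa using this
  have h6 : ⟪hankel u y', hankel u y'⟫ = 0 := by
    rw [← inner_hankelSq, h5, inner_zero_left]
  rw [hy] at h6
  exact hardyOne_ne_zero ((inner_self_eq_zero (𝕜 := ℂ) (E := hardy)).1 h6)

/-- If all the moments `(K_u²ⁿ u | 1)` vanish, every singular value of `H_u` is a singular value
of `K_u`. -/
theorem eigen_hankelSq_eq_bot_of_moments {u : C(Circ, ℂ)} (hu : toL2 u ∈ hardy)
    (hmom : ∀ n : ℕ, ⟪hardyOne, (shiftedHankelSq u ^ n) (⟨toL2 u, hu⟩ : hardy)⟫ = 0) {l : ℝ}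
    (hl : eigen (shiftedHankelSq u) l = ⊥) : eigen (hankelSq u) l = ⊥ := by
  rw [Submodule.eq_bot_iff]
  intro x hx
  have h0 : ∀ y ∈ eigen (hankelSq u) l, ⟪hardyOne, y⟫ = 0 := by
    intro y hy
    rw [hankelSq_eq_perturb hu] at hy
    exact inner_eigen_perturb_eq_zero (symm_shiftedHankelSq u) hmom hl hy
  -- Orthogonality of `H_u x` to `1` is orthogonality of `x` to `u`, which makes `x` an eigenvector
  -- of `K_u²`.
  have h1 := h0 _ (hankel_mem_eigen hx)
  rw [← conj_inner_hardy, inner_hankel_hardyOne hu, map_eq_zero] at h1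
  have h2 := (mem_eigen_hankelSq_iff hu h1).1 hx
  rw [hl] at h2
  exact h2

/-! ### The Sobolev embedding -/

theorem summable_inv_one_add_sq : Summable fun n : ℤ => (1 + (n : ℝ) ^ 2)⁻¹ := by
  refine Summable.of_norm_bounded_eventually
    (Real.summable_one_div_int_pow (p := 2) |>.2 (by norm_num)) ?_
  have h : ∀ᶠ n : ℤ in cofinite, n ≠ 0 := by
    simpa using (Set.finite_singleton (0 : ℤ)).eventually_cofinite_notMem
  filter_upwards [h] with n hn
  have h2 : (0 : ℝ) < (n : ℝ) ^ 2 := by positivity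
  rw [Real.norm_of_nonneg (by positivity), one_div]
  gcongr
  linarith

/-- The constant of the embedding of `H^s` into the absolutely convergent Fourier series. -/
def wienerConst : ℝ := ∑' n : ℤ, (1 + (n : ℝ) ^ 2)⁻¹

/-- Weighted arithmetic-geometric inequality. The free parameter `c` makes the first term small
before the `H^s` norm is used. -/
theorem norm_fourierCoeff_le {s : ℝ} (hs : 1 ≤ s) (f : L2) {c : ℝ} (hc : 0 < c) (n : ℤ) :
    ‖fourierCoeff f n‖ ≤ c * (1 + (n : ℝ) ^ 2)⁻¹ +
      c⁻¹ * ((1 + (n : ℝ) ^ 2) ^ s * ‖fourierCoeff f n‖ ^ 2) := by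
  set a := ‖fourierCoeff f n‖
  have ha : 0 ≤ a := norm_nonneg _
  set w : ℝ := 1 + (n : ℝ) ^ 2 with hw
  have hw1 : 1 ≤ w := by rw [hw]; nlinarith [sq_nonneg (n : ℝ)]
  have hws : w ≤ w ^ s := by
    simpa using Real.rpow_le_rpow_of_exponent_le hw1 hs
  have hw0 : 0 < w := by linarith
  have h1 : a ≤ c * w⁻¹ + c⁻¹ * (w * a ^ 2) := by
    have h2 : c * w⁻¹ + c⁻¹ * (w * a ^ 2) - a = ((c - w * a) ^ 2 + c * w * a) / (c * w) := by
      field_simp; ring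
    have h3 : 0 ≤ ((c - w * a) ^ 2 + c * w * a) / (c * w) := by positivity
    linarith
  refine h1.trans ?_
  gcongr

theorem summable_sobolev {s : ℝ} {f : L2} (hf : sobolevNormSq s f < ∞) :
    Summable fun n : ℤ => (1 + (n : ℝ) ^ 2) ^ s * ‖fourierCoeff f n‖ ^ 2 := by
  have h := ENNReal.summable_toReal hf.ne
  refine h.congr fun n => ?_
  exact ENNReal.toReal_ofReal (by positivity)

theorem tsum_sobolev {s : ℝ} (f : L2) :
    ∑' n : ℤ, (1 + (n : ℝ) ^ 2) ^ s * ‖fourierCoeff f n‖ ^ 2 = (sobolevNormSq s f).toReal := by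
  rw [sobolevNormSq, ENNReal.tsum_toReal_eq fun _ => ENNReal.ofReal_ne_top]
  exact tsum_congr fun n => (ENNReal.toReal_ofReal (by positivity)).symm

theorem summable_norm_fourierCoeff {s : ℝ} (hs : 1 ≤ s) {f : L2} (hf : sobolevNormSq s f < ∞) :
    Summable fun n : ℤ => ‖fourierCoeff f n‖ := by
  refine Summable.of_nonneg_of_le (fun _ => norm_nonneg _)
    (fun n => norm_fourierCoeff_le hs f one_pos n) ?_
  exact (summable_inv_one_add_sq.mul_left _).add ((summable_sobolev hf).mul_left _)

theorem tsum_norm_fourierCoeff_le {s : ℝ} (hs : 1 ≤ s) {f : L2} (hf : sobolevNormSq s f < ∞)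
    {c : ℝ} (hc : 0 < c) :
    ∑' n : ℤ, ‖fourierCoeff f n‖ ≤ c * wienerConst + c⁻¹ * (sobolevNormSq s f).toReal := by
  refine ((summable_norm_fourierCoeff hs hf).tsum_le_tsum (norm_fourierCoeff_le hs f hc)
    ((summable_inv_one_add_sq.mul_left _).add ((summable_sobolev hf).mul_left _))).trans ?_
  rw [(summable_inv_one_add_sq.mul_left _).tsum_add ((summable_sobolev hf).mul_left _),
    tsum_mul_left, tsum_mul_left, tsum_sobolev]
  rfl

theorem fourierCoeff_toL2 (f : C(Circ, ℂ)) (n : ℤ) :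
    fourierCoeff (toL2 f : L2) n = fourierCoeff f n :=
  fourierCoeff_toLp f n

theorem toL2_sub (f g : C(Circ, ℂ)) : toL2 (f - g) = toL2 f - toL2 g :=
  map_sub (ContinuousMap.toLp 2 μ ℂ) f g

theorem toL2_smul (c : ℂ) (f : C(Circ, ℂ)) : toL2 (c • f) = c • toL2 f :=
  map_smul (ContinuousMap.toLp 2 μ ℂ) c f

theorem exists_toL2_eq {s : ℝ} (hs : 1 ≤ s) {f : L2} (hf : sobolevNormSq s f < ∞) :
    ∃ g : C(Circ, ℂ), toL2 g = f := by
  have h1 : Summable fun n : ℤ => fourierCoeff f n • (fourier n : C(Circ, ℂ)) := by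
    refine Summable.of_norm ?_
    simpa only [norm_smul, fourier_norm, mul_one] using summable_norm_fourierCoeff hs hf
  refine ⟨∑' n : ℤ, fourierCoeff f n • (fourier n : C(Circ, ℂ)), ?_⟩
  have h2 := h1.hasSum.mapL (ContinuousMap.toLp 2 μ ℂ : C(Circ, ℂ) →L[ℂ] L2)
  refine h2.unique ?_
  simpa only [map_smul] using hasSum_fourier_series_L2 f

theorem norm_le_tsum_fourierCoeff {s : ℝ} (hs : 1 ≤ s) {f : C(Circ, ℂ)}
    (hf : sobolevNormSq s (toL2 f) < ∞) :
    ‖f‖ ≤ ∑' n : ℤ, ‖fourierCoeff (toL2 f : L2) n‖ := by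
  have h0 := summable_norm_fourierCoeff hs hf
  simp only [fourierCoeff_toL2] at h0 ⊢
  have h1 := hasSum_fourier_series_of_summable (f := f) (Summable.of_norm h0)
  rw [← h1.tsum_eq]
  have h2 : ∀ n : ℤ, ‖fourierCoeff f n • (fourier n : C(Circ, ℂ))‖ = ‖fourierCoeff f n‖ := by
    intro n
    rw [norm_smul, fourier_norm, mul_one]
  refine (norm_tsum_le_tsum_norm (by simpa only [h2] using h0)).trans ?_
  rw [h1.tsum_eq]
  simp only [h2]
  exact le_rfl

theorem tendsto_zero_of_sobolevNormSq {s : ℝ} (hs : 1 ≤ s) {ι : Type*} {l : Filter ι}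
    {r : ι → C(Circ, ℂ)} (h : Tendsto (fun i => sobolevNormSq s (toL2 (r i))) l (𝓝 0)) :
    Tendsto r l (𝓝 0) := by
  rw [Metric.tendsto_nhds]
  intro ε hε
  have hW : 0 ≤ wienerConst := tsum_nonneg fun n => by positivity
  set c : ℝ := ε / (2 * (wienerConst + 1)) with hc
  have hc0 : 0 < c := by positivity
  have h1 : c * wienerConst < ε / 2 := by
    have : c * (wienerConst + 1) = ε / 2 := by rw [hc]; field_simp
    nlinarith
  have h3 : ∀ᶠ i in l, sobolevNormSq s (toL2 (r i)) < ENNReal.ofReal (c * (ε / 2)) :=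
    h.eventually (gt_mem_nhds (by rw [ENNReal.ofReal_pos]; positivity))
  filter_upwards [h3] with i hi
  have hfin : sobolevNormSq s (toL2 (r i)) < ∞ := hi.trans ENNReal.ofReal_lt_top
  rw [dist_zero_right]
  refine (norm_le_tsum_fourierCoeff hs hfin).trans_lt
    ((tsum_norm_fourierCoeff_le hs hfin hc0).trans_lt ?_)
  have h4 : (sobolevNormSq s (toL2 (r i))).toReal < c * (ε / 2) :=
    (ENNReal.lt_ofReal_iff_toReal_lt hfin.ne).1 hi
  have h5 : c⁻¹ * (sobolevNormSq s (toL2 (r i))).toReal < ε / 2 := by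
    rw [inv_mul_lt_iff₀ hc0]
    exact h4
  linarith

/-- A solution is differentiable in the uniform norm. -/
theorem IsSolution.exists_hasDerivAt {s α : ℝ} (hs : 1 ≤ s) {u : ℝ → C(Circ, ℂ)}
    (hu : IsSolution s α u) (t : ℝ) :
    ∃ g : C(Circ, ℂ), toL2 g = vectorField α (u t) ∧ HasDerivAt u g t := by
  have h1 : ∀ᶠ h : ℝ in 𝓝[≠] 0, sobolevNormSq s
      (((h⁻¹ : ℝ) : ℂ) • (toL2 (u (t + h)) - toL2 (u t)) - vectorField α (u t)) < 1 :=
    (hu.deriv t).eventually (gt_mem_nhds one_pos)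
  -- A single difference quotient shows that the vector field has a continuous representative: it is
  -- that quotient minus a remainder of finite `H^s` norm.
  obtain ⟨h, hh⟩ := h1.exists
  obtain ⟨r, hr⟩ := exists_toL2_eq hs (hh.trans ENNReal.one_lt_top)
  have hg : toL2 (((h⁻¹ : ℝ) : ℂ) • (u (t + h) - u t) - r) = vectorField α (u t) := by
    rw [toL2_sub, toL2_smul, toL2_sub, hr, sub_sub_cancel]
  refine ⟨_, hg, ?_⟩
  set g := ((h⁻¹ : ℝ) : ℂ) • (u (t + h) - u t) - r
  rw [hasDerivAt_iff_tendsto_slope_zero]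
  have h2 : Tendsto (fun k : ℝ => ((k⁻¹ : ℝ) : ℂ) • (u (t + k) - u t) - g) (𝓝[≠] 0) (𝓝 0) := by
    refine tendsto_zero_of_sobolevNormSq hs ?_
    simpa only [toL2_sub, toL2_smul, hg] using hu.deriv t
  have h3 := h2.add_const g
  simp only [sub_add_cancel, zero_add] at h3
  refine h3.congr fun k => ?_
  ext x
  simp

theorem IsSolution.continuous {s α : ℝ} (hs : 1 ≤ s) {u : ℝ → C(Circ, ℂ)}
    (hu : IsSolution s α u) : Continuous u := by
  rw [continuous_iff_continuousAt]
  intro t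
  obtain ⟨g, -, hg⟩ := hu.exists_hasDerivAt hs t
  exact hg.continuousAt

/-- If the mean of a solution vanishes identically, it solves the cubic Szegő equation. -/
theorem IsSolution.cubic {s α : ℝ} {u : ℝ → C(Circ, ℂ)} (hu : IsSolution s α u)
    (h : ∀ t, ∫ x, u t x ∂μ = 0) : IsSolution s 0 u := by
  refine ⟨hu.mem, fun t => ?_⟩
  have h1 : vectorField 0 (u t) = vectorField α (u t) := by
    rw [vectorField, vectorField, h t, mul_zero, mul_zero]
  rw [h1]
  exact hu.deriv t

/-! ### The Lax flow of a solution -/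

/-- The projection of a continuous function on the Hardy space, as a map into that space. -/
def hardyOf : C(Circ, ℂ) →L[ℂ] hardy :=
  szego.comp (ContinuousMap.toLp 2 μ ℂ : C(Circ, ℂ) →L[ℂ] L2)

theorem hardyOf_apply (u : C(Circ, ℂ)) : hardyOf u = szego (toL2 u) := rfl

theorem hardyOf_of_mem {u : C(Circ, ℂ)} (hu : toL2 u ∈ hardy) : hardyOf u = ⟨toL2 u, hu⟩ :=
  Subtype.ext (szego_of_mem hu)

theorem hardyOf_one : hardyOf 1 = hardyOne := hardyOf_of_mem one_mem_hardy

theorem inner_hardyOne_hardyOf {u : C(Circ, ℂ)} (hu : toL2 u ∈ hardy) :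
    ⟪hardyOne, hardyOf u⟫ = ∫ x, u x ∂μ := by
  rw [hardyOf_of_mem hu]
  have h1 : ⟪hardyOne, (⟨toL2 u, hu⟩ : hardy)⟫ = ⟪toL2 1, toL2 u⟫ := rfl
  rw [h1, toL2_one, ← toL2_fourier, ← fourierCoeff_eq_inner, fourierCoeff_toL2, fourierCoeff]
  simp

theorem toeplitz_abs_sq_hardyOf {u : C(Circ, ℂ)} (hu : toL2 u ∈ hardy) :
    toeplitz (u * star u) (hardyOf u) = hardyOf (u * star u * u) := by
  rw [hardyOf_of_mem hu, toeplitz_apply, hardyOf_apply, mulL2_toL2]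

/-- `T_{|u|²} 1 = Π (u ū) = H_u u = H_u² 1`, which splits as `K_u²` plus the rank one term. -/
theorem toeplitz_abs_sq_hardyOne {u : C(Circ, ℂ)} (hu : toL2 u ∈ hardy) :
    toeplitz (u * star u) hardyOne =
      shiftedHankelSq u hardyOne + ⟪hardyOf u, hardyOne⟫ • hardyOf u := by
  have h1 : toeplitz (u * star u) hardyOne = hankelSq u hardyOne := by
    rw [hankelSq_apply, hankel_one hu, hankel_apply, toeplitz_apply]
    change szego (mulL2 (u * star u) (toL2 1)) = szego (mulL2 u (conjL2 (toL2 u)))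
    rw [mulL2_toL2, mul_one, conjL2_toL2, mulL2_toL2]
  rw [h1, hankelSq_eq hu, hardyOf_of_mem hu]

/-- From `Π (|u|² u) = T_{|u|²} u` and `-i T_{|u|²} = C_u - (i/2) K_u²`. -/
theorem hardyOf_vectorField {α : ℝ} {u g : C(Circ, ℂ)} (hu : toL2 u ∈ hardy)
    (hg : toL2 g = vectorField α u) :
    hardyOf g = laxOp u (hardyOf u) - (Complex.I / 2) • shiftedHankelSq u (hardyOf u) -
      (Complex.I * α * ⟪hardyOne, hardyOf u⟫) • hardyOne := by
  have h1 : hardyOf g =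
      -Complex.I • (hardyOf (u * star u * u) + ((α : ℂ) * ∫ x, u x ∂μ) • hardyOne) := by
    rw [← hardyOf_one, ← map_smul, ← map_add, ← map_smul]
    exact szego_toL2_of_vectorField hg
  rw [h1, inner_hardyOne_hardyOf hu, laxOp, add_apply, smul_apply, smul_apply,
    toeplitz_abs_sq_hardyOf hu]
  module

theorem laxOp_hardyOne {u : C(Circ, ℂ)} (hu : toL2 u ∈ hardy) :
    laxOp u hardyOne = -(Complex.I / 2) • shiftedHankelSq u hardyOne -
      (Complex.I * ⟪hardyOf u, hardyOne⟫) • hardyOf u := by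
  rw [laxOp, add_apply, smul_apply, smul_apply, toeplitz_abs_sq_hardyOne hu]
  module

theorem hasDerivAt_hardyOf {u : ℝ → C(Circ, ℂ)} {g : C(Circ, ℂ)} {t : ℝ} (h : HasDerivAt u g t) :
    HasDerivAt (fun t => hardyOf (u t)) (hardyOf g) t := by
  have h1 := (hardyOf.restrictScalars ℝ).hasFDerivAt.comp_hasDerivAt t h
  exact h1

theorem IsSolution.laxFlow {s α : ℝ} (hs : 1 ≤ s) {u : ℝ → C(Circ, ℂ)} (hu : IsSolution s α u) :
    LaxFlow α (fun t => shiftedHankelSq (u t)) (fun t => laxOp (u t)) (fun t => hardyOf (u t))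
      hardyOne where
  continuous := continuous_laxOp (hu.continuous hs)
  skew t := star_laxOp (u t)
  selfAdjoint t := isSelfAdjoint_shiftedHankelSq (u t)
  hasDerivAt_A t := by
    obtain ⟨g, hg, hd⟩ := hu.exists_hasDerivAt hs t
    have h1 := hasDerivAt_antiSq shiftedHankelL hd
    exact h1.congr_deriv (shiftedHankel_comp_vectorField (hu.mem t).1 hg)
  hasDerivAt_x t := by
    obtain ⟨g, hg, hd⟩ := hu.exists_hasDerivAt hs t
    exact (hasDerivAt_hardyOf hd).congr_deriv (hardyOf_vectorField (hu.mem t).1 hg)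
  apply_e t := laxOp_hardyOne (hu.mem t).1
  norm_e := norm_hardyOne

section

section SpectralTrichotomy

variable {E : Type*} [NormedAddCommGroup E] [InnerProductSpace ℂ E] {α : ℝ} {A : E →L[ℂ] E}
  {v w : ℝ → E}

/-! ### Components of the flow along eigenvectors -/

/-- Differentiating `⟪x, v⟫ ≡ 0` along an eigenvector leaves only `α ⟪w, v⟫ ⟪x, w⟫ = 0`. Here `α ≠
0` is essential. -/
theorem ModeFlow.inner_eq_zero_of_orthogonal (h : ModeFlow α A v w) (hα : α ≠ 0) {l : ℝ}
    (hv : ∀ t, ∀ x ∈ eigen A l, ⟪v t, x⟫ = 0) {t : ℝ} {x : E} (hx : x ∈ eigen A l)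
    (hw : ⟪w t, x⟫ ≠ 0) : ⟪w t, v t⟫ = 0 := by
  have hv' : ∀ t, ⟪x, v t⟫ = 0 := fun t => by
    rw [← inner_conj_symm, hv t x hx, map_zero]
  have h1 := (hasDerivAt_const t x).inner ℂ (h.hasDerivAt_v t)
  have h2 : (fun t => ⟪x, v t⟫) = fun _ => 0 := funext hv'
  have h3 : HasDerivAt (fun t => ⟪x, v t⟫) (0 : ℂ) t := by
    rw [h2]
    exact hasDerivAt_const t 0
  have h4 := h1.unique h3
  rw [inner_zero_left, add_zero, inner_sub_right, inner_smul_right, inner_smul_right, ← h.symm,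
    mem_eigen.1 hx, inner_smul_left, hv' t] at h4
  have h5 : ⟪x, w t⟫ ≠ 0 := by
    intro h0
    apply hw
    rw [← inner_conj_symm, h0, map_zero]
  have h6 : (α : ℂ) ≠ 0 := by exact_mod_cast hα
  simpa [h5, h6] using h4

/-- Without the mean term, the component along an eigenvector only turns by the phase `exp (-i l t /
2)`. -/
theorem ModeFlow.inner_eigen_ne_zero (h : ModeFlow α A v w) (hq : ∀ t, ⟪w t, v t⟫ = 0) {l : ℝ}
    {x : E} (hx : x ∈ eigen A l) {t₀ : ℝ} (ht₀ : ⟪x, v t₀⟫ ≠ 0) (t : ℝ) : ⟪x, v t⟫ ≠ 0 := by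
  have h1 : ∀ t, HasDerivAt (fun t => ⟪x, v t⟫) (-(Complex.I / 2) * l * ⟪x, v t⟫) t := by
    intro t
    refine ((hasDerivAt_const t x).inner ℂ (h.hasDerivAt_v t)).congr_deriv ?_
    rw [hq t, mul_zero, zero_smul, sub_zero, inner_zero_left, add_zero, inner_smul_right,
      ← h.symm, mem_eigen.1 hx, inner_smul_left, Complex.conj_ofReal]
    ring
  have h2 : ∀ t : ℝ, HasDerivAt (fun t : ℝ => Complex.exp ((Complex.I / 2) * l * t))
      (Complex.exp ((Complex.I / 2) * l * t) * ((Complex.I / 2) * l)) t := by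
    intro t
    have h3 : HasDerivAt (fun t : ℝ => (Complex.I / 2) * l * (t : ℂ)) ((Complex.I / 2) * l) t := by
      simpa using (Complex.ofRealCLM.hasDerivAt (x := t)).const_mul ((Complex.I / 2) * (l : ℂ))
    exact h3.cexp
  have h4 : ∀ t, HasDerivAt
      (fun t : ℝ => Complex.exp ((Complex.I / 2) * l * t) * ⟪x, v t⟫) 0 t := by
    intro t
    refine ((h2 t).mul (h1 t)).congr_deriv ?_
    ring
  have h5 := is_const_of_deriv_eq_zero (fun t => (h4 t).differentiableAt)
    (fun t => (h4 t).deriv) t t₀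
  intro h0
  simp only [h0, mul_zero] at h5
  exact mul_ne_zero (Complex.exp_ne_zero _) ht₀ h5.symm

theorem ModeFlow.codiscrete_inner_ne [CompleteSpace E] (h : ModeFlow α A v w) {x : E} {t₀ : ℝ}
    (ht₀ : ⟪x, v t₀⟫ ≠ 0) : {t | ⟪x, v t⟫ ≠ 0} ∈ codiscrete ℝ := by
  have h1 : AnalyticOnNhd ℝ (fun t => ⟪x, v t⟫) Set.univ := fun t _ =>
    ((innerSL ℂ x).restrictScalars ℝ).analyticAt _ |>.comp (h.analyticAt_v t)
  rcases h1.eqOn_zero_or_eventually_ne_zero_of_preconnected isPreconnected_univ with h2 | h2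
  · exact absurd (h2 (Set.mem_univ t₀)) ht₀
  · exact h2

/-! ### Roots of the secular equation -/

theorem exists_eigen_add {a : ℝ} {x y : E} (hx : x ∈ eigen A a) (hxy : ⟪x, y⟫ ≠ 0) :
    ∃ p ∈ eigen A a, ∃ r, p ≠ 0 ∧ ⟪p, r⟫ = 0 ∧ y = p + r := by
  have hx0 : x ≠ 0 := by
    rintro rfl
    exact hxy (inner_zero_left _)
  have hxx : ⟪x, x⟫ ≠ 0 := inner_self_ne_zero.2 hx0
  refine ⟨(⟪x, y⟫ / ⟪x, x⟫) • x, Submodule.smul_mem _ _ hx, y - (⟪x, y⟫ / ⟪x, x⟫) • x,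
    smul_ne_zero (div_ne_zero hxy hxx) hx0, ?_, by abel⟩
  rw [inner_smul_left, inner_sub_right, inner_smul_right, div_mul_cancel₀ _ hxx, sub_self, mul_zero]

variable [CompleteSpace E]

theorem exists_secular_neg_of_inner_ne {a b : ℝ} (hab : a < b)
    (hreg : ∀ l ∈ Set.Ioo a b, Regular A l) (hA : ∀ x y, ⟪A x, y⟫ = ⟪x, A y⟫) {x y : E}
    (hx : x ∈ eigen A a) (hxy : ⟪x, y⟫ ≠ 0) : ∃ l ∈ Set.Ioo a b, secular A y l < 0 := by
  obtain ⟨p, hp, r, hp0, hpr, rfl⟩ := exists_eigen_add hx hxy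
  exact exists_secular_neg hab hreg hA hp hp0 hpr

theorem exists_secular_pos_of_inner_ne {a b : ℝ} (hab : a < b)
    (hreg : ∀ l ∈ Set.Ioo a b, Regular A l) (hA : ∀ x y, ⟪A x, y⟫ = ⟪x, A y⟫) {x y : E}
    (hx : x ∈ eigen A b) (hxy : ⟪x, y⟫ ≠ 0) : ∃ l ∈ Set.Ioo a b, 0 < secular A y l := by
  obtain ⟨p, hp, r, hp0, hpr, rfl⟩ := exists_eigen_add hx hxy
  exact exists_secular_pos hab hreg hA hp hp0 hpr

/-- Strict monotonicity and a sign change give exactly one root. It is simple in `ρ`, because the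
derivative `2 ρ ‖R v‖²` is positive. -/
theorem exists_analytic_secular_root (hA : ∀ x y, ⟪A x, y⟫ = ⟪x, A y⟫) {T J : Set ℝ}
    (hT : IsOpen T) (hJ : IsOpen J) (hJc : Convex ℝ J) (hJ0 : J ⊆ Set.Ioi 0)
    (hreg : ∀ l ∈ J, Regular A l) (hv : ∀ t, AnalyticAt ℝ v t) (hv0 : ∀ t ∈ T, v t ≠ 0)
    (hneg : ∀ t ∈ T, ∃ l ∈ J, secular A (v t) l < 0)
    (hpos : ∀ t ∈ T, ∃ l ∈ J, 0 < secular A (v t) l) :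
    ∃ r : ℝ → ℝ, AnalyticOnNhd ℝ r T ∧ ∀ t ∈ T, 0 < r t ∧ r t ^ 2 ∈ J ∧
      secular A (v t) (r t ^ 2) = 0 ∧ ∀ l ∈ J, secular A (v t) l = 0 → l = r t ^ 2 := by
  have hinj : ∀ t ∈ T, Set.InjOn (secular A (v t)) J := fun t ht =>
    (strictMonoOn_secular hJc hreg hA (hv0 t ht)).injOn
  obtain ⟨r, hr, hr'⟩ := exists_analytic_root (g := fun p => secular A (v p.1) (p.2 ^ 2))
    (g' := fun t ρ => ‖resolv A (ρ ^ 2) (v t)‖ ^ 2 * (2 * ρ)) (T := T)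
    (I := {ρ | 0 < ρ ∧ ρ ^ 2 ∈ J}) hT
    ((isOpen_lt continuous_const continuous_id).inter (hJ.preimage (continuous_pow 2)))
    (fun t _ ρ hρ => contDiffAt_secular (hv t) (hreg _ hρ.2))
    (fun t _ ρ hρ => by
      have h1 : HasDerivAt (fun r : ℝ => r ^ 2) (2 * ρ) ρ := by simpa using hasDerivAt_pow 2 ρ
      exact (hasDerivAt_secular (hreg _ hρ.2) hA (v t)).comp (h := fun r : ℝ => r ^ 2) ρ h1)
    (fun t ht ρ hρ => by
      have h1 := norm_pos_iff.2 ((hreg _ hρ.2).resolv_ne_zero (hv0 t ht))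
      have h2 := hρ.1
      positivity)
    (fun t ht => by
      obtain ⟨l₁, hl₁, h1⟩ := hneg t ht
      obtain ⟨l₂, hl₂, h2⟩ := hpos t ht
      have hc : ContinuousOn (secular A (v t)) J := fun l hl =>
        (hasDerivAt_secular (hreg l hl) hA (v t)).continuousAt.continuousWithinAt
      obtain ⟨l, hl, h3⟩ := hJc.isPreconnected.intermediate_value hl₁ hl₂ hc ⟨h1.le, h2.le⟩
      have hl0 : (0 : ℝ) < l := hJ0 hl
      refine ⟨√l, ⟨Real.sqrt_pos.2 hl0, ?_⟩, ?_⟩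
      · rwa [Real.sq_sqrt hl0.le]
      · simpa only [Real.sq_sqrt hl0.le] using h3)
    (fun t ht ρ hρ ρ' hρ' h1 h2 =>
      (pow_left_inj₀ hρ.1.le hρ'.1.le two_ne_zero).1 (hinj t ht hρ.2 hρ'.2 (h1.trans h2.symm)))
  refine ⟨r, hr, fun t ht => ?_⟩
  obtain ⟨⟨h1, h2⟩, h3⟩ := hr' t ht
  exact ⟨h1, h2, h3, fun l hl h4 => hinj t ht hl h2 (h4.trans h3.symm)⟩

/-! ### The trichotomy -/

/-- The spectral properties shared by the triples `(K_u², u, 1)`. -/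
structure HankelTriple (A : E →L[ℂ] E) (x e : E) : Prop where
  not_orthogonal : ∀ l : ℝ, 0 < l → eigen A l ≠ ⊥ → (∀ y ∈ eigen A l, ⟪x, y⟫ = 0) →
    ∃ y ∈ eigen A l, ⟪e, y⟫ ≠ 0
  not_orthogonal_ker : ∀ s : ℝ, 0 < s → (∀ l ∈ Set.Ioo 0 s, Regular A l) →
    (∀ y ∈ eigen A 0, ⟪x, y⟫ = 0) → ∃ y ∈ eigen A 0, ⟪e, y⟫ ≠ 0
  exists_eigen_perturb : ∀ l : ℝ, l ≠ 0 → eigen A l ≠ ⊥ → (∀ y ∈ eigen A l, ⟪x, y⟫ = 0) →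
    ∃ y ∈ eigen (perturb A x) l, ⟪x, y⟫ ≠ 0
  eigen_perturb_eq_bot : (∀ n : ℕ, ⟪e, (A ^ n) x⟫ = 0) → ∀ l : ℝ,
    eigen A l = ⊥ → eigen (perturb A x) l = ⊥

/-- Here `a`, `S`, `J` stand for `σ_-²`, `σ²` and `(σ_-, σ_+)` squared above `σ²`. The cases are
decided by whether `v` ever meets the eigenspace of `S` and whether `⟪w, v⟫ ≡ 0`. -/
theorem ModeFlow.spectral_trichotomy (h : ModeFlow α A v w)
    (hT : ∀ t, HankelTriple A (v t) (w t)) (hα : α ≠ 0) {a S : ℝ} {J : Set ℝ}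
    {m : ℕ} (ha : 0 ≤ a) (haS : a < S) (hm : Module.rank ℂ (eigen A S) = m) (hm1 : 1 ≤ m)
    (hregL : ∀ l ∈ Set.Ioo a S, Regular A l) (haE : 0 < a → eigen A a ≠ ⊥)
    (hregJ : ∀ l ∈ J, Regular A l)
    (hJ : J = Set.Ioi S ∨ ∃ b, S < b ∧ eigen A b ≠ ⊥ ∧ J = Set.Ioo S b) :
    ((∀ t, Module.rank ℂ (eigen (perturb A (v t)) S) = ((m + 1 : ℕ) : Cardinal)) ∧
      ∀ t, ⟪w t, v t⟫ = 0) ∨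
    (∃ (Tc : Set ℝ) (ρ₁ ρ₂ : ℝ → ℝ), IsClosed Tc ∧ IsDiscrete Tc ∧
      AnalyticOnNhd ℝ ρ₁ Tcᶜ ∧ AnalyticOnNhd ℝ ρ₂ Tcᶜ ∧ ∀ t ∉ Tc,
        (0 < ρ₁ t ∧ ρ₁ t ^ 2 ∈ J) ∧ (0 < ρ₂ t ∧ ρ₂ t ^ 2 ∈ Set.Ioo a S) ∧
        (∀ l ∈ Set.Ioo a S ∪ J, eigen (perturb A (v t)) l ≠ ⊥ → l = ρ₁ t ^ 2 ∨ l = ρ₂ t ^ 2) ∧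
        Module.rank ℂ (eigen (perturb A (v t)) (ρ₁ t ^ 2)) = 1 ∧
        Module.rank ℂ (eigen (perturb A (v t)) (ρ₂ t ^ 2)) = 1 ∧
        Module.rank ℂ (eigen (perturb A (v t)) S) = ((m - 1 : ℕ) : Cardinal)) ∨
    ((∀ t, ⟪w t, v t⟫ = 0) ∧ ∀ t,
      Module.rank ℂ (eigen (perturb A (v t)) S) = ((m - 1 : ℕ) : Cardinal) ∧
      ∀ l ∈ Set.Ioo a S ∪ J, eigen (perturb A (v t)) l = ⊥) := by
  have hS : 0 < S := ha.trans_lt haS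
  have hSne : eigen A S ≠ ⊥ := by
    intro h0
    rw [h0, rank_bot] at hm
    have : m = 0 := by exact_mod_cast hm.symm
    omega
  have hreg : ∀ l ∈ Set.Ioo a S ∪ J, Regular A l := fun l hl => hl.elim (hregL l) (hregJ l)
  have hconj : ∀ x y : E, ⟪x, y⟫ ≠ 0 → ⟪y, x⟫ ≠ 0 := fun x y h1 h2 =>
    h1 (by rw [← inner_conj_symm, h2, map_zero])
  by_cases h1 : ∀ t, ∀ x ∈ eigen A S, ⟪v t, x⟫ = 0
  · refine Or.inl ⟨fun t => ?_, fun t => ?_⟩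
    · obtain ⟨x, hx, hvx⟩ := (hT t).exists_eigen_perturb S hS.ne' hSne (h1 t)
      exact rank_eigen_perturb_of_orthogonal (h1 t) hx hvx hm
    · obtain ⟨x, hx, hwx⟩ := (hT t).not_orthogonal S hS hSne (h1 t)
      exact h.inner_eq_zero_of_orthogonal hα h1 hx hwx
  push Not at h1
  obtain ⟨t₁, x₁, hx₁, hvx₁⟩ := h1
  right
  by_cases hq : ∀ t, ⟪w t, v t⟫ = 0
  · refine Or.inr ⟨hq, fun t => ⟨?_, fun l hl => ?_⟩⟩
    · exact rank_eigen_perturb_of_inner_ne h.symm hx₁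
        (h.inner_eigen_ne_zero hq hx₁ (hconj _ _ hvx₁) t) hm
    · exact (hT t).eigen_perturb_eq_bot (fun n => h.inner_pow_eq_zero hq n t) l
        (hreg l hl).eigen_eq_bot
  left
  -- As the mean is not identically zero, no eigenspace to which the Hankel structure applies can
  -- stay orthogonal to `v` for all times.
  have hdet : ∀ l, (∀ t, (∀ x ∈ eigen A l, ⟪v t, x⟫ = 0) → ∃ x ∈ eigen A l, ⟪w t, x⟫ ≠ 0) →
      ∃ x ∈ eigen A l, ∃ t, ⟪x, v t⟫ ≠ 0 := by
    intro l hl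
    by_contra! hcon
    have h2 : ∀ t, ∀ x ∈ eigen A l, ⟪v t, x⟫ = 0 := fun t x hx => by
      rw [← inner_conj_symm, hcon x hx t, map_zero]
    refine hq fun t => ?_
    obtain ⟨x, hx, hwx⟩ := hl t (h2 t)
    exact h.inner_eq_zero_of_orthogonal hα h2 hx hwx
  -- For `a = 0` the kernel of `A` takes the place of the lower eigenspace.
  obtain ⟨x₂, hx₂, t₂, hvx₂⟩ := hdet a fun t h2 => by
    rcases ha.eq_or_lt with h3 | h3
    · subst h3
      exact (hT t).not_orthogonal_ker S hS hregL h2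
    · exact (hT t).not_orthogonal a h3 (haE h3) h2
  -- When `J` is unbounded no time has to be excluded: positivity holds for large `l`.
  obtain ⟨D, hD, hDpos⟩ : ∃ D ∈ codiscrete ℝ, ∀ t ∈ D, v t ≠ 0 →
      ∃ l ∈ J, 0 < secular A (v t) l := by
    rcases hJ with rfl | ⟨b, hb, hbne, rfl⟩
    · refine ⟨Set.univ, univ_mem, fun t _ _ => ?_⟩
      have hl : S < max S (‖A‖ + ‖v t‖ ^ 2) + 1 := by
        linarith [le_max_left S (‖A‖ + ‖v t‖ ^ 2)]
      exact ⟨_, hl, secular_pos_of_large (hregJ _ hl)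
        (by linarith [le_max_right S (‖A‖ + ‖v t‖ ^ 2)])⟩
    · obtain ⟨x, hx, t, hvx⟩ := hdet b fun t h2 => (hT t).not_orthogonal b (hS.trans hb) hbne h2
      exact ⟨_, h.codiscrete_inner_ne hvx, fun t ht _ =>
        exists_secular_pos_of_inner_ne hb hregJ h.symm hx ht⟩
  have hTc : {t | ⟪x₁, v t⟫ ≠ 0} ∩ {t | ⟪x₂, v t⟫ ≠ 0} ∩ D ∈ codiscrete ℝ :=
    inter_mem (inter_mem (h.codiscrete_inner_ne (hconj _ _ hvx₁)) (h.codiscrete_inner_ne hvx₂)) hD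
  set T := {t | ⟪x₁, v t⟫ ≠ 0} ∩ {t | ⟪x₂, v t⟫ ≠ 0} ∩ D with hTdef
  obtain ⟨hTo, hTd⟩ := mem_codiscrete'.1 hTc
  have hv0 : ∀ t ∈ T, v t ≠ 0 := fun t ht h0 => ht.1.1 (by rw [h0, inner_zero_right])
  have hJo : IsOpen J := by
    rcases hJ with rfl | ⟨b, -, -, rfl⟩
    exacts [isOpen_Ioi, isOpen_Ioo]
  have hJc : Convex ℝ J := by
    rcases hJ with rfl | ⟨b, -, -, rfl⟩
    exacts [convex_Ioi S, convex_Ioo S b]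
  have hJS : J ⊆ Set.Ioi S := by
    rcases hJ with rfl | ⟨b, -, -, rfl⟩
    exacts [subset_rfl, Set.Ioo_subset_Ioi_self]
  obtain ⟨ρ₁, hρ₁, hρ₁'⟩ := exists_analytic_secular_root h.symm hTo hJo hJc
    (hJS.trans (Set.Ioi_subset_Ioi hS.le)) hregJ h.analyticAt_v hv0
    (fun t ht => by
      rcases hJ with rfl | ⟨b, hb, -, rfl⟩
      · obtain ⟨l, hl, h2⟩ := exists_secular_neg_of_inner_ne (b := S + 1) (by linarith)
          (fun l hl => hregJ l hl.1) h.symm hx₁ ht.1.1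
        exact ⟨l, hl.1, h2⟩
      · exact exists_secular_neg_of_inner_ne hb hregJ h.symm hx₁ ht.1.1)
    (fun t ht => hDpos t ht.2 (hv0 t ht))
  obtain ⟨ρ₂, hρ₂, hρ₂'⟩ := exists_analytic_secular_root h.symm hTo isOpen_Ioo (convex_Ioo a S)
    (fun l hl => ha.trans_lt hl.1) hregL h.analyticAt_v hv0
    (fun t ht => exists_secular_neg_of_inner_ne haS hregL h.symm hx₂ ht.1.2)
    (fun t ht => exists_secular_pos_of_inner_ne haS hregL h.symm hx₁ ht.1.1)
  refine ⟨Tᶜ, ρ₁, ρ₂, hTo.isClosed_compl, hTd, by rwa [compl_compl], by rwa [compl_compl],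
    fun t ht => ?_⟩
  rw [Set.notMem_compl_iff] at ht
  obtain ⟨h1, h2, h3, h4⟩ := hρ₁' t ht
  obtain ⟨h1', h2', h3', h4'⟩ := hρ₂' t ht
  refine ⟨⟨h1, h2⟩, ⟨h1', h2'⟩, fun l hl hne => ?_, (hregJ _ h2).rank_eigen_perturb h.symm h3,
    (hregL _ h2').rank_eigen_perturb h.symm h3',
    rank_eigen_perturb_of_inner_ne h.symm hx₁ ht.1.1 hm⟩
  have h5 : secular A (v t) l = 0 := by
    by_contra h6
    exact hne ((hreg l hl).eigen_perturb_eq_bot h.symm h6)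
  rcases hl with hl | hl
  · exact Or.inr (h4' l hl h5)
  · exact Or.inl (h4 l hl h5)

end SpectralTrichotomy

/-! ### Unitary equivalence -/

section UnitaryEquivalence

variable {E : Type*} [NormedAddCommGroup E] [InnerProductSpace ℂ E] {A B U V : E →L[ℂ] E}

theorem eigen_eq_map (hVU : V * U = 1) (hUV : U * V = 1) (hV : V * A = B * V) (l : ℝ) :
    eigen B l = (eigen A l).map (V : E →ₗ[ℂ] E) := by
  have hU : U * B = A * U := by
    calc U * B = U * B * (V * U) := by rw [hVU, mul_one]
      _ = U * (B * V) * U := by simp only [mul_assoc]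
      _ = U * V * A * U := by rw [← hV]; simp only [mul_assoc]
      _ = A * U := by rw [hUV, one_mul]
  have hU' : ∀ y, U (B y) = A (U y) := fun y => congrArg (fun T : E →L[ℂ] E => T y) hU
  have hV' : ∀ y, V (A y) = B (V y) := fun y => congrArg (fun T : E →L[ℂ] E => T y) hV
  have hVU' : ∀ y, V (U y) = y := fun y => congrArg (fun T : E →L[ℂ] E => T y) hVU
  ext y
  rw [Submodule.mem_map]
  constructor
  · intro hy
    refine ⟨U y, ?_, hVU' y⟩
    rw [mem_eigen, ← hU', mem_eigen.1 hy, map_smul]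
  · rintro ⟨x, hx, rfl⟩
    rw [mem_eigen]
    change B (V x) = (l : ℂ) • V x
    rw [← hV', mem_eigen.1 hx, map_smul]

theorem rank_eigen_eq (hVU : V * U = 1) (hUV : U * V = 1) (hV : V * A = B * V) (l : ℝ) :
    Module.rank ℂ (eigen B l) = Module.rank ℂ (eigen A l) := by
  have hinj : Function.Injective (V : E →ₗ[ℂ] E) := fun x y hxy => by
    have h1 : ∀ y, U (V y) = y := fun y => congrArg (fun T : E →L[ℂ] E => T y) hUV
    rw [← h1 x, ← h1 y]
    exact congrArg U hxy
  rw [eigen_eq_map hVU hUV hV]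
  exact (Submodule.equivMapOfInjective _ hinj _).rank_eq.symm

theorem regular_conj (hVU : V * U = 1) (hUV : U * V = 1) (hV : V * A = B * V) {l : ℝ}
    (h : Regular B l) : Regular A l := by
  have hVu : IsUnit V := ⟨⟨V, U, hVU, hUV⟩, rfl⟩
  have hUu : IsUnit U := ⟨⟨U, V, hUV, hVU⟩, rfl⟩
  have h1 : A - (l : ℂ) • (1 : E →L[ℂ] E) = U * (B - (l : ℂ) • (1 : E →L[ℂ] E)) * V := by
    rw [mul_sub, sub_mul, mul_assoc U B, ← hV, ← mul_assoc, hUV, one_mul, mul_smul_comm, mul_one,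
      smul_mul_assoc, hUV]
  rw [Regular, h1]
  exact (hUu.mul h).mul hVu

theorem perturb_conj (hV : V * A = B * V) (hin : ∀ x y, ⟪V x, V y⟫ = ⟪x, y⟫) (x : E) :
    V * perturb A x = perturb B (V x) * V := by
  ext1 y
  have hV' : V (A y) = B (V y) := congrArg (fun T : E →L[ℂ] E => T y) hV
  change V (perturb A x y) = perturb B (V x) (V y)
  rw [perturb_apply, perturb_apply, map_add, map_smul, hV', hin]

theorem HankelTriple.conj (hVU : V * U = 1) (hUV : U * V = 1) (hV : V * A = B * V)
    (hin : ∀ x y, ⟪V x, V y⟫ = ⟪x, y⟫) {x e : E} (h : HankelTriple A x e) :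
    HankelTriple B (V x) (V e) := by
  have hE := eigen_eq_map hVU hUV hV
  have hP := eigen_eq_map hVU hUV (perturb_conj hV hin x)
  have hmem : ∀ {G : Submodule ℂ E} {y}, y ∈ G → V y ∈ G.map (V : E →ₗ[ℂ] E) := fun hy =>
    Submodule.mem_map_of_mem hy
  have horth : ∀ l, (∀ y ∈ eigen B l, ⟪V x, y⟫ = 0) → ∀ y ∈ eigen A l, ⟪x, y⟫ = 0 := by
    intro l hl y hy
    rw [← hin]
    exact hl _ (hE l ▸ hmem hy)
  have hbot : ∀ l, eigen B l = ⊥ ↔ eigen A l = ⊥ := fun l => by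
    rw [← Submodule.rank_eq_zero, rank_eigen_eq hVU hUV hV, Submodule.rank_eq_zero]
  refine ⟨fun l hl hne hx => ?_, fun s hs hreg hx => ?_, fun l hl hne hx => ?_, fun hmom l hl => ?_⟩
  · obtain ⟨y, hy, hey⟩ := h.not_orthogonal l hl (mt (hbot l).2 hne) (horth l hx)
    exact ⟨V y, hE l ▸ hmem hy, by rwa [hin]⟩
  · obtain ⟨y, hy, hey⟩ := h.not_orthogonal_ker s hs
      (fun l hl => regular_conj hVU hUV hV (hreg l hl)) (horth 0 hx)
    exact ⟨V y, hE 0 ▸ hmem hy, by rwa [hin]⟩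
  · obtain ⟨y, hy, hey⟩ := h.exists_eigen_perturb l hl (mt (hbot l).2 hne) (horth l hx)
    exact ⟨V y, hP l ▸ hmem hy, by rwa [hin]⟩
  · have hpow : ∀ n : ℕ, V * A ^ n = B ^ n * V := fun n => (SemiconjBy.pow_right hV n : _)
    rw [hP, h.eigen_perturb_eq_bot (fun n => ?_) l ((hbot l).1 hl), Submodule.map_bot]
    rw [← hin, ← hmom n]
    exact congrArg (fun z => ⟪V e, z⟫) (congrArg (fun T : E →L[ℂ] E => T x) (hpow n))

theorem LaxFlow.exists_modeFlow [CompleteSpace E] {α : ℝ} {A C : ℝ → E →L[ℂ] E} {x : ℝ → E} {e : E}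
    (h : LaxFlow α A C x e) (hT : ∀ t, HankelTriple (A t) (x t) e) :
    ∃ v w : ℝ → E, ModeFlow α (A 0) v w ∧ (∀ t, HankelTriple (A 0) (v t) (w t)) ∧
      (∀ t, ⟪w t, v t⟫ = ⟪e, x t⟫) ∧ ∀ t l, Module.rank ℂ (eigen (perturb (A 0) (v t)) l) =
        Module.rank ℂ (eigen (perturb (A t) (x t)) l) := by
  obtain ⟨U, hVU, hUV, hV, -, hm⟩ := h.exists_frame
  have hin : ∀ t y z, ⟪star (U t) y, star (U t) z⟫ = ⟪y, z⟫ := by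
    intro t y z
    rw [ContinuousLinearMap.star_eq_adjoint, ContinuousLinearMap.adjoint_inner_left]
    exact congrArg (fun z => ⟪y, z⟫) (congrArg (fun T : E →L[ℂ] E => T z) (hUV t))
  exact ⟨_, _, hm, fun t => (hT t).conj (hVU t) (hUV t) (hV t) (hin t), fun t => hin t _ _,
    fun t l => rank_eigen_eq (hVU t) (hUV t) (perturb_conj (hV t) (hin t) (x t)) l⟩

end UnitaryEquivalence

end

section

/-! ### Isolated eigenvalues of compact operators -/

section Isolated

variable {E : Type*} [NormedAddCommGroup E] [InnerProductSpace ℂ E]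
  {A : E →L[ℂ] E}

theorem inner_eigen_eq_zero (hA : ∀ x y, ⟪A x, y⟫ = ⟪x, A y⟫) {l k : ℝ} (hlk : l ≠ k) {x y : E}
    (hx : x ∈ eigen A l) (hy : y ∈ eigen A k) : ⟪x, y⟫ = 0 := by
  have h1 := hA x y
  rw [mem_eigen.1 hx, mem_eigen.1 hy, inner_smul_left, inner_smul_right, Complex.conj_ofReal] at h1
  have h2 : ((l : ℂ) - k) * ⟪x, y⟫ = 0 := by linear_combination h1
  exact (mul_eq_zero.1 h2).resolve_left (sub_ne_zero.2 (by exact_mod_cast hlk))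

/-- With `P` the projection on the eigenspace at `S`, `A (1 - P)` is invertible after subtraction of
`l` near `S`. Eigenvectors of `A` for `l ≠ S` are killed by `P`, so they would be eigenvectors of `A
(1 - P)`. -/
theorem eventually_regular [CompleteSpace E] (hA : ∀ x y, ⟪A x, y⟫ = ⟪x, A y⟫) (hc : IsCompactOperator A) {S : ℝ}
    (hS : S ≠ 0) : ∀ᶠ l in 𝓝[≠] S, Regular A l := by
  have : CompleteSpace (eigen A S) := (isClosed_eigen A S).completeSpace_coe
  set P : E →L[ℂ] E := (eigen A S).starProjection
  set B : E →L[ℂ] E := A.comp (1 - P) with hB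
  have hBapp : ∀ x, B x = A (x - P x) := fun x => by simp [hB]
  have hBc : IsCompactOperator B := hc.comp_clm (1 - P)
  have hP : ∀ x, ∀ y ∈ eigen A S, ⟪y, x - P x⟫ = 0 := fun x y hy =>
    Submodule.inner_right_of_mem_orthogonal hy ((eigen A S).sub_starProjection_mem_orthogonal x)
  have hbot : eigen B S = ⊥ := by
    rw [Submodule.eq_bot_iff]
    intro x hx
    rw [mem_eigen, hBapp] at hx
    have hPx : P x ∈ eigen A S := (eigen A S).starProjection_apply_mem x
    have h1 : ⟪P x, A (x - P x)⟫ = 0 := by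
      rw [← hA, mem_eigen.1 hPx, inner_smul_left, hP x _ hPx, mul_zero]
    have h2 : ⟪P x, x⟫ = ⟪P x, P x⟫ := by
      have := hP x _ hPx
      rwa [inner_sub_right, sub_eq_zero] at this
    rw [hx, inner_smul_right, h2] at h1
    have h3 : P x = 0 := inner_self_eq_zero.1
      ((mul_eq_zero.1 h1).resolve_left (by exact_mod_cast hS))
    rw [h3, sub_zero] at hx
    have h4 := hP x x (mem_eigen.2 hx)
    rwa [h3, sub_zero, inner_self_eq_zero] at h4
  have h1 : ∀ᶠ l in 𝓝 S, Regular B l :=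
    (isOpen_regular B).mem_nhds (regular_of_eigen_eq_bot hBc hS hbot)
  have h2 : ∀ᶠ l in 𝓝 S, l ≠ 0 := isOpen_ne.mem_nhds hS
  filter_upwards [h1.filter_mono nhdsWithin_le_nhds, h2.filter_mono nhdsWithin_le_nhds,
    self_mem_nhdsWithin] with l hl hl0 hlS
  refine regular_of_eigen_eq_bot hc hl0 ?_
  rw [Submodule.eq_bot_iff]
  intro y hy
  have hPy : P y = 0 := by
    refine (Submodule.starProjection_apply_eq_zero_iff _).2 ?_
    rw [Submodule.mem_orthogonal]
    intro z hz
    exact inner_eigen_eq_zero hA (Ne.symm hlS) hz hy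
  have hyB : y ∈ eigen B l := by
    rw [mem_eigen, hBapp, hPy, sub_zero]
    exact mem_eigen.1 hy
  rw [hl.eigen_eq_bot] at hyB
  exact hyB

end Isolated

theorem eventually_sq_notMem {N : Set ℝ} (hN : ∀ S : ℝ, S ≠ 0 → ∀ᶠ l in 𝓝[≠] S, l ∉ N) {τ : ℝ}
    (hτ : 0 < τ) : ∀ᶠ ρ in 𝓝[≠] τ, ρ ^ 2 ∉ N := by
  have h1 : Tendsto (fun ρ : ℝ => ρ ^ 2) (𝓝[≠] τ) (𝓝[≠] (τ ^ 2)) := by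
    refine tendsto_nhdsWithin_iff.2
      ⟨((continuous_pow 2).tendsto τ).mono_left nhdsWithin_le_nhds, ?_⟩
    filter_upwards [self_mem_nhdsWithin,
      nhdsWithin_le_nhds (isOpen_Ioi.mem_nhds (Set.mem_Ioi.2 hτ))] with ρ h2 h3 h4
    exact h2 ((pow_left_inj₀ (le_of_lt h3) hτ.le two_ne_zero).1 h4)
  exact h1.eventually (hN _ (by positivity))

theorem isolated_sSup_mem {s : Set ℝ} (hne : s.Nonempty) (hb : BddAbove s)
    (h : ∀ᶠ x in 𝓝[≠] sSup s, x ∉ s) : sSup s ∈ s := by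
  by_contra hcon
  have h1 := (isLUB_csSup hne hb).frequently_mem hne
  refine h1 (nhdsWithin_le_nhds ?_)
  filter_upwards [eventually_nhdsWithin_iff.1 h] with x hx hxs
  by_cases hxe : x = sSup s
  · exact hcon (hxe ▸ hxs)
  · exact hx hxe hxs

theorem isolated_sInf_mem {s : Set ℝ} (hne : s.Nonempty) (hb : BddBelow s)
    (h : ∀ᶠ x in 𝓝[≠] sInf s, x ∉ s) : sInf s ∈ s := by
  by_contra hcon
  have h1 := (isGLB_csInf hne hb).frequently_mem hne
  refine h1 (nhdsWithin_le_nhds ?_)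
  filter_upwards [eventually_nhdsWithin_iff.1 h] with x hx hxs
  by_cases hxe : x = sInf s
  · exact hcon (hxe ▸ hxs)
  · exact hx hxe hxs

end

/-! ### Singular values and eigenvalues of the squares -/

theorem eigenspaceSq_hankel (u : C(Circ, ℂ)) (τ : ℝ) :
    eigenspaceSq (hankel u) τ = eigen (hankelSq u) (τ ^ 2) := by
  rw [eigenspaceSq, eigen, Complex.ofReal_pow]
  rfl

theorem eigenspaceSq_shiftedHankel (u : C(Circ, ℂ)) (τ : ℝ) :
    eigenspaceSq (shiftedHankel u) τ = eigen (shiftedHankelSq u) (τ ^ 2) := by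
  rw [eigenspaceSq, eigen, Complex.ofReal_pow]
  rfl

theorem hankelTriple {u : C(Circ, ℂ)} (hu : toL2 u ∈ hardy) :
    HankelTriple (shiftedHankelSq u) (hardyOf u) hardyOne := by
  rw [hardyOf_of_mem hu]
  refine ⟨fun l hl hne h1 => ?_, fun s hs hreg h1 => ?_, fun l hl hne h1 => ?_,
    fun hmom l hl => ?_⟩
  · by_contra! hcon
    exact hne (eigen_shiftedHankelSq_eq_bot hu hl.ne' h1 hcon)
  · by_contra! hcon
    exact not_orthogonal_ker_shiftedHankelSq hu hs hreg h1 hcon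
  · rw [← hankelSq_eq_perturb hu]
    exact exists_eigen_hankelSq_inner_ne hu hl h1 hne
  · rw [← hankelSq_eq_perturb hu]
    exact eigen_hankelSq_eq_bot_of_moments hu hmom hl

theorem eventually_sq_not_eigenvalue (u : C(Circ, ℂ)) {τ : ℝ} (hτ : 0 < τ) :
    ∀ᶠ ρ in 𝓝[≠] τ, ¬ IsSingularValue (shiftedHankel u) ρ := by
  have h1 := eventually_sq_notMem (N := {l | ¬ Regular (shiftedHankelSq u) l})
    (fun S hS => (eventually_regular (symm_shiftedHankelSq u)
      (isCompactOperator_shiftedHankelSq u) hS).mono fun l hl hl' => hl' hl) hτ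
  filter_upwards [h1] with ρ h2 h3
  refine h3.2 ?_
  rw [eigenspaceSq_shiftedHankel]
  exact (not_not.1 h2 : Regular _ _).eigen_eq_bot

theorem regular_of_not_isSingularValue {u : C(Circ, ℂ)} {τ : ℝ} (hτ : 0 < τ)
    (h : ¬ IsSingularValue (shiftedHankel u) τ) : Regular (shiftedHankelSq u) (τ ^ 2) := by
  refine regular_of_eigen_eq_bot (isCompactOperator_shiftedHankelSq u) (by positivity) ?_
  by_contra h1
  exact h ⟨hτ, by rwa [eigenspaceSq_shiftedHankel]⟩

/-- Positive singular values of a compact operator are isolated, so a positive supremum is attained.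
-/
theorem lowerNeighbor_spec (u : C(Circ, ℂ)) {σ : ℝ} (hσ : 0 < σ) :
    0 ≤ lowerNeighbor (shiftedHankel u) σ ∧ lowerNeighbor (shiftedHankel u) σ < σ ∧
      (∀ τ, lowerNeighbor (shiftedHankel u) σ < τ → τ < σ →
        ¬ IsSingularValue (shiftedHankel u) τ) ∧
      (0 < lowerNeighbor (shiftedHankel u) σ →
        IsSingularValue (shiftedHankel u) (lowerNeighbor (shiftedHankel u) σ)) := by
  set s : Set ℝ := {0} ∪ {τ | IsSingularValue (shiftedHankel u) τ ∧ τ < σ} with hs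
  change 0 ≤ sSup s ∧ sSup s < σ ∧ _ ∧ _
  have hb : BddAbove s := by
    refine ⟨σ, ?_⟩
    rintro x (rfl | hx)
    exacts [hσ.le, hx.2.le]
  have h0s : (0 : ℝ) ∈ s := Or.inl rfl
  have h0 : 0 ≤ sSup s := le_csSup hb h0s
  have hmem : 0 < sSup s → IsSingularValue (shiftedHankel u) (sSup s) ∧ sSup s < σ := by
    intro hpos
    have h1 : sSup s ∈ s := by
      refine isolated_sSup_mem ⟨0, h0s⟩ hb ?_
      filter_upwards [eventually_sq_not_eigenvalue u hpos,
        nhdsWithin_le_nhds (isOpen_Ioi.mem_nhds (Set.mem_Ioi.2 hpos))] with x h2 h3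
      rintro (rfl | h4)
      exacts [lt_irrefl (0 : ℝ) h3, h2 h4.1]
    rcases h1 with h1 | h1
    · exact absurd h1 hpos.ne'
    · exact h1
  refine ⟨h0, ?_, fun τ h1 h2 h3 => ?_, fun h => (hmem h).1⟩
  · rcases h0.eq_or_lt with h1 | h1
    · rwa [← h1]
    · exact (hmem h1).2
  · exact absurd (le_csSup hb (Or.inr ⟨h3, h2⟩)) (not_le.2 h1)

theorem upperNeighbor_spec (u : C(Circ, ℂ)) {σ : ℝ} (hσ : 0 < σ) :
    (upperNeighbor (shiftedHankel u) σ = ⊤ ∧ ∀ τ, σ < τ → ¬ IsSingularValue (shiftedHankel u) τ) ∨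
      ∃ b : ℝ, σ < b ∧ upperNeighbor (shiftedHankel u) σ = (b : EReal) ∧
        IsSingularValue (shiftedHankel u) b ∧
        ∀ τ, σ < τ → τ < b → ¬ IsSingularValue (shiftedHankel u) τ := by
  set s : Set ℝ := {τ | IsSingularValue (shiftedHankel u) τ ∧ σ < τ} with hs
  have hup : upperNeighbor (shiftedHankel u) σ = sInf ((fun τ : ℝ => (τ : EReal)) '' s) := rfl
  rcases s.eq_empty_or_nonempty with he | hne
  · refine Or.inl ⟨by rw [hup, he, Set.image_empty, sInf_empty], fun τ h1 h2 => ?_⟩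
    have : τ ∈ s := ⟨h2, h1⟩
    rw [he] at this
    exact this
  · have hb : BddBelow s := ⟨σ, fun x hx => hx.2.le⟩
    have hσb : σ ≤ sInf s := le_csInf hne fun x hx => hx.2.le
    have hmem : sInf s ∈ s := by
      refine isolated_sInf_mem hne hb ?_
      filter_upwards [eventually_sq_not_eigenvalue u (hσ.trans_le hσb)] with x h1 h2
      exact h1 h2.1
    have hleast : IsLeast s (sInf s) := ⟨hmem, fun x hx => csInf_le hb hx⟩
    refine Or.inr ⟨sInf s, hmem.2, ?_, hmem.1, fun τ h1 h2 h3 => ?_⟩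
    · rw [hup]
      have hmono : Monotone fun τ : ℝ => (τ : EReal) := fun _ _ h => EReal.coe_le_coe_iff.2 h
      exact (hmono.map_isLeast hleast).csInf_eq
    · exact absurd (csInf_le hb ⟨h3, h1⟩) (not_le.2 h2)

/-- The gap around `σ` in terms of the spectrum of `K_u²`. -/
theorem exists_gap (u : C(Circ, ℂ)) {σ : ℝ} (hσ : 0 < σ) :
    ∃ (a : ℝ) (J : Set ℝ), 0 ≤ a ∧ a < σ ^ 2 ∧
      (∀ l ∈ Set.Ioo a (σ ^ 2), Regular (shiftedHankelSq u) l) ∧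
      (0 < a → eigen (shiftedHankelSq u) a ≠ ⊥) ∧ (∀ l ∈ J, Regular (shiftedHankelSq u) l) ∧
      (J = Set.Ioi (σ ^ 2) ∨
        ∃ b, σ ^ 2 < b ∧ eigen (shiftedHankelSq u) b ≠ ⊥ ∧ J = Set.Ioo (σ ^ 2) b) ∧
      ∀ τ, 0 < τ → (τ ∈ gap (shiftedHankel u) σ ∧ τ ≠ σ ↔ τ ^ 2 ∈ Set.Ioo a (σ ^ 2) ∪ J) := by
  obtain ⟨hL0, hLσ, hLreg, hLsv⟩ := lowerNeighbor_spec u hσ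
  set L := lowerNeighbor (shiftedHankel u) σ with hL
  have hlow : ∀ l ∈ Set.Ioo (L ^ 2) (σ ^ 2), Regular (shiftedHankelSq u) l := by
    intro l hl
    have hl0 : 0 < l := (sq_nonneg L).trans_lt hl.1
    rw [← Real.sq_sqrt hl0.le]
    exact regular_of_not_isSingularValue (Real.sqrt_pos.2 hl0)
      (hLreg _ ((Real.lt_sqrt hL0).2 hl.1) ((Real.sqrt_lt' hσ).2 hl.2))
  have hlowE : 0 < L ^ 2 → eigen (shiftedHankelSq u) (L ^ 2) ≠ ⊥ := by
    intro h
    rw [← eigenspaceSq_shiftedHankel]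
    exact (hLsv (hL0.lt_of_ne fun h0 => by simp [← h0] at h)).2
  have hlt : ∀ {x y : ℝ}, 0 ≤ x → 0 ≤ y → (x ^ 2 < y ^ 2 ↔ x < y) := fun hx hy =>
    pow_lt_pow_iff_left₀ hx hy two_ne_zero
  rcases upperNeighbor_spec u hσ with ⟨htop, hreg⟩ | ⟨b, hσb, hup, hsv, hreg⟩
  · refine ⟨L ^ 2, Set.Ioi (σ ^ 2), sq_nonneg L, (hlt hL0 hσ.le).2 hLσ, hlow, hlowE,
      fun l hl => ?_, Or.inl rfl, fun τ hτ => ?_⟩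
    · have hl0 : 0 < l := (sq_nonneg σ).trans_lt hl
      rw [← Real.sq_sqrt hl0.le]
      exact regular_of_not_isSingularValue (Real.sqrt_pos.2 hl0)
        (hreg _ ((Real.lt_sqrt hσ.le).2 hl))
    · simp only [gap, htop, ← hL, Set.mem_ofPred_eq, Set.mem_union, Set.mem_Ioo, Set.mem_Ioi,
        hlt hL0 hτ.le, hlt hτ.le hσ.le, hlt hσ.le hτ.le, EReal.coe_lt_top, and_true]
      constructor
      · rintro ⟨h1, h2⟩
        exact h2.lt_or_gt.imp (fun h3 => ⟨h1, h3⟩) id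
      · rintro (h1 | h1)
        exacts [⟨h1.1, h1.2.ne⟩, ⟨hLσ.trans h1, h1.ne'⟩]
  · have hb0 : 0 < b := hσ.trans hσb
    refine ⟨L ^ 2, Set.Ioo (σ ^ 2) (b ^ 2), sq_nonneg L, (hlt hL0 hσ.le).2 hLσ, hlow, hlowE,
      fun l hl => ?_, Or.inr ⟨b ^ 2, (hlt hσ.le hb0.le).2 hσb, ?_, rfl⟩, fun τ hτ => ?_⟩
    · have hl0 : 0 < l := (sq_nonneg σ).trans_lt hl.1
      rw [← Real.sq_sqrt hl0.le]
      exact regular_of_not_isSingularValue (Real.sqrt_pos.2 hl0)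
        (hreg _ ((Real.lt_sqrt hσ.le).2 hl.1) ((Real.sqrt_lt' hb0).2 hl.2))
    · rw [← eigenspaceSq_shiftedHankel]
      exact hsv.2
    · simp only [gap, hup, ← hL, Set.mem_ofPred_eq, Set.mem_union, Set.mem_Ioo,
        hlt hL0 hτ.le, hlt hτ.le hσ.le, hlt hσ.le hτ.le, hlt hτ.le hb0.le, EReal.coe_lt_coe_iff]
      constructor
      · rintro ⟨h1, h2⟩
        exact h2.lt_or_gt.imp (fun h3 => ⟨h1.1, h3⟩) (fun h3 => ⟨h3, h1.2⟩)
      · rintro (h1 | h1)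
        exacts [⟨⟨h1.1, h1.2.trans hσb⟩, h1.2.ne⟩, ⟨⟨hLσ.trans h1.1, h1.2⟩, h1.1.ne'⟩]

end AlphaSzego

end

/-! ### The theorem, translated back to singular values -/

open AlphaSzego
theorem proposition4p2 (α : ℝ) (hα : α ≠ 0) (s : ℝ) (hs : 1 < s)
    (u₀ : C(Circ, ℂ)) (hu₀ : u₀ ∈ sobolevPlus s)
    (u : ℝ → C(Circ, ℂ)) (hu : IsSolution s α u) (hinit : u 0 = u₀)
    (σ : ℝ) (hσ : 0 < σ) (m : ℕ) (hm : 1 ≤ m)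
    (hmult : multiplicity (shiftedHankel u₀) σ = (m : Cardinal)) :
    ((∀ t : ℝ, multiplicity (hankel (u t)) σ = ((m + 1 : ℕ) : Cardinal)) ∧ IsSolution s 0 u) ∨
    (∃ (Tc : Set ℝ) (ρ₁ ρ₂ : ℝ → ℝ), IsClosed Tc ∧ IsDiscrete Tc ∧
      AnalyticOnNhd ℝ ρ₁ Tcᶜ ∧ AnalyticOnNhd ℝ ρ₂ Tcᶜ ∧
      ∀ t ∉ Tc, ρ₂ t < σ ∧ σ < ρ₁ t ∧
        {τ ∈ gap (shiftedHankel u₀) σ | IsSingularValue (hankel (u t)) τ ∧ τ ≠ σ} =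
          {ρ₁ t, ρ₂ t} ∧
        multiplicity (hankel (u t)) (ρ₁ t) = 1 ∧ multiplicity (hankel (u t)) (ρ₂ t) = 1 ∧
        multiplicity (hankel (u t)) σ = ((m - 1 : ℕ) : Cardinal)) ∨
    (IsSolution s 0 u ∧ ∀ t : ℝ,
      multiplicity (hankel (u t)) σ = ((m - 1 : ℕ) : Cardinal) ∧
      ∀ τ ∈ gap (shiftedHankel u₀) σ, τ ≠ σ → ¬ IsSingularValue (hankel (u t)) τ) := by
  subst hinit
  have hmem : ∀ t, toL2 (u t) ∈ hardy := fun t => (hu.mem t).1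
  obtain ⟨v, w, hflow, htriple, hq, hrank⟩ :=
    (hu.laxFlow hs.le).exists_modeFlow fun t => hankelTriple (hmem t)
  obtain ⟨a, J, ha, haσ, hregL, haE, hregJ, hJ, hgap⟩ := exists_gap (u 0) hσ
  -- Unitary equivalence reduces all the operators `H_{u(t)}²` to perturbations of the single
  -- operator `K_{u(0)}²`.
  have hmul : ∀ t τ, multiplicity (hankel (u t)) τ =
      Module.rank ℂ (eigen (perturb (shiftedHankelSq (u 0)) (v t)) (τ ^ 2)) := by
    intro t τ
    rw [hrank, hardyOf_of_mem (hmem t), ← hankelSq_eq_perturb, AlphaSzego.multiplicity, eigenspaceSq_hankel]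
  have hsv : ∀ t τ, IsSingularValue (hankel (u t)) τ ↔
      0 < τ ∧ eigen (perturb (shiftedHankelSq (u 0)) (v t)) (τ ^ 2) ≠ ⊥ := by
    intro t τ
    rw [IsSingularValue, ne_eq, ne_eq, ← Submodule.rank_eq_zero, ← Submodule.rank_eq_zero, ← hmul]
    rfl
  have hcubic : (∀ t, inner ℂ (w t) (v t) = 0) → IsSolution s 0 u := fun h0 =>
    hu.cubic fun t => by rw [← inner_hardyOne_hardyOf (hmem t), ← hq t, h0 t]
  have hm' : Module.rank ℂ (eigen (shiftedHankelSq (u 0)) (σ ^ 2)) = m := by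
    rw [← eigenspaceSq_shiftedHankel]
    exact hmult
  have hJσ : ∀ l ∈ J, σ ^ 2 < l := by
    rcases hJ with rfl | ⟨b, -, -, rfl⟩
    exacts [fun l hl => hl, fun l hl => hl.1]
  rcases hflow.spectral_trichotomy htriple hα ha haσ hm' hm hregL haE hregJ hJ with
    ⟨h1, h2⟩ | ⟨Tc, ρ₁, ρ₂, hcl, hdisc, han₁, han₂, h1⟩ | ⟨h1, h2⟩
  · exact Or.inl ⟨fun t => (hmul t σ).trans (h1 t), hcubic h2⟩
  · refine Or.inr (Or.inl ⟨Tc, ρ₁, ρ₂, hcl, hdisc, han₁, han₂, fun t ht => ?_⟩)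
    obtain ⟨⟨hp₁, hm₁⟩, ⟨hp₂, hm₂⟩, huniq, hr₁, hr₂, hr⟩ := h1 t ht
    refine ⟨(pow_lt_pow_iff_left₀ hp₂.le hσ.le two_ne_zero).1 hm₂.2,
      (pow_lt_pow_iff_left₀ hσ.le hp₁.le two_ne_zero).1 (hJσ _ hm₁), ?_,
      (hmul t _).trans hr₁, (hmul t _).trans hr₂, (hmul t σ).trans hr⟩
    have hne : ∀ τ, Module.rank ℂ (eigen (perturb (shiftedHankelSq (u 0)) (v t)) (τ ^ 2)) = 1 →
        eigen (perturb (shiftedHankelSq (u 0)) (v t)) (τ ^ 2) ≠ ⊥ := by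
      intro τ h2
      rw [ne_eq, ← Submodule.rank_eq_zero, h2]
      exact one_ne_zero
    ext τ
    simp only [Set.mem_ofPred_eq, Set.mem_insert_iff, Set.mem_singleton_iff]
    constructor
    · rintro ⟨hg, hs', hτσ⟩
      obtain ⟨hτ, hτne⟩ := (hsv t τ).1 hs'
      exact (huniq _ ((hgap τ hτ).1 ⟨hg, hτσ⟩) hτne).imp
        (pow_left_inj₀ hτ.le hp₁.le two_ne_zero).1 (pow_left_inj₀ hτ.le hp₂.le two_ne_zero).1
    · rintro (rfl | rfl)
      · obtain ⟨h2, h3⟩ := (hgap _ hp₁).2 (Or.inr hm₁)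
        exact ⟨h2, (hsv t _).2 ⟨hp₁, hne _ hr₁⟩, h3⟩
      · obtain ⟨h2, h3⟩ := (hgap _ hp₂).2 (Or.inl hm₂)
        exact ⟨h2, (hsv t _).2 ⟨hp₂, hne _ hr₂⟩, h3⟩
  · refine Or.inr (Or.inr ⟨hcubic h1, fun t => ⟨(hmul t σ).trans (h2 t).1, fun τ hg hτσ hs' => ?_⟩⟩)
    obtain ⟨hτ, hτne⟩ := (hsv t τ).1 hs'
    exact hτne ((h2 t).2 _ ((hgap τ hτ).1 ⟨hg, hτσ⟩))
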